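/- For $t\in\mathbb C\setminus\{0,1\}$ let $E_t$ be the elliptic curve $y^2=x(x-1)(x-t)$, with zero point $O$, and let $\pi:E\setminus\mathcal S\to\mathbb C\setminus\{0,1\}$ be the complex surface formed by the curves $E_t$ (the part of good reduction of the Legendre scheme), a complex submanifold of $(\mathbb C\setminus\{0,1\})\times\mathbb P^2(\mathbb C)$. Write $O$ also for the zero section. Let $H_N:E\setminus(\mathcal S\cup O)\to\mathbb R$ be the archimedean Néron local height: on each $E_t\setminus\{O\}$ it is the unique function that is continuous, bounded on the complement of every neighbourhood of $O$, for which $H_N-\frac12\log|x|$ has a limit at $O$, and that satisfies $H_N([2]P)=4H_N(P)-\log|2y(P)|+\frac14\log|\Delta_t|$ whenever $[2]P\ne O$, where $\Delta_t=16t^2(t-1)^2$. With $d^c=\partial-\bar\partial$, so that $\frac1{2\pi i}dd^c=\frac i\pi\partial\bar\partial$, let $T$ be the DeMarco–Mavraki current: the real current of degree $2$ on $E\setminus\mathcal S$ that has locally continuous potentials (locally $T=\frac1{2\pi i}dd^cg$ with $g$ continuous) and is equal to $\frac1{2\pi i}dd^cH_N$ on $E\setminus(\mathcal S\cup O)$.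 Let $D\subset\mathbb C\setminus\{0,1\}$ be open and let $\rho_1,\rho_2$ be holomorphic functions on $D$ with $\operatorname{Im}(\rho_2/\rho_1)>0$ such that, for $t\in D$, the lattice $\Lambda_t=\mathbb Z\rho_1(t)+\mathbb Z\rho_2(t)$ has $g_2(\Lambda_t)=-4u$ and $g_3(\Lambda_t)=-4v$, where $y^2=x^3+ux+v$ is the equation obtained from $y^2=x(x-1)(x-t)$ by $x\mapsto x+\frac{1+t}3$. The Betti coordinates $\beta_1,\beta_2$ of a point $P$ over $t\in D$ are the real numbers (determined modulo $\mathbb Z$) such that $z=\beta_1\rho_1(t)+\beta_2\rho_2(t)$ is a value of the abelian logarithm at $P$, i.e. $P$ is the image of $z$ under $\mathbb C/\Lambda_t\cong E_t$, $z\mapsto(\wp(z)+\frac{1+t}3,\frac12\wp'(z))$. The form $d\beta_1\wedge d\beta_2$ on $E\setminus\mathcal S$ is the one computed from smooth local branches of these coordinates. Then $T$ is the current associated to $d\beta_1\wedge d\beta_2$. More precisely, on every holomorphic chart of $E\setminus\mathcal S$ on which a smooth real-valued branch $(\beta_1,\beta_2)$ of the Betti coordinates is defined, a current of degree $2$ has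 locally continuous potentials and equals $\frac1{2\pi i}dd^cH_N$ off $O$ if and only if it is the current $\psi\mapsto\int\psi\wedge d\beta_1\wedge d\beta_2$. -/

import Mathlib

open MeasureTheory Filter Topology TopologicalSpace
open scoped Distributions ContDiff

noncomputable section

namespace LegendreCurrent

/-! ## The Legendre scheme over the locus of good reduction -/

/-- The Legendre curve `y² = x (x - 1) (x - t)` as a Weierstrass curve. -/
def legendre (t : ℂ) : WeierstrassCurve ℂ := ⟨0, -(1 + t), 0, t, 0⟩

theorem legendre_equation_iff (t x y : ℂ) :
    (legendre t).toAffine.Equation x y ↔ y ^ 2 = x * (x - 1) * (x - t) := by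
  rw [WeierstrassCurve.Affine.equation_iff]
  simp only [legendre]
  constructor <;> intro h <;> linear_combination h

/-- The complex points of the Legendre elliptic scheme over `ℙ¹ ∖ {0, 1, ∞}`. -/
structure LegendreScheme where
  /-- The parameter of the fibre. -/
  base : ℂ
  base_ne_zero : base ≠ 0
  base_ne_one : base ≠ 1
  /-- The point of the fibre. -/
  point : (legendre base).toAffine.Point

/-- `v = (X, Y, Z)` is a vector of homogeneous coordinates in `ℙ²(ℂ)` of the point `P`. -/
def IsHomogeneousCoord {W : WeierstrassCurve ℂ} (v : Fin 3 → ℂ) : W.toAffine.Point → Prop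
  | .zero => v 0 = 0 ∧ v 1 ≠ 0 ∧ v 2 = 0
  | .some x y _ => v 2 ≠ 0 ∧ v 0 = x * v 2 ∧ v 1 = y * v 2

/-- The coordinate space of the complex surface. -/
abbrev C2 : Type := Fin 2 → ℂ

/-- A holomorphic chart of the complex surface `E ∖ 𝒮 ⊆ (ℂ ∖ {0, 1}) × ℙ²(ℂ)`, given by its inverse:
an injective holomorphic immersion of an open subset of `ℂ²` into the surface. Holomorphy is
tested on the parameter of the fibre and on a local lift `F` of the point to `ℂ³ ∖ {0}`; the
last condition says that the differential of the resulting map to `ℂ × ℙ²(ℂ)` is injective. -/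
structure Chart where
  domain : Opens C2
  toFun : C2 → LegendreScheme
  injOn : Set.InjOn toFun domain
  analyticAt_base : ∀ p ∈ domain, AnalyticAt ℂ (fun q => (toFun q).base) p
  immersion : ∀ p ∈ domain, ∃ F : C2 → Fin 3 → ℂ, AnalyticAt ℂ F p ∧
    (∀ᶠ q in 𝓝 p, IsHomogeneousCoord (F q) (toFun q).point) ∧
    ∀ v : C2, fderiv ℂ (fun q => (toFun q).base) p v = 0 →
      (∃ c : ℂ, fderiv ℂ F p v = c • F p) → v = 0

/-! ## The archimedean Néron local height -/

/-- The conditions that characterize the Néron local height `H : W(ℂ) ∖ {O} → ℝ` at the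
archimedean place, with `v = -log |·|` (the value of `H` at `O` plays no role): `H` is continuous,
it is bounded on the complement of every neighbourhood of `O`, the difference `H - log |x| / 2` has
a limit at `O`, and `H (2P) = 4 H (P) - log |2 y + a₁ x + a₃| + log |Δ| / 4` whenever `2P ≠ O`. -/
structure IsNeronLocalHeight (W : WeierstrassCurve ℂ) (H : W.toAffine.Point → ℝ) : Prop where
  continuous : Continuous fun p : {p : ℂ × ℂ // W.toAffine.Nonsingular p.1 p.2} =>
    H (.some p.1.1 p.1.2 p.2)
  bounded : ∀ R : ℝ, ∃ C : ℝ, ∀ (x y : ℂ) (h : W.toAffine.Nonsingular x y),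
    ‖x‖ ≤ R → |H (.some x y h)| ≤ C
  limit : ∃ l : ℝ, ∀ ε > 0, ∃ R : ℝ, ∀ (x y : ℂ) (h : W.toAffine.Nonsingular x y),
    R < ‖x‖ → |H (.some x y h) - 1 / 2 * Real.log ‖x‖ - l| < ε
  duplication : ∀ (x y : ℂ) (h : W.toAffine.Nonsingular x y),
    (2 • (.some x y h : W.toAffine.Point)) ≠ 0 →
      H (2 • (.some x y h : W.toAffine.Point)) =
        4 * H (.some x y h) - Real.log ‖2 * y + W.a₁ * x + W.a₃‖ + 1 / 4 * Real.log ‖W.Δ‖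

/-- The Néron local height of `W` at the archimedean place. -/
def neronLocalHeight (W : WeierstrassCurve ℂ) : W.toAffine.Point → ℝ :=
  Classical.epsilon (IsNeronLocalHeight W)

/-- The function `H_N` on the Legendre scheme (used only off the zero section). -/
def neronHeight (P : LegendreScheme) : ℝ := neronLocalHeight (legendre P.base) P.point

/-! ## Periods, the abelian logarithm and the Betti map -/

/-- A holomorphic choice of oriented periods of the Legendre curves over the open set `D`. The
substitution `x ↦ x + (1 + t) / 3` turns the Legendre equation into `y² = x³ + u x + v` with
`u = t - (1 + t)² / 3` and `v = t (1 + t) / 3 - 2 (1 + t)³ / 27`, and the lattice is the one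
with `g₂ = -4 u` and `g₃ = -4 v`. -/
structure IsPeriodFamily (D : Set ℂ) (L : ℂ → PeriodPair) : Prop where
  isOpen : IsOpen D
  zero_notMem : (0 : ℂ) ∉ D
  one_notMem : (1 : ℂ) ∉ D
  holomorphic₁ : DifferentiableOn ℂ (fun t => (L t).ω₁) D
  holomorphic₂ : DifferentiableOn ℂ (fun t => (L t).ω₂) D
  oriented : ∀ t ∈ D, 0 < ((L t).ω₂ / (L t).ω₁).im
  g₂_eq : ∀ t ∈ D, (L t).g₂ = -4 * (t - (1 + t) ^ 2 / 3)
  g₃_eq : ∀ t ∈ D, (L t).g₃ = -4 * (t * (1 + t) / 3 - 2 * (1 + t) ^ 3 / 27)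

/-- `z` is a value of the abelian logarithm at `P`: the uniformization
`z ↦ (℘(z) + (1 + t) / 3, ℘'(z) / 2)` of the Legendre curve maps `z` to `P`. -/
def IsAbelianLog (L : PeriodPair) (t z : ℂ) : (legendre t).toAffine.Point → Prop
  | .zero => z ∈ L.lattice
  | .some x y _ => z ∉ L.lattice ∧ x = L.weierstrassP z + (1 + t) / 3 ∧
      y = L.derivWeierstrassP z / 2

/-- `(β₁, β₂)` is a smooth real-valued branch, in the chart `c`, of the Betti map with respect to
the periods `L` over `D`: `log P = β₁(P) ρ₁(π(P)) + β₂(P) ρ₂(π(P))`. -/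
structure IsBettiBranch (c : Chart) (D : Set ℂ) (L : ℂ → PeriodPair) (β₁ β₂ : C2 → ℝ) :
    Prop where
  base_mem : ∀ p ∈ c.domain, (c.toFun p).base ∈ D
  smooth₁ : ContDiffOn ℝ ∞ β₁ c.domain
  smooth₂ : ContDiffOn ℝ ∞ β₂ c.domain
  isLog : ∀ p ∈ c.domain, IsAbelianLog (L (c.toFun p).base) (c.toFun p).base
    (β₁ p * (L (c.toFun p).base).ω₁ + β₂ p * (L (c.toFun p).base).ω₂) (c.toFun p).point

/-! ## Differential forms and currents on open subsets of `ℂ²` -/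

/-- Real alternating forms of degree `n` on `ℂ²`. -/
abbrev Alt (n : ℕ) : Type := C2 [⋀^Fin n]→L[ℝ] ℝ

instance instNormedAddCommGroupAlt (n : ℕ) : NormedAddCommGroup (Alt n) := inferInstance

instance instNormedSpaceAlt (n : ℕ) : NormedSpace ℝ (Alt n) := inferInstance

/-- The oriented real basis `∂/∂x₁, ∂/∂y₁, ∂/∂x₂, ∂/∂y₂` of `ℂ²`. -/
def frame : Fin 4 → C2 :=
  ![Pi.single 0 1, Pi.single 0 Complex.I, Pi.single 1 1, Pi.single 1 Complex.I]

/-- The wedge product of two `2`-forms, as its value on `frame`. -/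
def wedge : Alt 2 →L[ℝ] Alt 2 →L[ℝ] ℝ :=
  let m (i j k l : Fin 4) : Alt 2 →L[ℝ] Alt 2 →L[ℝ] ℝ :=
    (ContinuousLinearMap.mul ℝ ℝ).bilinearComp
      (ContinuousAlternatingMap.apply ℝ C2 ℝ ![frame i, frame j])
      (ContinuousAlternatingMap.apply ℝ C2 ℝ ![frame k, frame l])
  m 0 1 2 3 - m 0 2 1 3 + m 0 3 1 2 + m 1 2 0 3 - m 1 3 0 2 + m 2 3 0 1

theorem wedge_apply (a b : Alt 2) :
    wedge a b =
      a ![frame 0, frame 1] * b ![frame 2, frame 3]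
      - a ![frame 0, frame 2] * b ![frame 1, frame 3]
      + a ![frame 0, frame 3] * b ![frame 1, frame 2]
      + a ![frame 1, frame 2] * b ![frame 0, frame 3]
      - a ![frame 1, frame 3] * b ![frame 0, frame 2]
      + a ![frame 2, frame 3] * b ![frame 0, frame 1] := rfl

/-- Pull-back of a form under multiplication by `s` on `ℂ²`. -/
def pullMul (s : ℂ) {n : ℕ} (a : Alt n) : Alt n :=
  a.compContinuousLinearMap (s • ContinuousLinearMap.id ℝ C2)

/-- The real operator `i (∂̄ - ∂) = C⁻¹ d C` on forms, where `C` is the pull-back under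
multiplication by `i` (it multiplies forms of type `(p, q)` by `i ^ (p - q)`). With
`d^c = ∂ - ∂̄` this operator is `d^c / i`, so that `(1 / 2πi) d d^c = (1 / 2π) d ∘ dcReal`, which is
`(i / π) ∂∂̄`. -/
def dcReal {n : ℕ} (ψ : C2 → Alt n) (p : C2) : Alt (n + 1) :=
  pullMul (-Complex.I) (extDeriv (fun q => pullMul Complex.I (ψ q)) p)

/-- The `4`-form `(1 / 2πi) d d^c ψ = (i / π) ∂∂̄ψ` of a `2`-form `ψ`, as its coefficient with
respect to the volume form `dx₁ ∧ dy₁ ∧ dx₂ ∧ dy₂`. -/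
def normalizedDdc (ψ : C2 → Alt 2) (p : C2) : ℝ :=
  1 / (2 * Real.pi) * extDeriv (dcReal ψ) p frame

/-- Real currents of degree `2` on `Ω`: continuous linear functionals on the smooth real `2`-forms
with compact support in `Ω`. -/
abbrev Current (Ω : Opens C2) : Type := 𝓓(Ω, Alt 2) →L[ℝ] ℝ

/-- The current `ψ ↦ ∫_Ω ψ ∧ η` associated to a locally integrable `2`-form `η` on `Ω`. -/
def formCurrent (Ω : Opens C2) (η : C2 → Alt 2) : Current Ω :=
  TestFunction.integralAgainstBilinCLM wedge volume η

/-- On the subset `V` of `Ω` the current `T` is `(1 / 2πi) d d^c u`, where `u` is a locally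
integrable function: `T ψ = ∫ u (1 / 2πi) d d^c ψ` for every test form `ψ` with support in `V`. -/
def HasPotentialOn {Ω : Opens C2} (T : Current Ω) (V : Set C2) (u : C2 → ℝ) : Prop :=
  LocallyIntegrableOn u V volume ∧
    ∀ ψ : 𝓓(Ω, Alt 2), tsupport ψ ⊆ V → T ψ = ∫ p in V, u p * normalizedDdc ψ p

/-- The `2`-form `df ∧ dg` of two real functions. -/
def wedgeD (f g : C2 → ℝ) (p : C2) : Alt 2 :=
  ((ContinuousMultilinearMap.mkPiAlgebra ℝ (Fin 2) ℝ).compContinuousLinearMap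
    ![fderiv ℝ f p, fderiv ℝ g p]).alternatization

theorem wedgeD_apply (f g : C2 → ℝ) (p : C2) (v : Fin 2 → C2) :
    wedgeD f g p v = fderiv ℝ f p (v 0) * fderiv ℝ g p (v 1)
      - fderiv ℝ f p (v 1) * fderiv ℝ g p (v 0) := by
  have h : (Finset.univ : Finset (Equiv.Perm (Fin 2))) = {1, Equiv.swap 0 1} := by decide
  have h' : (1 : Equiv.Perm (Fin 2)) ≠ Equiv.swap 0 1 := by decide
  simp [wedgeD, ContinuousMultilinearMap.alternatization_apply_apply, Fin.prod_univ_two, h,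
    Finset.sum_pair h', ← sub_eq_add_neg]

/-- `T` is the expression in the chart `c` of the DeMarco-Mavraki current: it has locally continuous
potentials, and off the zero section it is `(1 / 2πi) d d^c H_N`. -/
def IsDeMarcoMavraki (c : Chart) (T : Current c.domain) : Prop :=
  (∀ p ∈ c.domain, ∃ V : Set C2, IsOpen V ∧ p ∈ V ∧ V ⊆ c.domain ∧
    ∃ g : C2 → ℝ, ContinuousOn g V ∧ HasPotentialOn T V g) ∧
  HasPotentialOn T {p | p ∈ c.domain ∧ (c.toFun p).point ≠ 0} (fun p => neronHeight (c.toFun p))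

end LegendreCurrent

end

/-!
The current of `dβ₁ ∧ dβ₂` has an explicit smooth potential. With `τ = ω₂ / ω₁` the abelian
logarithm divided by `ω₁` is `ζ = β₁ + β₂ τ`, and `(1 / 2πi) dd^c (π β₂² Im τ) = dβ₁ ∧ dβ₂`
(`ddcPair_bettiPotential`, `formCurrent_apply`). The only input for this identity is that `ζ` and
`τ` are holomorphic in the chart. For `ζ` the smoothness of the Betti coordinates is given, and only
the Cauchy-Riemann equations remain. The coordinate `y` is `-ω₁⁻³ ∑ (ζ - m - nτ)⁻³`, holomorphic in
`(ζ, τ)`, so the equations follow from those for `y` wherever the derivative in `ζ` does not vanish.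
Such points are dense because a chart is an immersion (`exists_generic_point`,
`fderiv_zeta_I_smul`).

The same function `π β₂² Im τ` is the quadratic part of the Néron local height. Let
`S(ζ, τ) = sin (π ζ) ∏ (1 - qⁿ w) (1 - qⁿ / w)` with `q = exp (2πiτ)` and `w = exp (2πiζ)`, a sigma
function up to an exponential factor. Then

  `H_N = π β₂² Im τ - log |S(ζ, τ)| + log |∂S/∂ζ (0, τ)| - log |ω₁| - log |Δ_t| / 12`.

Indeed, the right-hand side is periodic in `ζ`, and the formula `℘'(z) = -σ(2z) / σ(z)⁴` shows that
it satisfies the duplication law (`isNeronLocalHeight`). The difference of two functions with the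
characterizing properties is bounded and is multiplied by four under doubling, so it vanishes
(`neronLocalHeight_unique`). The uniformization by `℘` and `℘'` and the duplication formulas are
derived from the product for `S`: an entire function with trivial multipliers is constant
(`eq_const_of_quasiperiodic`). Off the zero section the terms other than `π β₂² Im τ` are logarithms
of absolute values of holomorphic functions without zeros, so they are pluriharmonic
(`isWeaklyPluriharmonicOn_neronHeight_sub`). This shows that the current of `dβ₁ ∧ dβ₂` has
continuous potentials and is `(1 / 2πi) dd^c H_N` off the zero section.

Conversely, let `g` be a continuous local potential of a current that has these two properties. Then
`g - π β₂² Im τ` is continuous, and it is pluriharmonic off the zero section. The zero section is a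
smooth complex hypersurface, locally `X / Y = 0` (`Chart.exists_zeroSection_equation`), with tubular
neighbourhoods of radius `r` of volume `O(r²)`. A cut-off in `log |X / Y|` therefore shows that
`g - π β₂² Im τ` is pluriharmonic across it (`IsWeaklyPluriharmonicOn.of_inter_ne`). So the current
agrees locally, hence globally (`current_eq_zero_of_local`), with that of `dβ₁ ∧ dβ₂`.
-/

noncomputable section

namespace LegendreCurrent

/-! ### The operator `ddᶜ` in coordinates and integration by parts -/

/-- The second derivative `D_v D_{-i w} u`. Antisymmetrised in `(v, w)` it is
`(dd^c / i) u (v, w)`. -/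
def ddcPair (u : C2 → ℝ) (p v w : C2) : ℝ :=
  fderiv ℝ (fun q => fderiv ℝ u q (-Complex.I • w)) p v

theorem contDiff_pullMul {n : ℕ} {ψ : C2 → Alt n} (hψ : ContDiff ℝ ∞ ψ) (s : ℂ) :
    ContDiff ℝ ∞ (fun q => pullMul s (ψ q)) :=
  (ContinuousAlternatingMap.compContinuousLinearMapCLM (F := ℝ) (ι := Fin n)
    (s • ContinuousLinearMap.id ℝ C2)).contDiff.comp hψ

/-- The value of `dcReal` on three vectors. The two multiplications by `i` act on the arguments of
`ψ` by `i · (-i) = 1`, so that only the direction of differentiation is rotated. -/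
theorem dcReal_apply {ψ : C2 → Alt 2} (hψ : ContDiff ℝ ∞ ψ) (p : C2) (v : Fin 3 → C2) :
    dcReal ψ p v =
      fderiv ℝ (fun q => ψ q ![v 1, v 2]) p (-Complex.I • v 0)
      - fderiv ℝ (fun q => ψ q ![v 0, v 2]) p (-Complex.I • v 1)
      + fderiv ℝ (fun q => ψ q ![v 0, v 1]) p (-Complex.I • v 2) := by
  have hd := (contDiff_pullMul hψ Complex.I).differentiable (by simp)
  have key : ∀ a b : C2, (fun q => ψ q ![Complex.I • -Complex.I • a, Complex.I • -Complex.I • b])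
      = fun q => ψ q ![a, b] := by
    intro a b
    simp [smul_smul]
  have e : dcReal ψ p v = extDeriv (fun q => pullMul Complex.I (ψ q)) p
      (fun i => -Complex.I • v i) := rfl
  rw [e, extDeriv_apply (hd p), Fin.sum_univ_three]
  have h0 : (fun q => pullMul Complex.I (ψ q) ((0 : Fin 3).removeNth fun i => -Complex.I • v i))
      = fun q => ψ q ![v 1, v 2] := by
    rw [← key]; funext q; simp only [pullMul]
    refine congrArg (ψ q) (funext fun i => ?_); fin_cases i <;> rfl
  have h1 : (fun q => pullMul Complex.I (ψ q) ((1 : Fin 3).removeNth fun i => -Complex.I • v i))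
      = fun q => ψ q ![v 0, v 2] := by
    rw [← key]; funext q; simp only [pullMul]
    refine congrArg (ψ q) (funext fun i => ?_); fin_cases i <;> rfl
  have h2 : (fun q => pullMul Complex.I (ψ q) ((2 : Fin 3).removeNth fun i => -Complex.I • v i))
      = fun q => ψ q ![v 0, v 1] := by
    rw [← key]; funext q; simp only [pullMul]
    refine congrArg (ψ q) (funext fun i => ?_); fin_cases i <;> rfl
  rw [h0, h1, h2]
  simp

/-- The coefficient of `ψ` on the pair of frame vectors `k, l`. -/
abbrev coeff (ψ : C2 → Alt 2) (k l : Fin 4) (p : C2) : ℝ := ψ p ![frame k, frame l]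

theorem contDiff_apply_alt {ψ : C2 → Alt 2} (hψ : ContDiff ℝ ∞ ψ) (v : Fin 2 → C2) :
    ContDiff ℝ ∞ (fun p => ψ p v) :=
  (ContinuousAlternatingMap.apply ℝ C2 ℝ v).contDiff.comp hψ

theorem contDiff_fderiv_apply_const {f : C2 → ℝ} (hf : ContDiff ℝ ∞ f) (v : C2) :
    ContDiff ℝ ∞ (fun p => fderiv ℝ f p v) :=
  (hf.fderiv_right (m := ∞) (by simp)).clm_apply contDiff_const

theorem contDiff_dcReal {ψ : C2 → Alt 2} (hψ : ContDiff ℝ ∞ ψ) : ContDiff ℝ ∞ (dcReal ψ) := by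
  exact contDiff_pullMul ((ContinuousAlternatingMap.alternatizeUncurryFinCLM ℝ C2 ℝ).contDiff.comp
    ((contDiff_pullMul hψ Complex.I).fderiv_right (m := ∞) (by simp))) (-Complex.I)

/-- The coordinate expression of `(i / π) ∂∂̄ψ`: the signs are those of the wedge product. -/
theorem normalizedDdc_eq {ψ : C2 → Alt 2} (hψ : ContDiff ℝ ∞ ψ) (p : C2) :
    normalizedDdc ψ p = 1 / (2 * Real.pi) *
      ((ddcPair (coeff ψ 0 1) p (frame 2) (frame 3) - ddcPair (coeff ψ 0 1) p (frame 3) (frame 2))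
      - (ddcPair (coeff ψ 0 2) p (frame 1) (frame 3) - ddcPair (coeff ψ 0 2) p (frame 3) (frame 1))
      + (ddcPair (coeff ψ 0 3) p (frame 1) (frame 2) - ddcPair (coeff ψ 0 3) p (frame 2) (frame 1))
      + (ddcPair (coeff ψ 1 2) p (frame 0) (frame 3) - ddcPair (coeff ψ 1 2) p (frame 3) (frame 0))
      - (ddcPair (coeff ψ 1 3) p (frame 0) (frame 2) - ddcPair (coeff ψ 1 3) p (frame 2) (frame 0))
      + (ddcPair (coeff ψ 2 3) p (frame 0) (frame 1)
        - ddcPair (coeff ψ 2 3) p (frame 1) (frame 0))) := by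
  have hd : ∀ (a b c : C2), DifferentiableAt ℝ
      (fun q => fderiv ℝ (fun r => ψ r ![a, b]) q (-Complex.I • c)) p := fun a b c =>
    (contDiff_fderiv_apply_const (contDiff_apply_alt hψ _) _).differentiable (by simp) p
  have hs : ∀ (a b c v : C2), fderiv ℝ (fun q => dcReal ψ q ![a, b, c]) p v =
      ddcPair (fun q => ψ q ![b, c]) p v a - ddcPair (fun q => ψ q ![a, c]) p v b
        + ddcPair (fun q => ψ q ![a, b]) p v c := by
    intro a b c v
    simp only [dcReal_apply hψ, Matrix.cons_val_zero, Matrix.cons_val_one, Matrix.cons_val]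
    rw [fderiv_fun_add ((hd _ _ _).fun_sub (hd _ _ _)) (hd _ _ _),
      fderiv_fun_sub (hd _ _ _) (hd _ _ _)]
    simp [ddcPair]
  have r0 : (0 : Fin 4).removeNth frame = ![frame 1, frame 2, frame 3] := by
    funext i; fin_cases i <;> rfl
  have r1 : (1 : Fin 4).removeNth frame = ![frame 0, frame 2, frame 3] := by
    funext i; fin_cases i <;> rfl
  have r2 : (2 : Fin 4).removeNth frame = ![frame 0, frame 1, frame 3] := by
    funext i; fin_cases i <;> rfl
  have r3 : (3 : Fin 4).removeNth frame = ![frame 0, frame 1, frame 2] := by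
    funext i; fin_cases i <;> rfl
  rw [normalizedDdc, extDeriv_apply ((contDiff_dcReal hψ).differentiable (by simp) p),
    Fin.sum_univ_four, r0, r1, r2, r3, hs, hs, hs, hs]
  norm_num
  ring

theorem tsupport_coeff_subset (ψ : C2 → Alt 2) (k l : Fin 4) :
    tsupport (coeff ψ k l) ⊆ tsupport ψ := by
  refine closure_mono fun p hp => ?_
  contrapose! hp
  simp only [Function.mem_support, not_not] at hp ⊢
  simp [coeff, hp]

theorem contDiffOn_fderiv_apply_const {V : Set C2} (hV : IsOpen V) {f : C2 → ℝ}
    (hf : ContDiffOn ℝ ∞ f V) (v : C2) : ContDiffOn ℝ ∞ (fun p => fderiv ℝ f p v) V :=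
  (hf.fderiv_of_isOpen hV (m := ∞) (by simp)).clm_apply contDiffOn_const

theorem tsupport_ddcPair_subset (φ : C2 → ℝ) (v w : C2) :
    tsupport (fun p => ddcPair φ p v w) ⊆ tsupport φ :=
  (tsupport_fderiv_apply_subset ℝ v).trans (tsupport_fderiv_apply_subset ℝ _)

/-- A function that is continuous on an open set times a continuous function with compact support in
this set is integrable. -/
theorem integrable_mul_of_tsupport_subset {V : Set C2} (hV : IsOpen V) {u φ : C2 → ℝ}
    (hu : ContinuousOn u V) (hφ : Continuous φ) (hc : HasCompactSupport φ) (hs : tsupport φ ⊆ V) :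
    Integrable (fun p => u p * φ p) := by
  have : Continuous (fun p => u p * φ p) := by
    refine continuous_of_tsupport fun x hx => ?_
    have hx' : x ∈ V := hs (tsupport_mul_subset_right hx)
    exact (hu.continuousAt (hV.mem_nhds hx')).mul hφ.continuousAt
  exact this.integrable_of_hasCompactSupport hc.mul_left

theorem contDiff_ddcPair {φ : C2 → ℝ} (hφ : ContDiff ℝ ∞ φ) (v w : C2) :
    ContDiff ℝ ∞ (fun p => ddcPair φ p v w) :=
  contDiff_fderiv_apply_const (contDiff_fderiv_apply_const hφ _) _

theorem contDiffOn_ddcPair {V : Set C2} (hV : IsOpen V) {u : C2 → ℝ}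
    (hu : ContDiffOn ℝ ∞ u V) (v w : C2) : ContDiffOn ℝ ∞ (fun p => ddcPair u p v w) V :=
  contDiffOn_fderiv_apply_const hV (contDiffOn_fderiv_apply_const hV hu _) _

theorem integral_mul_fderiv_of_tsupport_subset {V : Set C2} (hV : IsOpen V) {u φ : C2 → ℝ}
    (hu : ContDiffOn ℝ ∞ u V) (hφ : ContDiff ℝ ∞ φ) (hc : HasCompactSupport φ)
    (hs : tsupport φ ⊆ V) (v : C2) :
    ∫ p, u p * fderiv ℝ φ p v = - ∫ p, fderiv ℝ u p v * φ p := by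
  refine integral_mul_fderiv_eq_neg_fderiv_mul_of_integrable ?_ ?_ ?_ ?_ ?_
  · exact integrable_mul_of_tsupport_subset hV (contDiffOn_fderiv_apply_const hV hu v).continuousOn
      hφ.continuous hc hs
  · exact integrable_mul_of_tsupport_subset hV hu.continuousOn
      (contDiff_fderiv_apply_const hφ v).continuous (hc.fderiv_apply ℝ v)
      ((tsupport_fderiv_apply_subset ℝ v).trans hs)
  · exact integrable_mul_of_tsupport_subset hV hu.continuousOn hφ.continuous hc hs
  · intro x hx
    exact (hu.contDiffAt (hV.mem_nhds (hs hx))).differentiableAt (by simp)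
  · intro x _
    exact hφ.differentiable (by simp) x

theorem fderiv_fderiv_apply_comm {V : Set C2} (hV : IsOpen V) {u : C2 → ℝ}
    (hu : ContDiffOn ℝ ∞ u V) {p : C2} (hp : p ∈ V) (v w : C2) :
    fderiv ℝ (fun q => fderiv ℝ u q v) p w = fderiv ℝ (fun q => fderiv ℝ u q w) p v := by
  have hc := hu.contDiffAt (hV.mem_nhds hp)
  have hd : DifferentiableAt ℝ (fderiv ℝ u) p :=
    (hc.fderiv_right (m := ∞) (by simp)).differentiableAt (by simp)
  rw [fderiv_clm_apply hd (differentiableAt_const _),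
    fderiv_clm_apply hd (differentiableAt_const _)]
  simpa using (hc.isSymmSndFDerivAt (by simp; exact WithTop.coe_le_coe.2 le_top)) w v

theorem integral_mul_ddcPair {V : Set C2} (hV : IsOpen V) {u φ : C2 → ℝ}
    (hu : ContDiffOn ℝ ∞ u V) (hφ : ContDiff ℝ ∞ φ) (hc : HasCompactSupport φ)
    (hs : tsupport φ ⊆ V) (v w : C2) :
    ∫ p, u p * ddcPair φ p v w = ∫ p, ddcPair u p v w * φ p := by
  unfold ddcPair
  rw [integral_mul_fderiv_of_tsupport_subset hV hu (contDiff_fderiv_apply_const hφ _)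
      (hc.fderiv_apply ℝ _) ((tsupport_fderiv_apply_subset ℝ _).trans hs),
    integral_mul_fderiv_of_tsupport_subset hV (contDiffOn_fderiv_apply_const hV hu v) hφ hc hs,
    neg_neg]
  refine integral_congr_ae (Eventually.of_forall fun p => ?_)
  by_cases hp : p ∈ V
  · simp only
    rw [fderiv_fderiv_apply_comm hV hu hp]
  · simp [image_eq_zero_of_notMem_tsupport fun h => hp (hs h)]

/-- `f` is integrable with integral zero. -/
def IsNullIntegral (f : C2 → ℝ) : Prop := Integrable f ∧ ∫ p, f p = 0

theorem IsNullIntegral.add {f g : C2 → ℝ} (hf : IsNullIntegral f) (hg : IsNullIntegral g) :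
    IsNullIntegral (fun p => f p + g p) :=
  ⟨hf.1.add hg.1, by rw [integral_add hf.1 hg.1, hf.2, hg.2, add_zero]⟩

theorem IsNullIntegral.sub {f g : C2 → ℝ} (hf : IsNullIntegral f) (hg : IsNullIntegral g) :
    IsNullIntegral (fun p => f p - g p) :=
  ⟨hf.1.sub hg.1, by rw [integral_sub hf.1 hg.1, hf.2, hg.2, sub_zero]⟩

/-- Integration by parts, twice, with a function `u` that is smooth near the support of `φ`. -/
theorem isNullIntegral_ddcPair {V : Set C2} (hV : IsOpen V) {u φ : C2 → ℝ}
    (hu : ContDiffOn ℝ ∞ u V) (hφ : ContDiff ℝ ∞ φ) (hc : HasCompactSupport φ)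
    (hs : tsupport φ ⊆ V) (v w : C2) :
    IsNullIntegral (fun p => u p * ddcPair φ p v w - ddcPair u p v w * φ p) := by
  have h1 : Integrable (fun p => u p * ddcPair φ p v w) :=
    integrable_mul_of_tsupport_subset hV hu.continuousOn (contDiff_ddcPair hφ v w).continuous
      (hc.mono' (subset_closure.trans (tsupport_ddcPair_subset φ v w)))
      ((tsupport_ddcPair_subset φ v w).trans hs)
  have h2 : Integrable (fun p => ddcPair u p v w * φ p) :=
    integrable_mul_of_tsupport_subset hV (contDiffOn_ddcPair hV hu v w).continuousOn
      hφ.continuous hc hs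
  exact ⟨h1.sub h2, by rw [integral_sub h1 h2, integral_mul_ddcPair hV hu hφ hc hs, sub_self]⟩

theorem normalizedDdc_eq_zero_of_notMem_tsupport {ψ : C2 → Alt 2} (hψ : ContDiff ℝ ∞ ψ) {p : C2}
    (hp : p ∉ tsupport ψ) : normalizedDdc ψ p = 0 := by
  have h : ∀ k l v w, ddcPair (coeff ψ k l) p v w = 0 := fun k l v w =>
    image_eq_zero_of_notMem_tsupport (f := fun p => ddcPair (coeff ψ k l) p v w)
      fun h => hp (tsupport_coeff_subset ψ k l (tsupport_ddcPair_subset _ v w h))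
  simp [normalizedDdc_eq hψ, h]

theorem setIntegral_mul_normalizedDdc {V : Set C2} {ψ : C2 → Alt 2} (hψ : ContDiff ℝ ∞ ψ)
    (hs : tsupport ψ ⊆ V) (u : C2 → ℝ) :
    ∫ p in V, u p * normalizedDdc ψ p = ∫ p, u p * normalizedDdc ψ p :=
  setIntegral_eq_integral_of_forall_compl_eq_zero fun p hp => by
    rw [normalizedDdc_eq_zero_of_notMem_tsupport hψ fun h => hp (hs h), mul_zero]

/-- If the form `(1 / 2πi) dd^c u` of a smooth function `u` is `η`, then the same holds for
currents. -/
theorem integral_mul_normalizedDdc_of_smooth {V : Set C2} (hV : IsOpen V) {u : C2 → ℝ}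
    (hu : ContDiffOn ℝ ∞ u V) {η : C2 → Alt 2}
    (hη : ∀ p ∈ V, ∀ v w, ddcPair u p v w - ddcPair u p w v = 2 * Real.pi * η p ![v, w])
    {ψ : C2 → Alt 2} (hψ : ContDiff ℝ ∞ ψ) (hc : HasCompactSupport ψ) (hs : tsupport ψ ⊆ V)
    (hi : Integrable fun p => wedge (ψ p) (η p)) :
    ∫ p in V, u p * normalizedDdc ψ p = ∫ p, wedge (ψ p) (η p) := by
  rw [setIntegral_mul_normalizedDdc hψ hs]
  have hN : ∀ k l v w, IsNullIntegral (fun p => u p * ddcPair (coeff ψ k l) p v w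
      - ddcPair u p v w * coeff ψ k l p) := fun k l v w =>
    isNullIntegral_ddcPair hV hu (contDiff_apply_alt hψ _)
      (hc.mono' (subset_closure.trans (tsupport_coeff_subset ψ k l)))
      ((tsupport_coeff_subset ψ k l).trans hs) v w
  -- the total derivatives that integrate to zero
  let B (k l i j : Fin 4) (p : C2) : ℝ :=
    (u p * ddcPair (coeff ψ k l) p (frame i) (frame j)
      - ddcPair u p (frame i) (frame j) * coeff ψ k l p)
      - (u p * ddcPair (coeff ψ k l) p (frame j) (frame i)
      - ddcPair u p (frame j) (frame i) * coeff ψ k l p)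
  have hP : ∀ k l i j, IsNullIntegral (B k l i j) := fun k l i j => (hN k l _ _).sub (hN k l _ _)
  have hT := ((((((hP 0 1 2 3).sub (hP 0 2 1 3)).add (hP 0 3 1 2)).add (hP 1 2 0 3)).sub
    (hP 1 3 0 2)).add (hP 2 3 0 1))
  have hpi : (2 * Real.pi) ≠ 0 := by positivity
  have hE : (fun p => u p * normalizedDdc ψ p) =
      fun p => 1 / (2 * Real.pi) * (B 0 1 2 3 p - B 0 2 1 3 p + B 0 3 1 2 p + B 1 2 0 3 p
        - B 1 3 0 2 p + B 2 3 0 1 p) + wedge (ψ p) (η p) := by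
    funext p
    rw [normalizedDdc_eq hψ, wedge_apply]
    simp only [B]
    by_cases hp : p ∈ V
    · have h23 := hη p hp (frame 2) (frame 3)
      have h13 := hη p hp (frame 1) (frame 3)
      have h12 := hη p hp (frame 1) (frame 2)
      have h03 := hη p hp (frame 0) (frame 3)
      have h02 := hη p hp (frame 0) (frame 2)
      have h01 := hη p hp (frame 0) (frame 1)
      rw [eq_comm, ← sub_eq_zero]
      field_simp
      linear_combination (-coeff ψ 0 1 p) * h23 + coeff ψ 0 2 p * h13 - coeff ψ 0 3 p * h12
        - coeff ψ 1 2 p * h03 + coeff ψ 1 3 p * h02 - coeff ψ 2 3 p * h01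
    · have h0 : ∀ v, ψ p v = 0 := fun v => by
        rw [image_eq_zero_of_notMem_tsupport fun h => hp (hs h)]; rfl
      simp only [h0]
      ring
  rw [hE, integral_add (hT.1.const_mul _) hi, integral_const_mul, hT.2, mul_zero, zero_add]

/-! ### The sigma function as an infinite product -/

/-- The infinite product `∏_{n ≥ 1} (1 - qⁿ w)`. -/
def qProd (q w : ℂ) : ℂ := ∏' n : ℕ, (1 - q ^ (n + 1) * w)

theorem summable_norm_qProd {q : ℂ} (hq : ‖q‖ < 1) (w : ℂ) :
    Summable fun n : ℕ => ‖-(q ^ (n + 1) * w)‖ := by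
  simpa using ((summable_nat_add_iff 1).mpr
    (summable_geometric_of_lt_one (norm_nonneg _) hq)).mul_right ‖w‖

theorem differentiable_qProd {q : ℂ} (hq : ‖q‖ < 1) : Differentiable ℂ (qProd q) := by
  have h : ∀ R : ℝ, DifferentiableOn ℂ (qProd q) (Metric.ball 0 R) := by
    intro R
    have := Summable.hasProdLocallyUniformlyOn_nat_one_add (K := Metric.ball (0 : ℂ) R)
      (f := fun n w => -(q ^ (n + 1) * w)) Metric.isOpen_ball
      (u := fun n => ‖q‖ ^ (n + 1) * R)
      (((summable_nat_add_iff 1).mpr (summable_geometric_of_lt_one (norm_nonneg _) hq)).mul_right R)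
      (.of_forall fun n w hw => by
        rw [norm_neg, norm_mul, norm_pow]
        exact mul_le_mul_of_nonneg_left (mem_ball_zero_iff.mp hw).le (by positivity))
      (fun n => by fun_prop)
    refine (this.differentiableOn (.of_forall fun _ => by
      simpa [Finset.prod_fn] using DifferentiableOn.finsetProd (fun _ _ => by fun_prop))
      Metric.isOpen_ball).congr fun w _ => by simp [qProd, sub_eq_add_neg]
  intro w
  exact (h (‖w‖ + 1)).differentiableAt (Metric.isOpen_ball.mem_nhds (by simp))

theorem qProd_ne_zero {q w : ℂ} (hq : ‖q‖ < 1) (h : ∀ n : ℕ, q ^ (n + 1) * w ≠ 1) :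
    qProd q w ≠ 0 := by
  have := tprod_one_add_ne_zero_of_summable (f := fun n : ℕ => -(q ^ (n + 1) * w))
    (fun n hn => h n (by linear_combination -hn)) (summable_norm_qProd hq w)
  simpa [qProd, sub_eq_add_neg] using this

theorem log_norm_qProd {q w : ℂ} (hq : ‖q‖ < 1) (h : ∀ n : ℕ, q ^ (n + 1) * w ≠ 1) :
    HasSum (fun n : ℕ => Real.log ‖1 - q ^ (n + 1) * w‖) (Real.log ‖qProd q w‖) := by
  have hm := multipliable_one_add_of_summable (summable_norm_qProd hq w)
  have hs := (summable_norm_qProd hq w).summable_log_norm_one_add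
  have := Real.rexp_tsum_eq_tprod (f := fun n : ℕ => ‖1 + -(q ^ (n + 1) * w)‖)
    (fun n => norm_pos_iff.mpr fun hn => h n (by linear_combination -hn)) hs
  rw [← hm.norm_tprod] at this
  simp only [← sub_eq_add_neg] at this hs
  rw [qProd, ← this, Real.log_exp]
  exact hs.hasSum

theorem qProd_shift {q : ℂ} (hq : ‖q‖ < 1) (w : ℂ) :
    qProd q w = (1 - q * w) * qProd q (q * w) := by
  have hm := multipliable_one_add_of_summable (summable_norm_qProd hq (q * w))
  have := tprod_eq_zero_mul' (f := fun n : ℕ => 1 - q ^ (n + 1) * w)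
    (hm.congr fun n => by ring)
  rw [qProd, this, qProd]
  congr 1
  · ring
  · exact tprod_congr fun n => by ring

open Complex in
/-- The entire function `sin (π z) ∏_{n ≥ 1} (1 - qⁿ w) (1 - qⁿ / w)` with `q = exp (2πiτ)` and
`w = exp (2πiz)`. Up to an exponential factor it is the Weierstrass sigma function of `ℤ + ℤτ`. -/
def sigmaProd (τ z : ℂ) : ℂ :=
  sin (Real.pi * z) * (qProd (exp (2 * Real.pi * I * τ)) (exp (2 * Real.pi * I * z)) *
    qProd (exp (2 * Real.pi * I * τ)) (exp (-(2 * Real.pi * I * z))))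

section
open Complex

variable {τ : ℂ}

theorem norm_nome_lt_one (hτ : 0 < τ.im) : ‖exp (2 * Real.pi * I * τ)‖ < 1 := by
  rw [norm_exp, Real.exp_lt_one_iff]
  simp
  positivity

theorem differentiable_sigmaProd (hτ : 0 < τ.im) : Differentiable ℂ (sigmaProd τ) := by
  have h := differentiable_qProd (norm_nome_lt_one hτ)
  unfold sigmaProd
  exact (by fun_prop : Differentiable ℂ fun z : ℂ => sin (Real.pi * z)).mul
    ((h.comp (f := fun z => exp (2 * Real.pi * I * z)) (by fun_prop)).mul
    (h.comp (f := fun z => exp (-(2 * Real.pi * I * z))) (by fun_prop)))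

theorem sigmaProd_neg (τ z : ℂ) : sigmaProd τ (-z) = -sigmaProd τ z := by
  simp only [sigmaProd, mul_neg, sin_neg, neg_neg]
  ring

theorem sigmaProd_zero (τ : ℂ) : sigmaProd τ 0 = 0 := by simp [sigmaProd]

theorem sigmaProd_add_one (τ z : ℂ) : sigmaProd τ (z + 1) = -sigmaProd τ z := by
  have h1 : exp (2 * Real.pi * I * (z + 1)) = exp (2 * Real.pi * I * z) := by
    rw [mul_add, mul_one, exp_add, exp_two_pi_mul_I, mul_one]
  have h2 : exp (-(2 * Real.pi * I * (z + 1))) = exp (-(2 * Real.pi * I * z)) := by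
    rw [exp_neg, h1, exp_neg]
  rw [sigmaProd, h1, h2, mul_add, mul_one, sin_add_pi, sigmaProd]
  ring

theorem sigmaProd_add_tau (hτ : 0 < τ.im) (z : ℂ) :
    sigmaProd τ (z + τ) = -exp (-(Real.pi * I * τ) - 2 * Real.pi * I * z) * sigmaProd τ z := by
  have hq := norm_nome_lt_one hτ
  set q := exp (2 * Real.pi * I * τ) with hqdef
  set w := exp (2 * Real.pi * I * z) with hwdef
  have hq0 : q ≠ 0 := exp_ne_zero _
  have hw0 : w ≠ 0 := exp_ne_zero _
  have h1 : exp (2 * Real.pi * I * (z + τ)) = q * w := by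
    rw [mul_add, exp_add, mul_comm]
  have h2 : exp (-(2 * Real.pi * I * (z + τ))) = (q * w)⁻¹ := by rw [exp_neg, h1]
  have h3 : exp (-(2 * Real.pi * I * z)) = w⁻¹ := by rw [exp_neg]
  have hA := qProd_shift hq w
  have hB := qProd_shift hq (q * w)⁻¹
  have e : q * (q * w)⁻¹ = w⁻¹ := by field_simp
  rw [e] at hB
  set a := exp (Real.pi * I * z) with ha
  set b := exp (Real.pi * I * τ) with hb
  have ha0 : a ≠ 0 := exp_ne_zero _
  have hb0 : b ≠ 0 := exp_ne_zero _
  have haw : w = a ^ 2 := by rw [hwdef, ha, ← exp_nat_mul]; congr 1; push_cast; ring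
  have hbq : q = b ^ 2 := by rw [hqdef, hb, ← exp_nat_mul]; congr 1; push_cast; ring
  have s1 : sin (Real.pi * z) = (a⁻¹ - a) * I / 2 := by
    rw [sin, ha, ← exp_neg]; ring_nf
  have s2 : sin (Real.pi * (z + τ)) = ((a * b)⁻¹ - a * b) * I / 2 := by
    rw [sin, ha, hb, ← exp_add, ← exp_neg]; ring_nf
  have s3 : exp (-(Real.pi * I * τ) - 2 * Real.pi * I * z) = b⁻¹ * w⁻¹ := by
    rw [sub_eq_add_neg, exp_add, exp_neg, exp_neg]
  rw [sigmaProd, sigmaProd, ← hqdef, ← hwdef, h1, h2, h3, hB, hA, s1, s2, s3, haw, hbq]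
  field_simp
  ring

/-- The quasi-periodicity of theta functions: the exponent is affine in `z`, and its part that is
quadratic in `n` is what the quadratic term of the Néron height compensates. -/
theorem sigmaProd_add_lattice (hτ : 0 < τ.im) (m n : ℤ) (z : ℂ) :
    sigmaProd τ (z + (m + n * τ)) =
      exp (Real.pi * I * (m + n) - Real.pi * I * n ^ 2 * τ - 2 * Real.pi * I * n * z)
        * sigmaProd τ z := by
  have hneg : ∀ x : ℂ, -x = exp (Real.pi * I) * x := fun x => by
    rw [exp_pi_mul_I, neg_one_mul]
  have hn : ∀ (n : ℤ) (z : ℂ), sigmaProd τ (z + n * τ) =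
      exp (Real.pi * I * n - Real.pi * I * n ^ 2 * τ - 2 * Real.pi * I * n * z)
        * sigmaProd τ z := by
    intro n
    induction n using Int.induction_on with
    | zero => intro z; simp
    | succ k ih =>
      intro z
      have e : z + ((k + 1 : ℤ) : ℂ) * τ = (z + (k : ℤ) * τ) + τ := by push_cast; ring
      rw [e, sigmaProd_add_tau hτ, ih, ← mul_assoc, neg_mul, ← exp_add, ← neg_one_mul,
        ← exp_pi_mul_I,
        ← exp_add]
      congr 2
      push_cast; ring
    | pred k ih =>
      intro z
      have e : z + ((-k : ℤ) : ℂ) * τ = (z + (-k - 1 : ℤ) * τ) + τ := by push_cast; ring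
      have h := ih z
      rw [e, sigmaProd_add_tau hτ] at h
      rw [← mul_right_inj' (neg_ne_zero.mpr (exp_ne_zero
        (-(Real.pi * I * τ) - 2 * Real.pi * I * (z + (-k - 1 : ℤ) * τ)))), h, ← mul_assoc, neg_mul,
        ← exp_add, hneg (exp _), ← exp_add]
      congr 2
      push_cast; ring
  have hm : ∀ (m : ℤ) (z : ℂ), sigmaProd τ (z + m) = exp (Real.pi * I * m) * sigmaProd τ z := by
    intro m
    induction m using Int.induction_on with
    | zero => intro z; simp
    | succ k ih =>
      intro z
      have e : z + ((k + 1 : ℤ) : ℂ) = (z + (k : ℤ)) + 1 := by push_cast; ring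
      rw [e, sigmaProd_add_one, ih, ← neg_one_mul, ← exp_pi_mul_I, ← mul_assoc, ← exp_add]
      congr 2
      push_cast; ring
    | pred k ih =>
      intro z
      have e : z + ((-k : ℤ) : ℂ) = (z + (-k - 1 : ℤ)) + 1 := by push_cast; ring
      have h := ih z
      rw [e, sigmaProd_add_one] at h
      rw [← neg_inj, h, hneg (exp _ * _), ← mul_assoc, ← exp_add]
      congr 2
      push_cast; ring
  rw [show z + (m + n * τ) = (z + n * τ) + m by ring, hm, hn, ← mul_assoc, ← exp_add]
  congr 2
  ring

/-- Off the lattice `ℤ + ℤτ` none of the factors of the product vanishes. -/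
theorem sigmaProd_factors_ne {z : ℂ} (hz : ∀ m n : ℤ, z ≠ m + n * τ) :
    sin (Real.pi * z) ≠ 0 ∧
    (∀ k : ℕ, exp (2 * Real.pi * I * τ) ^ (k + 1) * exp (2 * Real.pi * I * z) ≠ 1) ∧
    (∀ k : ℕ, exp (2 * Real.pi * I * τ) ^ (k + 1) * exp (-(2 * Real.pi * I * z)) ≠ 1) := by
  have hpi : (Real.pi : ℂ) ≠ 0 := by exact_mod_cast Real.pi_ne_zero
  refine ⟨fun h => ?_, fun k h => ?_, fun k h => ?_⟩
  · obtain ⟨m, hm⟩ := sin_eq_zero_iff.mp h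
    exact hz m 0 (by
      rw [mul_comm] at hm
      simpa using mul_right_cancel₀ hpi hm)
  · rw [← exp_nat_mul, ← exp_add, exp_eq_one_iff] at h
    obtain ⟨m, hm⟩ := h
    refine hz m (-(k + 1)) ?_
    have : 2 * Real.pi * I * (z + (k + 1) * τ - m) = 0 := by
      push_cast at hm; linear_combination hm
    simp [hpi] at this
    push_cast; linear_combination this
  · rw [← exp_nat_mul, ← exp_add, exp_eq_one_iff] at h
    obtain ⟨m, hm⟩ := h
    refine hz (-m) (k + 1) ?_
    have : 2 * Real.pi * I * (-z + (k + 1) * τ - m) = 0 := by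
      push_cast at hm; linear_combination hm
    simp [hpi] at this
    push_cast; linear_combination -this

theorem sigmaProd_eq_zero_iff (hτ : 0 < τ.im) (z : ℂ) :
    sigmaProd τ z = 0 ↔ ∃ m n : ℤ, z = m + n * τ := by
  constructor
  · contrapose!
    intro hz
    obtain ⟨h1, h2, h3⟩ := sigmaProd_factors_ne hz
    exact mul_ne_zero h1 (mul_ne_zero (qProd_ne_zero (norm_nome_lt_one hτ) h2)
      (qProd_ne_zero (norm_nome_lt_one hτ) h3))
  · rintro ⟨m, n, rfl⟩
    have := sigmaProd_add_lattice hτ m n 0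
    rwa [zero_add, sigmaProd_zero, mul_zero] at this

theorem nome_pow_ne_one (hτ : 0 < τ.im) (k : ℕ) :
    exp (2 * Real.pi * I * τ) ^ (k + 1) * 1 ≠ 1 := by
  intro h
  have h1 : ‖exp (2 * Real.pi * I * τ)‖ ^ (k + 1) < 1 :=
    pow_lt_one₀ (norm_nonneg _) (norm_nome_lt_one hτ) (by simp)
  rw [← norm_pow, ← mul_one (_ ^ (k + 1)), h, norm_one] at h1
  exact lt_irrefl _ h1

theorem deriv_sigmaProd_zero (hτ : 0 < τ.im) :
    deriv (sigmaProd τ) 0 = Real.pi * qProd (exp (2 * Real.pi * I * τ)) 1 ^ 2 := by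
  have h := differentiable_qProd (norm_nome_lt_one hτ)
  have h1 : HasDerivAt (fun z : ℂ => sin (Real.pi * z)) Real.pi 0 := by
    have := (hasDerivAt_sin ((Real.pi : ℂ) * 0)).comp 0
      ((hasDerivAt_id (0 : ℂ)).const_mul (Real.pi : ℂ))
    simpa [Function.comp_def] using this
  have h2 : DifferentiableAt ℂ (fun z =>
      qProd (exp (2 * Real.pi * I * τ)) (exp (2 * Real.pi * I * z)) *
      qProd (exp (2 * Real.pi * I * τ)) (exp (-(2 * Real.pi * I * z)))) 0 :=
    ((h.comp (f := fun z => exp (2 * Real.pi * I * z)) (by fun_prop)).mul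
      (h.comp (f := fun z => exp (-(2 * Real.pi * I * z))) (by fun_prop))) 0
  have := (h1.mul h2.hasDerivAt).deriv
  refine Eq.trans ?_ (this.trans ?_)
  · rfl
  · simp [sq]

theorem deriv_sigmaProd_zero_ne (hτ : 0 < τ.im) : deriv (sigmaProd τ) 0 ≠ 0 := by
  rw [deriv_sigmaProd_zero hτ]
  exact mul_ne_zero (by exact_mod_cast Real.pi_ne_zero)
    (pow_ne_zero _ (qProd_ne_zero (norm_nome_lt_one hτ) (nome_pow_ne_one hτ)))

end

/-- `s` is a sigma function of the lattice `L`: an odd entire function with simple zeros exactly at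
the points of `L`, whose translate by a period `l` is `exp (a z + b) s`. The normalization
`exp (2 b - a l) = 1` is the sign condition of the theory of theta functions; it makes
`s (2 z) / s (z) ^ 4` invariant under `z ↦ z + l` up to the same condition. -/
structure IsSigma (L : PeriodPair) (s : ℂ → ℂ) : Prop where
  differentiable : Differentiable ℂ s
  eq_zero_iff : ∀ z, s z = 0 ↔ z ∈ L.lattice
  deriv_ne_zero : deriv s 0 ≠ 0
  neg : ∀ z, s (-z) = -s z
  quasi : ∀ l ∈ L.lattice, ∃ a b : ℂ, Complex.exp (2 * b - a * l) = 1 ∧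
    ∀ z, s (z + l) = Complex.exp (a * z + b) * s z

/-- The sigma function of a lattice, in the variable of the uniformization. -/
def latticeSigma (L : PeriodPair) (z : ℂ) : ℂ := sigmaProd (L.ω₂ / L.ω₁) (z / L.ω₁)

theorem _root_.PeriodPair.ω₁_ne_zero (L : PeriodPair) : L.ω₁ ≠ 0 := L.indep.ne_zero 0

theorem mem_lattice_iff_div {L : PeriodPair} {z : ℂ} :
    z ∈ L.lattice ↔ ∃ m n : ℤ, z / L.ω₁ = m + n * (L.ω₂ / L.ω₁) := by
  have h0 := L.ω₁_ne_zero
  rw [PeriodPair.mem_lattice]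
  refine exists_congr fun m => exists_congr fun n => ?_
  field_simp
  exact eq_comm

theorem deriv_latticeSigma_zero (L : PeriodPair) :
    deriv (latticeSigma L) 0 = deriv (sigmaProd (L.ω₂ / L.ω₁)) 0 / L.ω₁ := by
  have := deriv_comp_mul_left (L.ω₁)⁻¹ (sigmaProd (L.ω₂ / L.ω₁)) 0
  have e : latticeSigma L = fun z => sigmaProd (L.ω₂ / L.ω₁) ((L.ω₁)⁻¹ * z) := by
    funext z; rw [latticeSigma, div_eq_inv_mul z]
  rw [e, this, mul_zero, smul_eq_mul, div_eq_inv_mul (deriv _ _)]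

theorem isSigma_latticeSigma {L : PeriodPair} (hL : 0 < (L.ω₂ / L.ω₁).im) :
    IsSigma L (latticeSigma L) where
  differentiable := (differentiable_sigmaProd hL).comp (f := fun z => z / L.ω₁) (by fun_prop)
  eq_zero_iff z := by rw [latticeSigma, sigmaProd_eq_zero_iff hL, mem_lattice_iff_div]
  deriv_ne_zero := by
    rw [deriv_latticeSigma_zero]
    exact div_ne_zero (deriv_sigmaProd_zero_ne hL) L.ω₁_ne_zero
  neg z := by rw [latticeSigma, neg_div, sigmaProd_neg, latticeSigma]
  quasi l hl := by
    obtain ⟨m, n, h⟩ := mem_lattice_iff_div.mp hl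
    have h0 := L.ω₁_ne_zero
    refine ⟨-(2 * Real.pi * Complex.I * n / L.ω₁),
      Real.pi * Complex.I * (m + n) - Real.pi * Complex.I * n ^ 2 * (L.ω₂ / L.ω₁), ?_, fun z => ?_⟩
    · rw [Complex.exp_eq_one_iff]
      refine ⟨m + n + n * m, ?_⟩
      have : l = (m + n * (L.ω₂ / L.ω₁)) * L.ω₁ := by rw [← h]; field_simp
      rw [this]
      push_cast
      field_simp
      ring
    · rw [latticeSigma, add_div, h, sigmaProd_add_lattice hL, latticeSigma]
      congr 2
      field_simp
      ring

/-! ### Elliptic functions with respect to a fixed lattice -/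

/-- If the zeros of the entire function `B` are simple and are zeros of the entire function `A`,
then `A / B` is entire. -/
theorem exists_entire_quotient {A B : ℂ → ℂ} (hA : Differentiable ℂ A) (hB : Differentiable ℂ B)
    (h : ∀ z, B z = 0 → A z = 0 ∧ deriv B z ≠ 0) :
    ∃ g : ℂ → ℂ, Differentiable ℂ g ∧ ∀ z, A z = g z * B z := by
  classical
  refine ⟨fun z => if B z = 0 then deriv A z / deriv B z else A z / B z, fun z => ?_, fun z => ?_⟩
  · by_cases hz : B z = 0
    · obtain ⟨hA0, hB0⟩ := h z hz
      have hdA : DifferentiableAt ℂ (dslope A z) z :=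
        ((Complex.differentiableOn_dslope univ_mem).mpr hA.differentiableOn).differentiableAt
          univ_mem
      have hdB : DifferentiableAt ℂ (dslope B z) z :=
        ((Complex.differentiableOn_dslope univ_mem).mpr hB.differentiableOn).differentiableAt
          univ_mem
      have hB1 : dslope B z z ≠ 0 := by rwa [dslope_same]
      refine (hdA.div hdB hB1).congr_of_eventuallyEq ?_
      filter_upwards [hdB.continuousAt.eventually_ne hB1] with w hw
      rcases eq_or_ne w z with rfl | hwz
      · simp [hz, dslope_same]
      · have eA : A w = (w - z) * dslope A z w := by
          simpa [hA0, eq_comm] using sub_smul_dslope A z w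
        have eB : B w = (w - z) * dslope B z w := by
          simpa [hz, eq_comm] using sub_smul_dslope B z w
        have hwz' : w - z ≠ 0 := sub_ne_zero.mpr hwz
        rw [if_neg (by rw [eB]; exact mul_ne_zero hwz' hw), eA, eB, Pi.div_apply]
        field_simp
    · refine ((hA z).div (hB z) hz).congr_of_eventuallyEq ?_
      filter_upwards [(hB z).continuousAt.eventually_ne hz] with w hw
      simp [hw]
  · by_cases hz : B z = 0
    · simp [hz, (h z hz).1]
    · simp [hz]

theorem countable_lattice (L : PeriodPair) : (L.lattice : Set ℂ).Countable := by
  have : Countable L.lattice := L.latticeEquivProd.toEquiv.countable_iff.mpr inferInstance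
  exact Set.countable_coe_iff.mp this

theorem dense_compl_lattice (L : PeriodPair) : Dense {z : ℂ | z ∉ L.lattice} :=
  (countable_lattice L).dense_compl ℝ

/-- The points whose multiples by powers of two avoid the lattice are dense. -/
theorem dense_two_pow_mul_notMem (L : PeriodPair) :
    Dense {z : ℂ | ∀ n : ℕ, 2 ^ n * z ∉ L.lattice} := by
  have : (⋃ n : ℕ, (fun z : ℂ => 2 ^ n * z) ⁻¹' (L.lattice : Set ℂ)).Countable :=
    Set.countable_iUnion fun n => (countable_lattice L).preimage_of_injOn
      (mul_right_injective₀ (pow_ne_zero n two_ne_zero)).injOn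
  convert this.dense_compl ℝ using 1
  ext z
  simp

theorem dense_two_mul_notMem (L : PeriodPair) :
    Dense {z : ℂ | z ∉ L.lattice ∧ 2 * z ∉ L.lattice} :=
  (dense_two_pow_mul_notMem L).mono fun z hz => ⟨by simpa using hz 0, by simpa using hz 1⟩

theorem exists_norm_sub_lattice_le (L : PeriodPair) :
    ∃ R : ℝ, ∀ z : ℂ, ∃ l ∈ L.lattice, ‖z - l‖ ≤ R := by
  refine ⟨∑ i, ‖L.basis i‖, fun z => ⟨ZSpan.floor L.basis z, ?_, ZSpan.norm_fract_le L.basis z⟩⟩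
  exact L.lattice_eq_span_range_basis.ge (ZSpan.floor L.basis z).2

/-- An entire function that is periodic with respect to a lattice is constant. -/
theorem eq_const_of_periodic {L : PeriodPair} {g : ℂ → ℂ} (hg : Differentiable ℂ g)
    (hp : ∀ l ∈ L.lattice, ∀ z, g (z + l) = g z) (z w : ℂ) : g z = g w := by
  refine hg.apply_eq_apply_of_bounded ?_ z w
  obtain ⟨R, hR⟩ := exists_norm_sub_lattice_le L
  refine ((isCompact_closedBall (0 : ℂ) R).image hg.continuous).isBounded.subset ?_
  rintro _ ⟨z, rfl⟩
  obtain ⟨l, hl, h⟩ := hR z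
  exact ⟨z - l, by simpa using h, by rw [← hp l hl, sub_add_cancel]⟩

/-- If `g B = A` and `A`, `B` have the same quasi-periods, then the entire function `g` is
constant. It suffices to know the quasi-periods of `A` off the lattice. -/
theorem eq_const_of_quasiperiodic {L : PeriodPair} {A B g : ℂ → ℂ} (hg : Differentiable ℂ g)
    (h : ∀ z, A z = g z * B z) {S : Set ℂ} (hS : Dense S) (hB : ∀ l ∈ L.lattice, ∀ z ∈ S,
      ∃ e : ℂ, e ≠ 0 ∧ A (z + l) = e * A z ∧ B (z + l) = e * B z ∧ B z ≠ 0) (z w : ℂ) :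
    g z = g w := by
  refine eq_const_of_periodic (L := L) hg (fun l hl => ?_) z w
  refine fun z => congrFun (Continuous.ext_on hS (f := fun z => g (z + l)) (g := g)
    (hg.continuous.comp (by fun_prop)) hg.continuous fun z hz => ?_) z
  obtain ⟨e, he, h1, h2, h3⟩ := hB l hl z hz
  rw [h, h, h2] at h1
  have : e * B z ≠ 0 := mul_ne_zero he h3
  exact mul_right_cancel₀ this (by linear_combination h1)

namespace IsSigma

variable {L : PeriodPair} {s : ℂ → ℂ}

theorem deriv_ne_zero_of_mem (hs : IsSigma L s) {l : ℂ} (hl : l ∈ L.lattice) : deriv s l ≠ 0 := by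
  obtain ⟨a, b, -, h⟩ := hs.quasi l hl
  have h1 : HasDerivAt (fun z => s (z + l)) (deriv s l) 0 := by
    have := (hs.differentiable (0 + l)).hasDerivAt.comp_add_const 0 l
    simpa using this
  have h0 : s 0 = 0 := (hs.eq_zero_iff 0).mpr (zero_mem _)
  have h2 : HasDerivAt (fun z => Complex.exp (a * z + b) * s z) (Complex.exp b * deriv s 0) 0 := by
    have h3 : DifferentiableAt ℂ (fun z => Complex.exp (a * z + b)) 0 := by fun_prop
    have := h3.hasDerivAt.fun_mul (hs.differentiable 0).hasDerivAt
    simpa [h0] using this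
  rw [show (fun z => s (z + l)) = _ from funext h] at h1
  rw [h1.unique h2]
  exact mul_ne_zero (Complex.exp_ne_zero _) hs.deriv_ne_zero

theorem ne_zero_of_notMem (hs : IsSigma L s) {z : ℂ} (hz : z ∉ L.lattice) : s z ≠ 0 :=
  fun h => hz ((hs.eq_zero_iff z).mp h)

theorem eq_zero_of_mem (hs : IsSigma L s) {z : ℂ} (hz : z ∈ L.lattice) : s z = 0 :=
  (hs.eq_zero_iff z).mpr hz

/-- The function `℘ s²` extends to an entire function: at a lattice point the double pole of `℘` is
cancelled, and the value `s'²` of the extension is not zero. -/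
theorem exists_entire_weierstrassP_mul_sq (hs : IsSigma L s) :
    ∃ M : ℂ → ℂ, Differentiable ℂ M ∧ (∀ z ∉ L.lattice, M z = L.weierstrassP z * s z ^ 2) ∧
      ∀ z ∈ L.lattice, M z = deriv s z ^ 2 := by
  classical
  refine ⟨fun z => if z ∈ L.lattice then deriv s z ^ 2 else L.weierstrassP z * s z ^ 2,
    fun z => ?_, fun z hz => by simp [hz], fun z hz => by simp [hz]⟩
  by_cases hz : z ∈ L.lattice
  · have hd : DifferentiableAt ℂ (dslope s z) z :=
      ((Complex.differentiableOn_dslope univ_mem).mpr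
        hs.differentiable.differentiableOn).differentiableAt univ_mem
    have hP : DifferentiableAt ℂ (L.weierstrassPExcept z) z :=
      (L.analyticAt_weierstrassPExcept z).differentiableAt
    have hsz := hs.differentiable z
    have : DifferentiableAt ℂ (fun w => (L.weierstrassPExcept z w - 1 / z ^ 2) * s w ^ 2
        + dslope s z w ^ 2) z := by fun_prop
    refine this.congr_of_eventuallyEq ?_
    filter_upwards [L.compl_lattice_sdiff_singleton_mem_nhds z] with w hw
    rcases eq_or_ne w z with rfl | hwz
    · simp [hz, hs.eq_zero_of_mem hz]
    · have hw' : w ∉ L.lattice := fun h => hw ⟨h, by simpa using hwz⟩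
      have e : s w = (w - z) * dslope s z w := by
        simpa [hs.eq_zero_of_mem hz, eq_comm] using sub_smul_dslope s z w
      have hwz' : w - z ≠ 0 := sub_ne_zero.mpr hwz
      have hPE := L.weierstrassPExcept_def ⟨z, hz⟩ w
      simp only at hPE
      simp only [hw', if_false]
      rw [hPE, e]
      field_simp
      ring
  · have hP : DifferentiableAt ℂ L.weierstrassP z :=
      (L.analyticOnNhd_weierstrassP z hz).differentiableAt
    have hsz := hs.differentiable z
    have : DifferentiableAt ℂ (fun w => L.weierstrassP w * s w ^ 2) z := by fun_prop
    refine this.congr_of_eventuallyEq ?_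
    filter_upwards [L.isClosed_lattice.isOpen_compl.mem_nhds hz] with w hw
    have : w ∉ L.lattice := hw
    simp [this]

/-- Iteration of the quasi-periodicity of `s` for the period `l`; the hypothesis on `b` normalizes
the multiplier so that the constant term is `4 b`. -/
theorem quasi_two_mul {l a b : ℂ} (hab : Complex.exp (2 * b - a * l) = 1)
    (h : ∀ z, s (z + l) = Complex.exp (a * z + b) * s z) (u : ℂ) :
    s (u + 2 * l) = Complex.exp (2 * a * u + 4 * b) * s u := by
  have e : Complex.exp (2 * a * u + 4 * b) =
      Complex.exp (a * (u + l) + b) * Complex.exp (a * u + b) := by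
    rw [← Complex.exp_add, ← one_mul (Complex.exp (a * (u + l) + b + (a * u + b))), ← hab,
      ← Complex.exp_add]
    congr 1; ring
  rw [show u + 2 * l = u + l + l by ring, h, h, e, mul_assoc]

theorem weierstrassP_add_mem {l : ℂ} (hl : l ∈ L.lattice) (z : ℂ) :
    L.weierstrassP (z + l) = L.weierstrassP z := L.weierstrassP_add_coe z ⟨l, hl⟩

theorem derivWeierstrassP_add_mem {l : ℂ} (hl : l ∈ L.lattice) (z : ℂ) :
    L.derivWeierstrassP (z + l) = L.derivWeierstrassP z := L.derivWeierstrassP_add_coe z ⟨l, hl⟩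

theorem add_notMem {l z : ℂ} (hl : l ∈ L.lattice) (hz : z ∉ L.lattice) : z + l ∉ L.lattice :=
  fun h => hz (by simpa using sub_mem h hl)

/-- The product formula for `℘(z) - ℘(w)` multiplied by `s(z)²`, with an entire function `M` in
place of `℘ s²`. As `2 w` is not a period, the zeros of `s(z - w) s(z + w)` are simple, and the
quotient of the two sides is an entire function with trivial multipliers, hence constant. -/
theorem weierstrassP_sub_aux (hs : IsSigma L s) {w : ℂ} (hw : w ∉ L.lattice)
    (h2w : 2 * w ∉ L.lattice) {M : ℂ → ℂ} (hM : Differentiable ℂ M)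
    (hM1 : ∀ z ∉ L.lattice, M z = L.weierstrassP z * s z ^ 2)
    (hM2 : ∀ z ∈ L.lattice, M z = deriv s z ^ 2) (z : ℂ) :
    (M z - L.weierstrassP w * s z ^ 2) * s w ^ 2 = -deriv s 0 ^ 2 * (s (z - w) * s (z + w)) := by
  have hd := hs.differentiable
  have hdm : Differentiable ℂ (fun z => s (z - w)) := hd.comp (f := fun z => z - w) (by fun_prop)
  have hdp : Differentiable ℂ (fun z => s (z + w)) := hd.comp (f := fun z => z + w) (by fun_prop)
  set A : ℂ → ℂ := fun z => M z - L.weierstrassP w * s z ^ 2 with hAdef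
  set B : ℂ → ℂ := fun z => s (z - w) * s (z + w) with hBdef
  have hA : Differentiable ℂ A := by fun_prop
  have hB : Differentiable ℂ B := hdm.mul hdp
  have hderiv : ∀ z, deriv B z = deriv s (z - w) * s (z + w) + s (z - w) * deriv s (z + w) := by
    intro z
    have h1 := (hd (z - w)).hasDerivAt.comp_sub_const z w
    have h2 := (hd (z + w)).hasDerivAt.comp_add_const z w
    exact (h1.mul h2).deriv
  obtain ⟨g, hg, hgA⟩ := exists_entire_quotient hA hB fun z hz => by
    rcases mul_eq_zero.mp hz with h | h
    · have hl := (hs.eq_zero_iff _).mp h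
      have hz : z ∉ L.lattice := fun h => hw (by simpa using sub_mem h hl)
      have hP : L.weierstrassP z = L.weierstrassP w := by
        simpa using weierstrassP_add_mem hl w
      refine ⟨by simp [A, hM1 z hz, hP], ?_⟩
      rw [hderiv, h, zero_mul, add_zero]
      refine mul_ne_zero (hs.deriv_ne_zero_of_mem hl) (hs.ne_zero_of_notMem ?_)
      have := add_notMem hl h2w
      rwa [show 2 * w + (z - w) = z + w by ring] at this
    · have hl := (hs.eq_zero_iff _).mp h
      have hz : z ∉ L.lattice := fun h => hw (by simpa using sub_mem hl h)
      have hP : L.weierstrassP z = L.weierstrassP w := by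
        have := weierstrassP_add_mem hl (-w)
        rwa [L.weierstrassP_neg, show -w + (z + w) = z by ring] at this
      refine ⟨by simp [A, hM1 z hz, hP], ?_⟩
      rw [hderiv, h, mul_zero, zero_add]
      refine mul_ne_zero (hs.ne_zero_of_notMem ?_) (hs.deriv_ne_zero_of_mem hl)
      intro h'
      exact h2w (by have := sub_mem hl h'; ring_nf at this ⊢; exact this)
  have hconst := eq_const_of_quasiperiodic (L := L) (S := {z | z ∉ L.lattice ∧ B z ≠ 0})
    hg hgA ?_ ?_
  · have h0 := hgA 0
    have hz := hgA z
    rw [hconst z 0] at hz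
    have e0 : A 0 = deriv s 0 ^ 2 := by
      simp [A, hM2 0 (zero_mem _), hs.eq_zero_of_mem (zero_mem _)]
    have eB : B 0 = -s w ^ 2 := by simp [B, hs.neg]; ring
    rw [e0, eB] at h0
    show A z * s w ^ 2 = -deriv s 0 ^ 2 * B z
    rw [hz, h0]; ring
  · have : ((fun z => z - w) ⁻¹' (L.lattice : Set ℂ) ∪ ((fun z => z + w) ⁻¹' (L.lattice : Set ℂ)
        ∪ L.lattice)).Countable :=
      ((countable_lattice L).preimage_of_injOn (sub_left_injective (b := w)).injOn).union
        (((countable_lattice L).preimage_of_injOn (add_left_injective w).injOn).union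
          (countable_lattice L))
    refine (this.dense_compl ℝ).mono fun z hz => ?_
    simp only [Set.mem_compl_iff, Set.mem_union, Set.mem_preimage, SetLike.mem_coe, not_or] at hz
    exact ⟨hz.2.2, mul_ne_zero (hs.ne_zero_of_notMem hz.1) (hs.ne_zero_of_notMem hz.2.1)⟩
  · rintro l hl z ⟨hz, hBz⟩
    obtain ⟨a, b, -, h⟩ := hs.quasi l hl
    refine ⟨Complex.exp (a * z + b) ^ 2, pow_ne_zero _ (Complex.exp_ne_zero _), ?_, ?_, hBz⟩
    · simp only [A]
      rw [hM1 z hz, hM1 _ (add_notMem hl hz), h, weierstrassP_add_mem hl]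
      ring
    · simp only [B]
      rw [show z + l - w = z - w + l by ring, show z + l + w = z + w + l by ring, h, h]
      have : Complex.exp (a * (z - w) + b) * Complex.exp (a * (z + w) + b)
          = Complex.exp (a * z + b) ^ 2 := by
        rw [← Complex.exp_add, ← Complex.exp_nat_mul]; congr 1; push_cast; ring
      rw [← this]; ring

/-- The classical formula `℘(z) - ℘(w) = -σ(z - w) σ(z + w) / (σ(z)² σ(w)²)`, for a sigma function
that is not normalized by `σ'(0) = 1`. -/
theorem weierstrassP_sub (hs : IsSigma L s) {z w : ℂ} (hz : z ∉ L.lattice) (hw : w ∉ L.lattice) :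
    (L.weierstrassP z - L.weierstrassP w) * (s z ^ 2 * s w ^ 2) =
      -deriv s 0 ^ 2 * (s (z - w) * s (z + w)) := by
  obtain ⟨M, hM, hM1, hM2⟩ := hs.exists_entire_weierstrassP_mul_sq
  have hc := hs.differentiable.continuous
  have hMc := hM.continuous
  have := Continuous.ext_on (dense_two_mul_notMem L)
    (f := fun w => (L.weierstrassP z * s w ^ 2 - M w) * s z ^ 2)
    (g := fun w => -deriv s 0 ^ 2 * (s (z - w) * s (z + w))) (by fun_prop) (by fun_prop)
    fun w ⟨hw, h2w⟩ => by
      simp only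
      rw [← hs.weierstrassP_sub_aux hw h2w hM hM1 hM2, hM1 z hz, hM1 w hw]
      ring
  have h := congrFun this w
  simp only [hM1 w hw] at h
  rw [← h]; ring

theorem hasDerivAt_weierstrassP {z : ℂ} (hz : z ∉ L.lattice) :
    HasDerivAt L.weierstrassP (L.derivWeierstrassP z) z := by
  have := (L.analyticOnNhd_weierstrassP z hz).differentiableAt.hasDerivAt
  rwa [L.deriv_weierstrassP] at this

/-- The formula `℘'(w) = -σ(2w) / σ(w)⁴`, again without the normalization `σ'(0) = 1`. -/
theorem derivWeierstrassP_eq (hs : IsSigma L s) {w : ℂ} (hw : w ∉ L.lattice) :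
    L.derivWeierstrassP w * s w ^ 4 = -deriv s 0 ^ 3 * s (2 * w) := by
  have hd := hs.differentiable
  have h0 := hs.eq_zero_of_mem (zero_mem L.lattice)
  have h1 : HasDerivAt (fun z => (L.weierstrassP z - L.weierstrassP w) * (s z ^ 2 * s w ^ 2))
      (L.derivWeierstrassP w * (s w ^ 2 * s w ^ 2)) w := by
    have hq : DifferentiableAt ℂ (fun z => s z ^ 2 * s w ^ 2) w := by
      have := hd w
      fun_prop
    have := ((hasDerivAt_weierstrassP hw).sub_const (L.weierstrassP w)).fun_mul hq.hasDerivAt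
    simpa using this
  have h2 : HasDerivAt (fun z => -deriv s 0 ^ 2 * (s (z - w) * s (z + w)))
      (-deriv s 0 ^ 2 * (deriv s 0 * s (2 * w))) w := by
    have e1 := (hd (w - w)).hasDerivAt.comp_sub_const w w
    have e2 := (hd (w + w)).hasDerivAt.comp_add_const w w
    have := (e1.mul e2).const_mul (-deriv s 0 ^ 2)
    simpa [h0, two_mul] using this
  have h3 := h1.congr_of_eventuallyEq (f₁ := fun z => -deriv s 0 ^ 2 * (s (z - w) * s (z + w))) (by
    filter_upwards [L.isClosed_lattice.isOpen_compl.mem_nhds hw] with z hz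
    exact (hs.weierstrassP_sub hz hw).symm)
  have := h3.unique h2
  linear_combination this

theorem derivWeierstrassP_eq_zero_iff (hs : IsSigma L s) {w : ℂ} (hw : w ∉ L.lattice) :
    L.derivWeierstrassP w = 0 ↔ 2 * w ∈ L.lattice := by
  have h := hs.derivWeierstrassP_eq hw
  rw [← hs.eq_zero_iff]
  constructor
  · intro h0
    rw [h0, zero_mul, eq_comm] at h
    exact (mul_eq_zero.mp h).resolve_left (neg_ne_zero.mpr (pow_ne_zero _ hs.deriv_ne_zero))
  · intro h0
    rw [h0, mul_zero] at h
    exact (mul_eq_zero.mp h).resolve_right (pow_ne_zero _ (hs.ne_zero_of_notMem hw))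

theorem weierstrassP_eq_iff (hs : IsSigma L s) {z w : ℂ} (hz : z ∉ L.lattice)
    (hw : w ∉ L.lattice) :
    L.weierstrassP z = L.weierstrassP w ↔ z - w ∈ L.lattice ∨ z + w ∈ L.lattice := by
  rw [← hs.eq_zero_iff, ← hs.eq_zero_iff, ← mul_eq_zero, ← sub_eq_zero]
  have h := hs.weierstrassP_sub hz hw
  have h1 : s z ^ 2 * s w ^ 2 ≠ 0 := mul_ne_zero (pow_ne_zero _ (hs.ne_zero_of_notMem hz))
    (pow_ne_zero _ (hs.ne_zero_of_notMem hw))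
  have h2 : -deriv s 0 ^ 2 ≠ 0 := neg_ne_zero.mpr (pow_ne_zero _ hs.deriv_ne_zero)
  constructor <;> intro h0 <;> rw [h0] at h
  · rw [zero_mul, eq_comm] at h; exact (mul_eq_zero.mp h).resolve_left h2
  · rw [mul_zero] at h; exact (mul_eq_zero.mp h).resolve_right h1

/-- The function `℘` takes every value: if `℘ - c` had no zeros, then `s² / (M - c s²)`, with `M`
the entire extension of `℘ s²`, would be an elliptic function without poles that vanishes at the
origin but not identically. -/
theorem exists_weierstrassP_eq (hs : IsSigma L s) (c : ℂ) :
    ∃ z ∉ L.lattice, L.weierstrassP z = c := by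
  by_contra! hcon
  obtain ⟨M, hM, hM1, hM2⟩ := hs.exists_entire_weierstrassP_mul_sq
  have hd := hs.differentiable
  have hne : ∀ z, M z - c * s z ^ 2 ≠ 0 := by
    intro z
    by_cases hz : z ∈ L.lattice
    · rw [hM2 z hz, hs.eq_zero_of_mem hz]
      simpa using hs.deriv_ne_zero_of_mem hz
    · rw [hM1 z hz, ← sub_mul]
      exact mul_ne_zero (sub_ne_zero.mpr (hcon z hz)) (pow_ne_zero _ (hs.ne_zero_of_notMem hz))
  have hg : Differentiable ℂ (fun z => s z ^ 2 / (M z - c * s z ^ 2)) :=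
    (by fun_prop : Differentiable ℂ fun z => s z ^ 2).div (by fun_prop) hne
  obtain ⟨z, hz⟩ : ∃ z, z ∉ L.lattice := (dense_compl_lattice L).nonempty
  have := eq_const_of_quasiperiodic (L := L) (A := fun z => s z ^ 2)
    (B := fun z => M z - c * s z ^ 2) hg (fun z => (div_mul_cancel₀ _ (hne z)).symm)
    (dense_compl_lattice L) (fun l hl z hz => by
      obtain ⟨a, b, -, h⟩ := hs.quasi l hl
      refine ⟨Complex.exp (a * z + b) ^ 2, pow_ne_zero _ (Complex.exp_ne_zero _), ?_, ?_, hne z⟩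
      · simp only [h]; ring
      · rw [hM1 z hz, hM1 _ (add_notMem hl hz), h, weierstrassP_add_mem hl]
        ring) z 0
  simp only [hs.eq_zero_of_mem (zero_mem L.lattice)] at this
  simp [hs.ne_zero_of_notMem hz, hne z] at this

end IsSigma

/-! ### The uniformization of a Legendre curve and the duplication formula -/

/-- `L` is an oriented pair of periods of the Legendre curve with parameter `t ≠ 0, 1`. -/
structure IsLegendrePeriods (L : PeriodPair) (t : ℂ) : Prop where
  ne_zero : t ≠ 0
  ne_one : t ≠ 1
  oriented : 0 < (L.ω₂ / L.ω₁).im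
  g₂_eq : L.g₂ = -4 * (t - (1 + t) ^ 2 / 3)
  g₃_eq : L.g₃ = -4 * (t * (1 + t) / 3 - 2 * (1 + t) ^ 3 / 27)

/-- The `x`-coordinate of the uniformization. -/
def xCoord (L : PeriodPair) (t z : ℂ) : ℂ := L.weierstrassP z + (1 + t) / 3

/-- The `y`-coordinate of the uniformization. -/
def yCoord (L : PeriodPair) (z : ℂ) : ℂ := L.derivWeierstrassP z / 2

theorem legendre_Δ (t : ℂ) : (legendre t).Δ = 16 * t ^ 2 * (t - 1) ^ 2 := by
  simp only [WeierstrassCurve.Δ, WeierstrassCurve.b₂, WeierstrassCurve.b₄, WeierstrassCurve.b₆,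
    WeierstrassCurve.b₈, legendre]
  ring

theorem legendre_nonsingular {t x y : ℂ} (h0 : t ≠ 0) (h1 : t ≠ 1)
    (h : y ^ 2 = x * (x - 1) * (x - t)) : (legendre t).toAffine.Nonsingular x y := by
  refine (WeierstrassCurve.Affine.equation_iff_nonsingular_of_Δ_ne_zero ?_).mp
    ((legendre_equation_iff t x y).mpr h)
  rw [legendre_Δ]
  simp [h0, sub_ne_zero.mpr h1]

namespace IsLegendrePeriods

open IsSigma

variable {L : PeriodPair} {t : ℂ}

theorem equation (h : IsLegendrePeriods L t) {z : ℂ} (hz : z ∉ L.lattice) :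
    yCoord L z ^ 2 = xCoord L t z * (xCoord L t z - 1) * (xCoord L t z - t) := by
  have := L.derivWeierstrassP_sq z hz
  rw [h.g₂_eq, h.g₃_eq] at this
  simp only [xCoord, yCoord]
  linear_combination this / 4

theorem nonsingular (h : IsLegendrePeriods L t) {z : ℂ} (hz : z ∉ L.lattice) :
    (legendre t).toAffine.Nonsingular (xCoord L t z) (yCoord L z) :=
  legendre_nonsingular h.ne_zero h.ne_one (h.equation hz)

theorem isSigma (h : IsLegendrePeriods L t) : IsSigma L (latticeSigma L) :=
  isSigma_latticeSigma h.oriented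

theorem yCoord_eq_zero_iff (h : IsLegendrePeriods L t) {z : ℂ} (hz : z ∉ L.lattice) :
    yCoord L z = 0 ↔ 2 * z ∈ L.lattice := by
  rw [← h.isSigma.derivWeierstrassP_eq_zero_iff hz, yCoord]
  simp

theorem xCoord_eq_iff (h : IsLegendrePeriods L t) {z w : ℂ} (hz : z ∉ L.lattice)
    (hw : w ∉ L.lattice) :
    xCoord L t z = xCoord L t w ↔ z - w ∈ L.lattice ∨ z + w ∈ L.lattice := by
  rw [← h.isSigma.weierstrassP_eq_iff hz hw, xCoord, xCoord, add_left_inj]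

theorem exists_xCoord_eq (h : IsLegendrePeriods L t) (x : ℂ) :
    ∃ z ∉ L.lattice, xCoord L t z = x := by
  obtain ⟨z, hz, hx⟩ := h.isSigma.exists_weierstrassP_eq (x - (1 + t) / 3)
  exact ⟨z, hz, by rw [xCoord, hx]; ring⟩

theorem xCoord_add_mem {l : ℂ} (hl : l ∈ L.lattice) (z : ℂ) :
    xCoord L t (z + l) = xCoord L t z := by rw [xCoord, weierstrassP_add_mem hl, xCoord]

theorem yCoord_add_mem {l : ℂ} (hl : l ∈ L.lattice) (z : ℂ) :
    yCoord L (z + l) = yCoord L z := by rw [yCoord, derivWeierstrassP_add_mem hl, yCoord]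

theorem xCoord_neg (z : ℂ) : xCoord L t (-z) = xCoord L t z := by
  rw [xCoord, L.weierstrassP_neg, xCoord]

theorem yCoord_neg (z : ℂ) : yCoord L (-z) = -yCoord L z := by
  rw [yCoord, L.derivWeierstrassP_neg, yCoord, neg_div]

/-- A point of `ℂ` over the `2`-torsion point `(e, 0)`. -/
theorem exists_halfPeriod (h : IsLegendrePeriods L t) {e : ℂ} (he : e * (e - 1) * (e - t) = 0) :
    ∃ a ∉ L.lattice, 2 * a ∈ L.lattice ∧ xCoord L t a = e := by
  obtain ⟨a, ha, hx⟩ := h.exists_xCoord_eq e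
  refine ⟨a, ha, (h.yCoord_eq_zero_iff ha).mp ?_, hx⟩
  have := h.equation ha
  rw [hx, he] at this
  exact pow_eq_zero_iff two_ne_zero |>.mp this

/-- The product formula for `x`, whose zeros are the points over `(0, 0)`. -/
theorem xCoord_mul_sq (h : IsLegendrePeriods L t) {a : ℂ} (ha : a ∉ L.lattice)
    (hx : xCoord L t a = 0) {z : ℂ} (hz : z ∉ L.lattice) :
    xCoord L t z * (latticeSigma L z ^ 2 * latticeSigma L a ^ 2) =
      -deriv (latticeSigma L) 0 ^ 2 * (latticeSigma L (z - a) * latticeSigma L (z + a)) := by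
  rw [← h.isSigma.weierstrassP_sub hz ha]
  simp only [xCoord] at hx ⊢
  linear_combination (latticeSigma L z ^ 2 * latticeSigma L a ^ 2) * hx

/-- Translation by the `2`-torsion point `(0, 0)` is `x ↦ t / x`. -/
theorem xCoord_mul_xCoord_add (h : IsLegendrePeriods L t) {a : ℂ} (ha : a ∉ L.lattice)
    (h2a : 2 * a ∈ L.lattice) (hx : xCoord L t a = 0) {z : ℂ} (hz : z ∉ L.lattice)
    (hza : z + a ∉ L.lattice) : xCoord L t z * xCoord L t (z + a) = t := by
  have hs := h.isSigma
  set s := latticeSigma L with hsdef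
  obtain ⟨α, β, -, hq⟩ := hs.quasi _ h2a
  -- the product is constant, by the product formula for `x`
  have key : ∀ z, z ∉ L.lattice → z + a ∉ L.lattice →
      xCoord L t z * xCoord L t (z + a) * s a ^ 4 = deriv s 0 ^ 4 * Complex.exp (α * a) := by
    intro z hz hza
    have e1 := h.xCoord_mul_sq ha hx hz
    have e2 := h.xCoord_mul_sq ha hx hza
    rw [← hsdef] at e1 e2
    have q1 := hq z
    have q2 := hq (z - a)
    rw [show z - a + 2 * a = z + a by ring] at q2
    rw [show z + a - a = z by ring, show z + a + a = z + 2 * a by ring, q1] at e2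
    have hsz := hs.ne_zero_of_notMem hz
    have hsza := hs.ne_zero_of_notMem hza
    have hE : Complex.exp (α * z + β) = Complex.exp (α * (z - a) + β) * Complex.exp (α * a) := by
      rw [← Complex.exp_add]; congr 1; ring
    have hne : s z ^ 2 * s (z + a) ^ 2 ≠ 0 :=
      mul_ne_zero (pow_ne_zero _ hsz) (pow_ne_zero _ hsza)
    refine mul_right_cancel₀ hne ?_
    calc xCoord L t z * xCoord L t (z + a) * s a ^ 4 * (s z ^ 2 * s (z + a) ^ 2)
        = (xCoord L t z * (s z ^ 2 * s a ^ 2)) *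
            (xCoord L t (z + a) * (s (z + a) ^ 2 * s a ^ 2)) := by
          ring
      _ = deriv s 0 ^ 4 * s z ^ 2 * s (z + a) * (Complex.exp (α * (z - a) + β) * s (z - a))
          * Complex.exp (α * a) := by rw [e1, e2, hE]; ring
      _ = _ := by rw [← q2]; ring
  obtain ⟨b, hb, h2b, hxb⟩ := h.exists_halfPeriod (e := 1) (by ring)
  have hba : b + a ∉ L.lattice := fun hmem => by
    have := (h.xCoord_eq_iff hb ha).mpr (Or.inr hmem)
    rw [hxb, hx] at this
    exact one_ne_zero this
  -- the constant is found at the half period over `(1, 0)`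
  have hxt : xCoord L t (b + a) = t := by
    have h2 : 2 * (b + a) ∈ L.lattice := by rw [mul_add]; exact add_mem h2b h2a
    have h0 := h.equation hba
    rw [(h.yCoord_eq_zero_iff hba).mpr h2] at h0
    have n0 : xCoord L t (b + a) ≠ 0 := by
      rw [← hx, Ne, h.xCoord_eq_iff hba ha]
      rintro (hm | hm)
      · exact hb (by simpa using hm)
      · exact hb (by have := sub_mem hm h2a; ring_nf at this; exact this)
    have n1 : xCoord L t (b + a) - 1 ≠ 0 := by
      rw [sub_ne_zero, ← hxb, Ne, h.xCoord_eq_iff hba hb]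
      rintro (hm | hm)
      · exact ha (by simpa using hm)
      · exact ha (by have := sub_mem hm h2b; ring_nf at this; exact this)
    have := mul_eq_zero.mp (h0.symm.trans (by norm_num))
    rcases this with h' | h'
    · exact absurd h' (mul_ne_zero n0 n1)
    · exact sub_eq_zero.mp h'
  have h1 := key z hz hza
  rw [← key b hb hba, hxb, hxt, one_mul] at h1
  exact mul_right_cancel₀ (pow_ne_zero 4 (hs.ne_zero_of_notMem ha)) h1

/-- The identity behind the duplication formula for the `x`-coordinate. The zeros of the right-hand
side in `z` are the points with `2 z ≡ a`, at which `z + a ≡ -z`, so that `x(z)² = t` by the formula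
for translation by `(0, 0)`. Each of the factors `σ(2 z ± a)` has simple zeros, so it divides
`(x² - t) σ⁴`, and their product divides the square of this function. The quotient is then an entire
function with trivial multipliers, hence constant. -/
theorem xCoord_two_mul_aux (h : IsLegendrePeriods L t) {a : ℂ} (ha : a ∉ L.lattice)
    (h2a : 2 * a ∈ L.lattice) (hx : xCoord L t a = 0) {z : ℂ} (hz : z ∉ L.lattice) :
    (xCoord L t z ^ 2 - t) ^ 2 * latticeSigma L z ^ 8 * latticeSigma L a ^ 2 =
      -deriv (latticeSigma L) 0 ^ 8 *
        (latticeSigma L (2 * z - a) * latticeSigma L (2 * z + a)) := by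
  have hs := h.isSigma
  set s := latticeSigma L with hsdef
  have hd := hs.differentiable
  obtain ⟨M, hM, hM1, hM2⟩ := hs.exists_entire_weierstrassP_mul_sq
  set A : ℂ → ℂ := fun z => (M z + (1 + t) / 3 * s z ^ 2) ^ 2 - t * s z ^ 4 with hAdef
  have hA : Differentiable ℂ A := by fun_prop
  have hA1 : ∀ z ∉ L.lattice, A z = (xCoord L t z ^ 2 - t) * s z ^ 4 := fun z hz => by
    simp only [A, hM1 z hz, xCoord]; ring
  have hroot : ∀ z, 2 * z - a ∈ L.lattice → A z = 0 := by
    intro z hm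
    have hz : z ∉ L.lattice := fun hz => ha (by
      have := sub_mem (add_mem hz hz) hm
      rwa [show z + z - (2 * z - a) = a by ring] at this)
    have hza : z + a ∉ L.lattice := fun hza => hz (by
      have := sub_mem (sub_mem hza h2a) (sub_mem hm (add_mem hza hza))
      ring_nf at this
      have h3 := sub_mem (add_mem hza hza) hm
      have h4 : 3 * a ∈ L.lattice := by ring_nf at h3 ⊢; exact h3
      exact absurd (by have := sub_mem h4 h2a; ring_nf at this; exact this) ha)
    have e : xCoord L t (z + a) = xCoord L t z := by
      rw [h.xCoord_eq_iff hza hz]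
      right
      have := add_mem hm h2a
      ring_nf at this ⊢; exact this
    have := h.xCoord_mul_xCoord_add ha h2a hx hz hza
    rw [e] at this
    rw [hA1 z hz]
    linear_combination s z ^ 4 * this
  have hroot' : ∀ z, 2 * z + a ∈ L.lattice → A z = 0 := fun z hm => hroot z (by
    have := sub_mem hm h2a
    ring_nf at this ⊢; exact this)
  have hD : ∀ c z, HasDerivAt (fun z => s (2 * z + c)) (2 * deriv s (2 * z + c)) z := by
    intro c z
    have h1 : HasDerivAt (fun z : ℂ => 2 * z + c) 2 z := by
      simpa using ((hasDerivAt_id z).const_mul (2 : ℂ)).add_const c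
    have := (hd (2 * z + c)).hasDerivAt.comp z h1
    rw [mul_comm]; exact this
  have hq : ∀ c, (∀ z, 2 * z + c ∈ L.lattice → A z = 0) →
      ∃ g : ℂ → ℂ, Differentiable ℂ g ∧ ∀ z, A z = g z * s (2 * z + c) := fun c hc =>
    exists_entire_quotient hA (fun z => (hD c z).differentiableAt) fun z hz => by
      have hm := (hs.eq_zero_iff _).mp hz
      refine ⟨hc z hm, ?_⟩
      rw [(hD c z).deriv]
      exact mul_ne_zero two_ne_zero (hs.deriv_ne_zero_of_mem hm)
  obtain ⟨g₁, hg₁, e₁⟩ := hq (-a) (fun z hm => hroot z (by rwa [sub_eq_add_neg]))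
  obtain ⟨g₂, hg₂, e₂⟩ := hq a hroot'
  set B : ℂ → ℂ := fun z => s (2 * z - a) * s (2 * z + a) with hBdef
  have hg : ∀ z, A z ^ 2 = (g₁ z * g₂ z) * B z := fun z => by
    simp only [B]
    rw [sq]; nth_rewrite 1 [e₁]; rw [e₂, ← sub_eq_add_neg]; ring
  have hconst := eq_const_of_quasiperiodic (L := L) (g := fun z => g₁ z * g₂ z)
    (A := fun z => A z ^ 2) (S := {z | z ∉ L.lattice ∧ B z ≠ 0}) (hg₁.mul hg₂) hg ?_ ?_
  · have h0 := hg 0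
    have hz' := hg z
    have hc := hconst z 0
    rw [hc] at hz'
    have eA : A 0 = deriv s 0 ^ 4 := by
      simp [A, hM2 0 (zero_mem _), hs.eq_zero_of_mem (zero_mem _)]; ring
    have eB : B 0 = -s a ^ 2 := by simp [B, hs.neg]; ring
    rw [eA, eB] at h0
    show _ = -deriv s 0 ^ 8 * B z
    rw [hA1 z hz] at hz'
    linear_combination s a ^ 2 * hz' + B z * h0
  · have hc : ∀ c : ℂ, ((fun z => 2 * z + c) ⁻¹' (L.lattice : Set ℂ)).Countable := fun c =>
      (countable_lattice L).preimage_of_injOn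
        ((add_left_injective c).comp (mul_right_injective₀ two_ne_zero)).injOn
    have := ((hc (-a)).union (hc a)).union (countable_lattice L)
    refine (this.dense_compl ℝ).mono fun z hz => ?_
    simp only [Set.mem_compl_iff, Set.mem_union, Set.mem_preimage, SetLike.mem_coe, not_or,
      ← sub_eq_add_neg] at hz
    exact ⟨hz.2, mul_ne_zero (hs.ne_zero_of_notMem hz.1.1) (hs.ne_zero_of_notMem hz.1.2)⟩
  · rintro l hl z ⟨hz, hBz⟩
    obtain ⟨α, β, hαβ, hq⟩ := hs.quasi l hl
    refine ⟨Complex.exp (α * z + β) ^ 8, pow_ne_zero _ (Complex.exp_ne_zero _), ?_, ?_, hBz⟩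
    · rw [hA1 z hz, hA1 _ (add_notMem hl hz), hq, xCoord_add_mem hl]
      ring
    · simp only [B]
      rw [show 2 * (z + l) - a = 2 * z - a + 2 * l by ring,
        show 2 * (z + l) + a = 2 * z + a + 2 * l by ring, quasi_two_mul hαβ hq,
        quasi_two_mul hαβ hq]
      have : Complex.exp (2 * α * (2 * z - a) + 4 * β) * Complex.exp (2 * α * (2 * z + a) + 4 * β)
          = Complex.exp (α * z + β) ^ 8 := by
        rw [← Complex.exp_add, ← Complex.exp_nat_mul]; congr 1; push_cast; ring
      rw [← this]; ring

theorem xCoord_two_mul (h : IsLegendrePeriods L t) {z : ℂ} (hz : z ∉ L.lattice)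
    (h2z : 2 * z ∉ L.lattice) :
    xCoord L t (2 * z) * L.derivWeierstrassP z ^ 2 = (xCoord L t z ^ 2 - t) ^ 2 := by
  obtain ⟨a, ha, h2a, hx⟩ := h.exists_halfPeriod (e := 0) (by ring)
  have hs := h.isSigma
  have e1 := h.xCoord_two_mul_aux ha h2a hx hz
  have e2 := h.xCoord_mul_sq ha hx h2z
  have e3 := hs.derivWeierstrassP_eq hz
  set s := latticeSigma L
  have hne : s z ^ 8 * s a ^ 2 ≠ 0 := mul_ne_zero (pow_ne_zero _ (hs.ne_zero_of_notMem hz))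
    (pow_ne_zero _ (hs.ne_zero_of_notMem ha))
  refine mul_right_cancel₀ hne ?_
  calc _ = xCoord L t (2 * z) * (L.derivWeierstrassP z * s z ^ 4) ^ 2 * s a ^ 2 := by ring
    _ = deriv s 0 ^ 6 * (xCoord L t (2 * z) * (s (2 * z) ^ 2 * s a ^ 2)) := by rw [e3]; ring
    _ = _ := by rw [e2, ← mul_assoc _ (s z ^ 8), e1]; ring

theorem hasDerivAt_xCoord {z : ℂ} (hz : z ∉ L.lattice) :
    HasDerivAt (xCoord L t) (2 * yCoord L z) z := by
  have := (hasDerivAt_weierstrassP hz).add_const ((1 + t) / 3)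
  rwa [show L.derivWeierstrassP z = 2 * yCoord L z by rw [yCoord]; ring] at this

theorem hasDerivAt_yCoord (h : IsLegendrePeriods L t) {z : ℂ} (hz : z ∉ L.lattice)
    (h2z : 2 * z ∉ L.lattice) :
    HasDerivAt (yCoord L) (3 * xCoord L t z ^ 2 - 2 * (1 + t) * xCoord L t z + t) z := by
  have hy : HasDerivAt (yCoord L) (deriv (yCoord L) z) z :=
    ((L.analyticOnNhd_derivWeierstrassP z hz).differentiableAt.div_const 2).hasDerivAt
  have hx := hasDerivAt_xCoord (t := t) hz
  have h1 := hy.fun_pow 2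
  have h2 := (hx.fun_mul (hx.sub_const 1)).fun_mul (hx.sub_const t)
  have h3 := h1.congr_of_eventuallyEq
    (f₁ := fun z => xCoord L t z * (xCoord L t z - 1) * (xCoord L t z - t)) (by
      filter_upwards [L.isClosed_lattice.isOpen_compl.mem_nhds hz] with w hw
      exact (h.equation hw).symm)
  have h4 := h3.unique h2
  have hy0 : yCoord L z ≠ 0 := fun h0 => h2z ((h.yCoord_eq_zero_iff hz).mp h0)
  have : deriv (yCoord L) z = 3 * xCoord L t z ^ 2 - 2 * (1 + t) * xCoord L t z + t := by
    refine mul_left_cancel₀ (mul_ne_zero two_ne_zero hy0) ?_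
    push_cast at h4
    linear_combination h4
  rwa [this] at hy

/-- The duplication formula for the `y`-coordinate, obtained by differentiating the one for `x`. -/
theorem yCoord_two_mul (h : IsLegendrePeriods L t) {z : ℂ} (hz : z ∉ L.lattice)
    (h2z : 2 * z ∉ L.lattice) :
    yCoord L (2 * z) * (2 * yCoord L z) = xCoord L t z * (xCoord L t z ^ 2 - t) -
      xCoord L t (2 * z) * (3 * xCoord L t z ^ 2 - 2 * (1 + t) * xCoord L t z + t) := by
  have hy0 : yCoord L z ≠ 0 := fun h0 => h2z ((h.yCoord_eq_zero_iff hz).mp h0)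
  have hx := hasDerivAt_xCoord (t := t) hz
  have hy := h.hasDerivAt_yCoord hz h2z
  have hx2 : HasDerivAt (fun z => xCoord L t (2 * z)) (2 * (2 * yCoord L (2 * z))) z := by
    have h1 : HasDerivAt (fun z : ℂ => 2 * z) 2 z := by
      simpa using (hasDerivAt_id z).const_mul (2 : ℂ)
    have := (hasDerivAt_xCoord (t := t) h2z).comp z h1
    rw [mul_comm]; exact this
  have h1 := hx2.fun_mul ((hy.const_mul 2).fun_pow 2)
  have h2 := ((hx.fun_pow 2).sub_const t).fun_pow 2
  have hc2 : Continuous fun z : ℂ => 2 * z := by fun_prop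
  have h3 := h1.congr_of_eventuallyEq (f₁ := fun z => (xCoord L t z ^ 2 - t) ^ 2) (by
    filter_upwards [L.isClosed_lattice.isOpen_compl.mem_nhds hz,
      hc2.continuousAt.preimage_mem_nhds (L.isClosed_lattice.isOpen_compl.mem_nhds h2z)]
      with w hw h2w
    rw [← h.xCoord_two_mul hw h2w, yCoord]; ring)
  have h4 := h3.unique h2
  push_cast at h4
  refine mul_left_cancel₀ (mul_ne_zero (by norm_num : (8 : ℂ) ≠ 0) hy0) ?_
  linear_combination h4

/-- The uniformization carries the doubling of `ℂ` to the doubling of the elliptic curve. -/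
theorem two_nsmul_some (h : IsLegendrePeriods L t) {z : ℂ} (hz : z ∉ L.lattice)
    (h2z : 2 * z ∉ L.lattice) :
    (2 • (.some _ _ (h.nonsingular hz) : (legendre t).toAffine.Point)) =
      .some _ _ (h.nonsingular h2z) := by
  have hy0 : yCoord L z ≠ 0 := fun h0 => h2z ((h.yCoord_eq_zero_iff hz).mp h0)
  have hneg : (legendre t).toAffine.negY (xCoord L t z) (yCoord L z) = -yCoord L z := by
    simp [WeierstrassCurve.Affine.negY, legendre]
  have hne : yCoord L z ≠ (legendre t).toAffine.negY (xCoord L t z) (yCoord L z) := by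
    rw [hneg]
    intro h'
    exact hy0 (by linear_combination h' / 2)
  have hX := h.xCoord_two_mul hz h2z
  have hY := h.yCoord_two_mul hz h2z
  have hE := h.equation hz
  have hX' : xCoord L t (2 * z) * (4 * yCoord L z ^ 2) = (xCoord L t z ^ 2 - t) ^ 2 := by
    rw [← hX, yCoord]; ring
  rw [two_nsmul, WeierstrassCurve.Affine.Point.add_self_of_Y_ne hne]
  have hsl := WeierstrassCurve.Affine.slope_of_Y_ne rfl hne
  rw [hneg] at hsl
  set ℓ := (legendre t).toAffine.slope (xCoord L t z) (xCoord L t z) (yCoord L z) (yCoord L z)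
  have hℓ : ℓ * (2 * yCoord L z) = 3 * xCoord L t z ^ 2 - 2 * (1 + t) * xCoord L t z + t := by
    rw [hsl]
    simp only [legendre]
    rw [show yCoord L z - -yCoord L z = 2 * yCoord L z by ring]
    field_simp
    ring
  set x := xCoord L t z
  set y := yCoord L z
  have ex : (legendre t).toAffine.addX x x ℓ = xCoord L t (2 * z) := by
    simp only [WeierstrassCurve.Affine.addX, legendre]
    refine mul_right_cancel₀ (mul_ne_zero (by norm_num : (4 : ℂ) ≠ 0) (pow_ne_zero 2 hy0)) ?_
    rw [hX']
    linear_combination (ℓ * (2 * y) + (3 * x ^ 2 - 2 * (1 + t) * x + t)) * hℓ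
      + 4 * ((1 + t) - 2 * x) * hE
  have ey : (legendre t).toAffine.addY x x y ℓ = yCoord L (2 * z) := by
    rw [WeierstrassCurve.Affine.addY, WeierstrassCurve.Affine.negAddY, ex]
    simp only [WeierstrassCurve.Affine.negY, legendre]
    refine mul_right_cancel₀ (mul_ne_zero two_ne_zero hy0) ?_
    rw [hY]
    linear_combination (x - xCoord L t (2 * z)) * hℓ - 2 * hE
  congr 1

theorem two_nsmul_ne_zero_iff (h : IsLegendrePeriods L t) {z : ℂ} (hz : z ∉ L.lattice) :
    (2 • (.some _ _ (h.nonsingular hz) : (legendre t).toAffine.Point)) ≠ 0 ↔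
      2 * z ∉ L.lattice := by
  constructor
  · intro h0 h2
    refine h0 ?_
    rw [two_nsmul]
    refine WeierstrassCurve.Affine.Point.add_self_of_Y_eq ?_
    rw [(h.yCoord_eq_zero_iff hz).mpr h2]
    simp [WeierstrassCurve.Affine.negY, legendre]
  · intro h2
    rw [h.two_nsmul_some hz h2]
    exact WeierstrassCurve.Affine.Point.some_ne_zero _

end IsLegendrePeriods

/-! ### The Néron local height in terms of the sigma function -/

/-- The function `π (Im (z / ω₁))² / Im (ω₂ / ω₁)`, which repairs the quasi-periodicity of
`log |σ|`. -/
def quadraticPart (L : PeriodPair) (z : ℂ) : ℝ :=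
  Real.pi * (z / L.ω₁).im ^ 2 / (L.ω₂ / L.ω₁).im

/-- The Néron local height of a Legendre curve as a function on `ℂ`. -/
def neronFun (L : PeriodPair) (t z : ℂ) : ℝ :=
  quadraticPart L z - Real.log ‖latticeSigma L z‖ + Real.log ‖deriv (latticeSigma L) 0‖
    - 1 / 12 * Real.log ‖(legendre t).Δ‖

namespace IsLegendrePeriods

open IsSigma

variable {L : PeriodPair} {t : ℂ}

/-- The height is a function on `ℂ / Λ`: the quadratic part compensates the quasi-periodicity of
`σ`. -/
theorem neronFun_add_mem (h : IsLegendrePeriods L t) {l z : ℂ} (hl : l ∈ L.lattice)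
    (hz : z ∉ L.lattice) : neronFun L t (z + l) = neronFun L t z := by
  have him := h.oriented
  obtain ⟨m, n, hmn⟩ := mem_lattice_iff_div.mp hl
  have hs := h.isSigma.ne_zero_of_notMem hz
  have e : latticeSigma L (z + l) = Complex.exp (Real.pi * Complex.I * (m + n)
      - Real.pi * Complex.I * n ^ 2 * (L.ω₂ / L.ω₁) - 2 * Real.pi * Complex.I * n * (z / L.ω₁))
      * latticeSigma L z := by
    rw [latticeSigma, add_div, hmn, sigmaProd_add_lattice him, latticeSigma]
  have hre : (Real.pi * Complex.I * (m + n) - Real.pi * Complex.I * n ^ 2 * (L.ω₂ / L.ω₁)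
      - 2 * Real.pi * Complex.I * n * (z / L.ω₁)).re =
      Real.pi * n ^ 2 * (L.ω₂ / L.ω₁).im + 2 * Real.pi * n * (z / L.ω₁).im := by
    have e1 : (Real.pi * Complex.I * (m + n) - Real.pi * Complex.I * n ^ 2 * (L.ω₂ / L.ω₁)
      - 2 * Real.pi * Complex.I * n * (z / L.ω₁)) = Complex.I * (((Real.pi * (m + n) : ℝ) : ℂ)
        - ((Real.pi * n ^ 2 : ℝ) : ℂ) * (L.ω₂ / L.ω₁)
        - ((2 * Real.pi * n : ℝ) : ℂ) * (z / L.ω₁)) := by push_cast; ring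
    rw [e1, Complex.I_mul_re, Complex.sub_im, Complex.sub_im, Complex.im_ofReal_mul,
      Complex.im_ofReal_mul, Complex.ofReal_im]
    ring
  have hq : quadraticPart L (z + l) = quadraticPart L z +
      (Real.pi * n ^ 2 * (L.ω₂ / L.ω₁).im + 2 * Real.pi * n * (z / L.ω₁).im) := by
    have e1 : ((z + l) / L.ω₁).im = (z / L.ω₁).im + n * (L.ω₂ / L.ω₁).im := by
      rw [add_div, hmn]
      simp [Complex.add_im, Complex.mul_im]
    rw [quadraticPart, e1, quadraticPart]
    field_simp
    ring
  rw [neronFun, e, norm_mul, Complex.norm_exp, Real.log_mul (Real.exp_ne_zero _)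
    (norm_ne_zero_iff.mpr hs), Real.log_exp, hre, hq, neronFun]
  ring

/-- The duplication law is the logarithm of the absolute value of `℘'(z) = -σ(2z) / σ(z)⁴`. -/
theorem neronFun_two_mul (h : IsLegendrePeriods L t) {z : ℂ} (hz : z ∉ L.lattice)
    (h2z : 2 * z ∉ L.lattice) : neronFun L t (2 * z) = 4 * neronFun L t z
      - Real.log ‖L.derivWeierstrassP z‖ + 1 / 4 * Real.log ‖(legendre t).Δ‖ := by
  have hs := h.isSigma
  have e := congrArg (fun x => Real.log ‖x‖) (hs.derivWeierstrassP_eq hz)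
  have hP : L.derivWeierstrassP z ≠ 0 := fun h0 => h2z ((hs.derivWeierstrassP_eq_zero_iff hz).mp h0)
  simp only [norm_mul, norm_pow, norm_neg] at e
  rw [Real.log_mul (norm_ne_zero_iff.mpr hP)
      (pow_ne_zero _ (norm_ne_zero_iff.mpr (hs.ne_zero_of_notMem hz))),
    Real.log_mul (pow_ne_zero _ (norm_ne_zero_iff.mpr hs.deriv_ne_zero))
      (norm_ne_zero_iff.mpr (hs.ne_zero_of_notMem h2z)), Real.log_pow, Real.log_pow] at e
  have hq : quadraticPart L (2 * z) = 4 * quadraticPart L z := by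
    have : (2 * z / L.ω₁).im = 2 * (z / L.ω₁).im := by
      rw [mul_div_assoc]; simp
    rw [quadraticPart, this, quadraticPart]; ring
  rw [neronFun, neronFun, hq]
  push_cast at e
  linear_combination e

theorem continuous_quadraticPart (L : PeriodPair) : Continuous (quadraticPart L) := by
  unfold quadraticPart
  fun_prop

theorem continuousAt_neronFun (h : IsLegendrePeriods L t) {z : ℂ} (hz : z ∉ L.lattice) :
    ContinuousAt (neronFun L t) z := by
  have h1 := (continuous_quadraticPart L).continuousAt (x := z)
  have h2 := (h.isSigma.differentiable z).continuousAt.norm.log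
    (norm_ne_zero_iff.mpr (h.isSigma.ne_zero_of_notMem hz))
  exact ((h1.sub h2).add continuousAt_const).sub continuousAt_const

theorem continuousAt_xCoord {z : ℂ} (hz : z ∉ L.lattice) : ContinuousAt (xCoord L t) z :=
  (hasDerivAt_xCoord hz).continuousAt

theorem continuousAt_yCoord {z : ℂ} (hz : z ∉ L.lattice) : ContinuousAt (yCoord L) z :=
  (L.analyticOnNhd_derivWeierstrassP z hz).continuousAt.div_const 2

theorem exists_coord_eq (h : IsLegendrePeriods L t) {x y : ℂ}
    (hxy : (legendre t).toAffine.Nonsingular x y) :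
    ∃ z ∉ L.lattice, xCoord L t z = x ∧ yCoord L z = y := by
  obtain ⟨z, hz, hx⟩ := h.exists_xCoord_eq x
  have h1 := h.equation hz
  rw [hx, ← (legendre_equation_iff t x y).mp hxy.1] at h1
  rcases sq_eq_sq_iff_eq_or_eq_neg.mp h1 with h2 | h2
  · exact ⟨z, hz, hx, h2⟩
  · exact ⟨-z, fun hm => hz (by simpa using neg_mem hm), by rw [xCoord_neg, hx],
      by rw [yCoord_neg, h2, neg_neg]⟩

theorem sub_mem_of_coord_eq (h : IsLegendrePeriods L t) {z w : ℂ} (hz : z ∉ L.lattice)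
    (hw : w ∉ L.lattice) (hx : xCoord L t z = xCoord L t w) (hy : yCoord L z = yCoord L w) :
    z - w ∈ L.lattice := by
  rcases (h.xCoord_eq_iff hz hw).mp hx with hm | hm
  · exact hm
  · have h1 := yCoord_add_mem hm (-w)
    rw [yCoord_neg, show -w + (z + w) = z by ring, hy] at h1
    have h2 : yCoord L w = 0 := by linear_combination h1 / 2
    have := sub_mem hm ((h.yCoord_eq_zero_iff hw).mp h2)
    rwa [show z + w - 2 * w = z - w by ring] at this

/-- Poles: near a lattice point the `x`-coordinate is large. -/
theorem eventually_lt_norm_xCoord {l : ℂ} (hl : l ∈ L.lattice) (R : ℝ) :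
    ∀ᶠ z in 𝓝[≠] l, R < ‖xCoord L t z‖ := by
  have h1 : Tendsto L.weierstrassP (𝓝[≠] l) (Bornology.cobounded ℂ) := by
    rw [tendsto_cobounded_iff_meromorphicOrderAt_neg (L.meromorphic_weierstrassP l),
      L.order_weierstrassP l hl]
    decide
  have h2 : Tendsto (fun z => ‖L.weierstrassP z‖) (𝓝[≠] l) atTop :=
    tendsto_norm_cobounded_atTop.comp h1
  filter_upwards [h2.eventually_gt_atTop (R + ‖(1 + t) / 3‖)] with z hz
  have := norm_sub_le (xCoord L t z) ((1 + t) / 3)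
  rw [xCoord, add_sub_cancel_right] at this
  rw [xCoord]
  linarith

theorem isClosed_norm_xCoord_le (R : ℝ) :
    IsClosed {z | z ∉ L.lattice ∧ ‖xCoord L t z‖ ≤ R} := by
  rw [← isOpen_compl_iff, isOpen_iff_mem_nhds]
  intro z hz
  by_cases hzL : z ∈ L.lattice
  · have := eventually_lt_norm_xCoord (t := t) hzL R
    rw [eventually_nhdsWithin_iff] at this
    filter_upwards [this] with w hw
    rintro ⟨h1, h2⟩
    exact absurd h2 (not_le.mpr (hw fun h => h1 (by rw [h]; exact hzL)))
  · have hR : R < ‖xCoord L t z‖ := by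
      by_contra hle
      exact hz ⟨hzL, not_lt.mp hle⟩
    filter_upwards [(continuousAt_xCoord hzL).norm.eventually (lt_mem_nhds hR)] with w hw
    rintro ⟨_, h2⟩
    exact absurd h2 (not_le.mpr hw)

/-- Every affine point of bounded `x`-coordinate is the image of a point of a fixed compact set. -/
theorem exists_compact_coord (h : IsLegendrePeriods L t) (R : ℝ) :
    ∃ K : Set ℂ, IsCompact K ∧ (∀ z ∈ K, z ∉ L.lattice) ∧
      ∀ x y, (legendre t).toAffine.Nonsingular x y → ‖x‖ ≤ R →
        ∃ z ∈ K, xCoord L t z = x ∧ yCoord L z = y := by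
  obtain ⟨r, hr⟩ := exists_norm_sub_lattice_le L
  refine ⟨Metric.closedBall 0 r ∩ {z | z ∉ L.lattice ∧ ‖xCoord L t z‖ ≤ R},
    (isCompact_closedBall 0 r).inter_right (isClosed_norm_xCoord_le R), fun z hz => hz.2.1,
    fun x y hxy hx => ?_⟩
  obtain ⟨z, hz, rfl, rfl⟩ := h.exists_coord_eq hxy
  obtain ⟨l, hl, hzl⟩ := hr z
  have e : z = z - l + l := by ring
  have ex : xCoord L t (z - l) = xCoord L t z := by
    conv_rhs => rw [e, xCoord_add_mem hl]
  have ey : yCoord L (z - l) = yCoord L z := by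
    conv_rhs => rw [e, yCoord_add_mem hl]
  refine ⟨z - l, ⟨by simpa using hzl, fun hm => hz (by rw [e]; exact add_mem hm hl), ?_⟩, ex, ey⟩
  rwa [ex]

/-- The function on the curve that corresponds to `neronFun`. -/
def heightOfUniformization (L : PeriodPair) (t : ℂ) : (legendre t).toAffine.Point → ℝ
  | .zero => 0
  | .some x y _ => neronFun L t
      (Classical.epsilon fun z => z ∉ L.lattice ∧ xCoord L t z = x ∧ yCoord L z = y)

theorem heightOfUniformization_some (h : IsLegendrePeriods L t) {x y z : ℂ}
    (hxy : (legendre t).toAffine.Nonsingular x y) (hz : z ∉ L.lattice)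
    (hx : xCoord L t z = x) (hy : yCoord L z = y) :
    heightOfUniformization L t (.some x y hxy) = neronFun L t z := by
  have hw := Classical.epsilon_spec
    (p := fun w => w ∉ L.lattice ∧ xCoord L t w = x ∧ yCoord L w = y) ⟨z, hz, hx, hy⟩
  rw [heightOfUniformization]
  set w := Classical.epsilon fun w => w ∉ L.lattice ∧ xCoord L t w = x ∧ yCoord L w = y
  have := h.sub_mem_of_coord_eq hw.1 hz (hw.2.1.trans hx.symm) (hw.2.2.trans hy.symm)
  rw [← h.neronFun_add_mem this hz, add_sub_cancel]

/-- At the origin the height has the same singularity as `log |x| / 2`. -/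
theorem tendsto_neronFun_sub (h : IsLegendrePeriods L t) :
    Tendsto (fun z => neronFun L t z - 1 / 2 * Real.log ‖xCoord L t z‖) (𝓝[≠] 0)
      (𝓝 (-(1 / 12) * Real.log ‖(legendre t).Δ‖)) := by
  have hs := h.isSigma
  obtain ⟨M, hM, hM1, hM2⟩ := hs.exists_entire_weierstrassP_mul_sq
  have hd := hs.differentiable
  have h0 := hs.eq_zero_of_mem (zero_mem L.lattice)
  have hM0 : M 0 = deriv (latticeSigma L) 0 ^ 2 := hM2 0 (zero_mem _)
  have hκ := hs.deriv_ne_zero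
  have hval : M 0 + (1 + t) / 3 * latticeSigma L 0 ^ 2 = deriv (latticeSigma L) 0 ^ 2 := by
    rw [hM0, h0]; ring
  have hne : M 0 + (1 + t) / 3 * latticeSigma L 0 ^ 2 ≠ 0 := by
    rw [hval]; exact pow_ne_zero _ hκ
  have hcM : ContinuousAt (fun z => M z + (1 + t) / 3 * latticeSigma L z ^ 2) 0 := by
    have := hM.continuous; have := hd.continuous; fun_prop
  have hc : ContinuousAt (fun z => quadraticPart L z
      - 1 / 2 * Real.log ‖M z + (1 + t) / 3 * latticeSigma L z ^ 2‖
      + Real.log ‖deriv (latticeSigma L) 0‖ - 1 / 12 * Real.log ‖(legendre t).Δ‖) 0 :=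
    (((continuous_quadraticPart L).continuousAt.sub
      ((hcM.norm.log (norm_ne_zero_iff.mpr hne)).const_mul _)).add continuousAt_const).sub
      continuousAt_const
  have hlim := hc.tendsto
  rw [hval] at hlim
  have e0 : quadraticPart L 0 - 1 / 2 * Real.log ‖deriv (latticeSigma L) 0 ^ 2‖
      + Real.log ‖deriv (latticeSigma L) 0‖ - 1 / 12 * Real.log ‖(legendre t).Δ‖
      = -(1 / 12) * Real.log ‖(legendre t).Δ‖ := by
    rw [norm_pow, Real.log_pow]
    simp [quadraticPart]
  rw [e0] at hlim
  refine (hlim.mono_left nhdsWithin_le_nhds).congr' ?_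
  have hL := L.compl_lattice_sdiff_singleton_mem_nhds 0
  filter_upwards [mem_nhdsWithin_of_mem_nhds hL, self_mem_nhdsWithin,
    eventually_lt_norm_xCoord (t := t) (zero_mem L.lattice) 0] with z hz hz0 hx
  have hz' : z ∉ L.lattice := fun hm => hz ⟨hm, hz0⟩
  have hsz := hs.ne_zero_of_notMem hz'
  have e : M z + (1 + t) / 3 * latticeSigma L z ^ 2 = xCoord L t z * latticeSigma L z ^ 2 := by
    rw [hM1 z hz', xCoord]; ring
  rw [e, norm_mul, norm_pow, Real.log_mul hx.ne' (pow_ne_zero _ (norm_ne_zero_iff.mpr hsz)),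
    Real.log_pow, neronFun]
  push_cast
  ring

theorem isNeronLocalHeight (h : IsLegendrePeriods L t) :
    IsNeronLocalHeight (legendre t) (heightOfUniformization L t) where
  continuous := by
    refine continuous_iff_continuousAt.mpr fun p => tendsto_of_seq_tendsto fun u hu =>
      tendsto_of_subseq_tendsto fun ns hns => ?_
    have hv : Tendsto (fun n => u (ns n)) atTop (𝓝 p) := hu.comp hns
    have hv1 : Tendsto (fun n => (u (ns n)).1) atTop (𝓝 p.1) :=
      (continuous_subtype_val.tendsto p).comp hv
    have hvx : Tendsto (fun n => (u (ns n)).1.1) atTop (𝓝 p.1.1) :=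
      (continuous_fst.tendsto _).comp hv1
    have hvy : Tendsto (fun n => (u (ns n)).1.2) atTop (𝓝 p.1.2) :=
      (continuous_snd.tendsto _).comp hv1
    obtain ⟨R, hR⟩ := hvx.norm.bddAbove_range
    obtain ⟨K, hK, hKL, hKx⟩ := h.exists_compact_coord R
    choose z hzK hzx hzy using fun n => hKx _ _ (u (ns n)).2 (hR ⟨n, rfl⟩)
    obtain ⟨w, hwK, φ, hφ, hlim⟩ := hK.tendsto_subseq hzK
    have hwL := hKL w hwK
    have ex : xCoord L t w = p.1.1 := tendsto_nhds_unique
      ((continuousAt_xCoord hwL).tendsto.comp hlim)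
      ((hvx.comp hφ.tendsto_atTop).congr fun n => (hzx (φ n)).symm)
    have ey : yCoord L w = p.1.2 := tendsto_nhds_unique
      ((continuousAt_yCoord hwL).tendsto.comp hlim)
      ((hvy.comp hφ.tendsto_atTop).congr fun n => (hzy (φ n)).symm)
    refine ⟨φ, ?_⟩
    have hlimit := h.heightOfUniformization_some p.2 hwL ex ey
    simp only [Function.comp_apply, hlimit]
    refine ((h.continuousAt_neronFun hwL).tendsto.comp hlim).congr fun n => ?_
    exact (h.heightOfUniformization_some _ (hKL _ (hzK (φ n))) (hzx _) (hzy _)).symm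
  bounded R := by
    obtain ⟨K, hK, hKL, hKx⟩ := h.exists_compact_coord R
    obtain ⟨C, hC⟩ := hK.exists_bound_of_continuousOn (f := neronFun L t)
      fun z hz => (h.continuousAt_neronFun (hKL z hz)).continuousWithinAt
    refine ⟨C, fun x y hxy hx => ?_⟩
    obtain ⟨z, hzK, hzx, hzy⟩ := hKx x y hxy hx
    rw [h.heightOfUniformization_some hxy (hKL z hzK) hzx hzy]
    exact hC z hzK
  limit := by
    refine ⟨-(1 / 12) * Real.log ‖(legendre t).Δ‖, fun ε hε => ?_⟩
    have := h.tendsto_neronFun_sub.eventually (Metric.ball_mem_nhds _ hε)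
    rw [eventually_nhdsWithin_iff, Metric.eventually_nhds_iff] at this
    obtain ⟨δ, hδ, hball⟩ := this
    obtain ⟨r, hr⟩ := exists_norm_sub_lattice_le L
    have hcl : IsClosed {z : ℂ | ∀ l ∈ L.lattice, δ ≤ ‖z - l‖} := by
      simp only [Set.ofPred_forall]
      exact isClosed_biInter fun l _ => isClosed_le continuous_const (by fun_prop)
    have hK := (isCompact_closedBall (0 : ℂ) r).inter_right hcl
    obtain ⟨R, hR⟩ := hK.exists_bound_of_continuousOn (f := xCoord L t) fun z hz => by
      refine (continuousAt_xCoord fun hm => ?_).continuousWithinAt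
      have := hz.2 z hm
      simp at this
      linarith
    refine ⟨R, fun x y hxy hx => ?_⟩
    obtain ⟨z, hz, rfl, rfl⟩ := h.exists_coord_eq hxy
    obtain ⟨l, hl, hzl⟩ := hr z
    have hzl' : ¬ ∀ l' ∈ L.lattice, δ ≤ ‖z - l - l'‖ := fun hall => by
      have := hR (z - l) ⟨by simpa using hzl, hall⟩
      rw [sub_eq_add_neg, xCoord_add_mem (neg_mem hl)] at this
      linarith
    push Not at hzl'
    obtain ⟨l', hl', hlt⟩ := hzl'
    have hm : -l - l' ∈ L.lattice := sub_mem (neg_mem hl) hl'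
    have hzz : z - l - l' = z + (-l - l') := by ring
    have hn0 : z - l - l' ≠ 0 := fun h0 => add_notMem hm hz (by rw [← hzz, h0]; exact zero_mem _)
    have := hball (y := z - l - l') (by simpa using hlt) hn0
    rw [hzz, h.neronFun_add_mem hm hz, xCoord_add_mem hm] at this
    rw [h.heightOfUniformization_some hxy hz rfl rfl]
    exact this
  duplication x y hxy h2 := by
    obtain ⟨z, hz, rfl, rfl⟩ := h.exists_coord_eq hxy
    have h2z := (h.two_nsmul_ne_zero_iff hz).mp h2
    rw [h.two_nsmul_some hz h2z, h.heightOfUniformization_some _ h2z rfl rfl,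
      h.heightOfUniformization_some _ hz rfl rfl, h.neronFun_two_mul hz h2z]
    congr 3
    simp only [legendre, yCoord]
    congr 1
    ring

end IsLegendrePeriods

/-- The difference of two local heights is bounded: near the origin the logarithmic singularities
cancel. -/
theorem IsNeronLocalHeight.exists_bound_sub {W : WeierstrassCurve ℂ} {H H' : W.toAffine.Point → ℝ}
    (hH : IsNeronLocalHeight W H) (hH' : IsNeronLocalHeight W H') :
    ∃ C : ℝ, ∀ (x y : ℂ) (h : W.toAffine.Nonsingular x y),
      |H (.some x y h) - H' (.some x y h)| ≤ C := by
  obtain ⟨l, hl⟩ := hH.limit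
  obtain ⟨l', hl'⟩ := hH'.limit
  obtain ⟨R, hR⟩ := hl 1 one_pos
  obtain ⟨R', hR'⟩ := hl' 1 one_pos
  obtain ⟨C, hC⟩ := hH.bounded (max R R')
  obtain ⟨C', hC'⟩ := hH'.bounded (max R R')
  refine ⟨max (C + C') (2 + |l - l'|), fun x y h => ?_⟩
  by_cases hx : ‖x‖ ≤ max R R'
  · have h1 := hC x y h hx
    have h2 := hC' x y h hx
    refine le_max_of_le_left ((abs_sub _ _).trans ?_)
    linarith
  · push Not at hx
    have h1 := hR x y h ((le_max_left _ _).trans_lt hx)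
    have h2 := hR' x y h ((le_max_right _ _).trans_lt hx)
    refine le_max_of_le_right ?_
    rw [abs_lt] at h1 h2
    rw [abs_le]
    have := abs_le.mp (le_refl |l - l'|)
    constructor <;> linarith

namespace IsLegendrePeriods

open IsSigma

variable {L : PeriodPair} {t : ℂ}

/-- Two functions with the properties of the Néron local height agree: their difference is bounded
and is multiplied by four under duplication. -/
theorem neronLocalHeight_unique (h : IsLegendrePeriods L t)
    {H H' : (legendre t).toAffine.Point → ℝ} (hH : IsNeronLocalHeight (legendre t) H)
    (hH' : IsNeronLocalHeight (legendre t) H') {x y : ℂ}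
    (hxy : (legendre t).toAffine.Nonsingular x y) : H (.some x y hxy) = H' (.some x y hxy) := by
  classical
  obtain ⟨C, hC⟩ := hH.exists_bound_sub hH'
  -- the difference as a function on `ℂ`
  let G : ℂ → ℝ := fun z => if hz : z ∈ L.lattice then 0 else
    H (.some _ _ (h.nonsingular hz)) - H' (.some _ _ (h.nonsingular hz))
  have hG : ∀ z (hz : z ∉ L.lattice), G z =
      H (.some _ _ (h.nonsingular hz)) - H' (.some _ _ (h.nonsingular hz)) :=
    fun z hz => dif_neg hz
  have hGb : ∀ z, z ∉ L.lattice → |G z| ≤ C := fun z hz => by rw [hG z hz]; exact hC _ _ _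
  have hG2 : ∀ z, z ∉ L.lattice → 2 * z ∉ L.lattice → G (2 * z) = 4 * G z := by
    intro z hz h2z
    have h2 := (h.two_nsmul_ne_zero_iff hz).mpr h2z
    have e1 := hH.duplication _ _ (h.nonsingular hz) h2
    have e2 := hH'.duplication _ _ (h.nonsingular hz) h2
    rw [h.two_nsmul_some hz h2z] at e1 e2
    rw [hG _ h2z, hG _ hz, e1, e2]
    ring
  -- `|G (2ⁿ z)| = 4ⁿ |G z|` is bounded, as long as no `2ⁿ z` is a period
  have hGS : ∀ z ∈ {z : ℂ | ∀ n : ℕ, 2 ^ n * z ∉ L.lattice}, G z = 0 := by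
    intro z hz
    have hpow : ∀ n : ℕ, G (2 ^ n * z) = 4 ^ n * G z := by
      intro n
      induction n with
      | zero => simp
      | succ n ih =>
        have e : (2 : ℂ) ^ (n + 1) * z = 2 * (2 ^ n * z) := by ring
        rw [e, hG2 _ (hz n) (by rw [← e]; exact hz (n + 1)), ih]
        ring
    by_contra hne
    obtain ⟨n, hn⟩ := pow_unbounded_of_one_lt (C / |G z|) (by norm_num : (1 : ℝ) < 4)
    have hb := hGb _ (hz n)
    rw [hpow n, abs_mul, abs_of_pos (by positivity : (0 : ℝ) < 4 ^ n)] at hb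
    rw [div_lt_iff₀ (abs_pos.mpr hne)] at hn
    linarith
  obtain ⟨z, hz, rfl, rfl⟩ := h.exists_coord_eq hxy
  have hcont : ContinuousOn G {z | z ∉ L.lattice} := by
    rw [continuousOn_iff_continuous_domRestrict]
    have hpt : Continuous fun w : {z | z ∉ L.lattice} =>
        (⟨(xCoord L t w, yCoord L w), h.nonsingular w.2⟩ :
          {p : ℂ × ℂ // (legendre t).toAffine.Nonsingular p.1 p.2}) := by
      refine Continuous.subtype_mk (Continuous.prodMk ?_ ?_) _
      · exact continuousOn_iff_continuous_domRestrict.mp fun w hw =>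
          (continuousAt_xCoord hw).continuousWithinAt
      · exact continuousOn_iff_continuous_domRestrict.mp fun w hw =>
          (continuousAt_yCoord hw).continuousWithinAt
    refine ((hH.continuous.comp hpt).sub (hH'.continuous.comp hpt)).congr fun w => ?_
    exact (hG w w.2).symm
  have hz0 : G z = 0 := tendsto_nhds_unique_of_frequently_eq
    (hcont.continuousAt (L.isClosed_lattice.isOpen_compl.mem_nhds hz)) tendsto_const_nhds
    ((mem_closure_iff_frequently.mp (dense_two_pow_mul_notMem L z)).mono hGS)
  rw [hG z hz, sub_eq_zero] at hz0
  exact hz0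

/-- The Néron local height of a Legendre curve is given by the sigma function. -/
theorem neronLocalHeight_some (h : IsLegendrePeriods L t) {x y z : ℂ}
    (hxy : (legendre t).toAffine.Nonsingular x y) (hz : z ∉ L.lattice)
    (hx : xCoord L t z = x) (hy : yCoord L z = y) :
    neronLocalHeight (legendre t) (.some x y hxy) = neronFun L t z := by
  rw [← h.heightOfUniformization_some hxy hz hx hy]
  exact h.neronLocalHeight_unique (Classical.epsilon_spec ⟨_, h.isNeronLocalHeight⟩)
    h.isNeronLocalHeight hxy

end IsLegendrePeriods

/-! ### Dependence of the `y`-coordinate on the lattice -/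

theorem summable_lattice_weight :
    Summable fun i : ℤ × ℤ => ((1 + |(i.1 : ℝ)| + |(i.2 : ℝ)|) ^ 3)⁻¹ := by
  rw [← (finTwoArrowEquiv ℤ).summable_iff]
  refine Summable.of_norm_bounded_eventually
    (EisensteinSeries.summable_one_div_norm_rpow (k := 3) (by norm_num)) ?_
  filter_upwards [(Set.finite_singleton (0 : Fin 2 → ℤ)).compl_mem_cofinite] with x hx
  have hx0 : x ≠ 0 := by simpa using hx
  have hpos : 0 < ‖x‖ := norm_pos_iff.mpr hx0
  have hle : ‖x‖ ≤ 1 + |(x 0 : ℝ)| + |(x 1 : ℝ)| := by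
    refine (pi_norm_le_iff_of_nonneg (by positivity)).mpr fun i => ?_
    fin_cases i
    · simp only [Int.norm_eq_abs]
      have := abs_nonneg (x 1 : ℝ)
      simp; linarith
    · simp only [Int.norm_eq_abs]
      have := abs_nonneg (x 0 : ℝ)
      simp; linarith
  rw [Real.rpow_neg hpos.le, Function.comp_apply, Real.norm_of_nonneg (by positivity)]
  have e : ‖x‖ ^ (3 : ℝ) = ‖x‖ ^ 3 := by exact_mod_cast Real.rpow_natCast ‖x‖ 3
  rw [e]
  refine inv_anti₀ (by positivity) (pow_le_pow_left₀ hpos.le ?_ 3)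
  exact hle

/-- A point off the lattice `ℤ + ℤτ` has distance at least proportional to `1 + |m| + |n|` from the
lattice point `m + nτ`. -/
theorem exists_mul_le_norm_sub {ζ τ : ℂ} (hτ : 0 < τ.im) (hζ : ∀ m n : ℤ, ζ ≠ m + n * τ) :
    ∃ c > 0, ∀ m n : ℤ, c * (1 + |(m : ℝ)| + |(n : ℝ)|) ≤ ‖ζ - m - n * τ‖ := by
  set b : ℝ := ζ.im / τ.im with hb
  set a : ℝ := ζ.re - b * τ.re with ha
  have hζab : ζ = a + b * τ := by
    apply Complex.ext
    · simp [ha]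
    · simp [hb]; field_simp
  set K : ℝ := 1 + (‖τ‖ + 1) / τ.im with hK
  have hK0 : 0 < K := by positivity
  have h1 : ∀ u v : ℝ, |u| + |v| ≤ K * ‖(u : ℂ) + v * τ‖ := by
    intro u v
    have e1 : |v| * τ.im ≤ ‖(u : ℂ) + v * τ‖ := by
      have := Complex.abs_im_le_norm ((u : ℂ) + v * τ)
      simpa [abs_mul, abs_of_pos hτ] using this
    have e2 : |u| ≤ ‖(u : ℂ) + v * τ‖ + |v| * ‖τ‖ := by
      have := norm_sub_le ((u : ℂ) + v * τ) (v * τ)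
      simpa using this
    have e3 : |v| ≤ ‖(u : ℂ) + v * τ‖ / τ.im := by rwa [le_div_iff₀ hτ]
    have e4 : K * ‖(u : ℂ) + v * τ‖ = ‖(u : ℂ) + v * τ‖ +
        (‖τ‖ + 1) * (‖(u : ℂ) + v * τ‖ / τ.im) := by rw [hK]; ring
    rw [e4]
    have e5 : (‖τ‖ + 1) * |v| ≤ (‖τ‖ + 1) * (‖(u : ℂ) + v * τ‖ / τ.im) := by gcongr
    linarith
  set d : ℝ := |a - round a| + |b - round b| with hd
  have hd0 : 0 < d := by
    by_contra hle
    have h0 : d = 0 := le_antisymm (not_lt.mp hle) (by positivity)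
    have ea : a = round a := by
      have := abs_nonneg (b - round b)
      have h2 := abs_nonneg (a - round a)
      exact sub_eq_zero.mp (abs_eq_zero.mp (by linarith))
    have eb : b = round b := by
      have := abs_nonneg (a - round a)
      have h2 := abs_nonneg (b - round b)
      exact sub_eq_zero.mp (abs_eq_zero.mp (by linarith))
    apply hζ (round a) (round b)
    rw [hζab]
    conv_lhs => rw [ea, eb]
    simp
  have h2 : ∀ m n : ℤ, d ≤ |a - m| + |b - n| := fun m n =>
    add_le_add (round_le a m) (round_le b n)
  set P : ℝ := (1 + |a| + |b|) / d + 1 with hP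
  have hP0 : 0 < P := by positivity
  refine ⟨(K * P)⁻¹, by positivity, fun m n => ?_⟩
  have e1 : 1 + |(m : ℝ)| + |(n : ℝ)| ≤ P * (|a - m| + |b - n|) := by
    have t1 : |(m : ℝ)| ≤ |a| + |a - m| := by
      have := abs_sub a (a - m); simpa using this
    have t2 : |(n : ℝ)| ≤ |b| + |b - n| := by
      have := abs_sub b (b - n); simpa using this
    have t3 : 1 + |a| + |b| ≤ (1 + |a| + |b|) / d * (|a - m| + |b - n|) := by
      rw [div_mul_eq_mul_div, le_div_iff₀ hd0]
      exact mul_le_mul_of_nonneg_left (h2 m n) (by positivity)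
    rw [hP, add_mul, one_mul]
    linarith
  have e2 := h1 (a - m) (b - n)
  have e3 : ((a - m : ℝ) : ℂ) + (b - n : ℝ) * τ = ζ - m - n * τ := by
    rw [hζab]; push_cast; ring
  rw [e3] at e2
  rw [inv_mul_le_iff₀ (by positivity)]
  calc _ ≤ P * (|a - m| + |b - n|) := e1
    _ ≤ P * (K * ‖ζ - m - n * τ‖) := by gcongr
    _ = _ := by ring

/-- The Eisenstein series `∑ (ζ - m - nτ)⁻³` as a function of two variables. -/
def eisensteinCube (p : ℂ × ℂ) : ℂ := ∑' i : ℤ × ℤ, ((p.1 - i.1 - i.2 * p.2) ^ 3)⁻¹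

/-- The series is holomorphic in `ζ` and in the modulus `τ` jointly; this is where the dependence of
the uniformization on the fibre enters. -/
theorem differentiableAt_eisensteinCube {ζ τ : ℂ} (hτ : 0 < τ.im)
    (hζ : ∀ m n : ℤ, ζ ≠ m + n * τ) : DifferentiableAt ℂ eisensteinCube (ζ, τ) := by
  obtain ⟨c, hc, hcle⟩ := exists_mul_le_norm_sub hτ hζ
  let A : ℤ × ℤ → (ℂ × ℂ →L[ℂ] ℂ) := fun i =>
    ContinuousLinearMap.fst ℂ ℂ ℂ - (i.2 : ℂ) • ContinuousLinearMap.snd ℂ ℂ ℂ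
  have hA : ∀ i, ‖A i‖ ≤ 1 + |(i.2 : ℝ)| := fun i => by
    refine (norm_sub_le _ _).trans (add_le_add (ContinuousLinearMap.norm_fst_le ..) ?_)
    rw [norm_smul]
    calc ‖(i.2 : ℂ)‖ * ‖ContinuousLinearMap.snd ℂ ℂ ℂ‖ ≤ ‖(i.2 : ℂ)‖ * 1 := by
          gcongr; exact ContinuousLinearMap.norm_snd_le ..
      _ = |(i.2 : ℝ)| := by simp
  -- the lower bound persists on a ball
  have hball : ∀ i : ℤ × ℤ, ∀ p ∈ Metric.ball ((ζ, τ) : ℂ × ℂ) (c / 2),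
      c / 2 * (1 + |(i.1 : ℝ)| + |(i.2 : ℝ)|) ≤ ‖p.1 - i.1 - i.2 * p.2‖ := by
    intro i p hp
    have h0 := hcle i.1 i.2
    have h1 : ‖A i ((ζ, τ) - p)‖ ≤ (1 + |(i.2 : ℝ)|) * (c / 2) := by
      refine ((A i).le_opNorm _).trans ?_
      gcongr
      · exact hA i
      · rw [← dist_eq_norm, dist_comm]; exact (Metric.mem_ball.mp hp).le
    have h2 : A i ((ζ, τ) - p) = (ζ - i.1 - i.2 * τ) - (p.1 - i.1 - i.2 * p.2) := by
      simp [A]; ring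
    rw [h2] at h1
    have h3 := norm_sub_norm_le (ζ - i.1 - i.2 * τ) (p.1 - i.1 - i.2 * p.2)
    have h4 := abs_nonneg (i.1 : ℝ)
    nlinarith
  have hpos : ∀ i : ℤ × ℤ, 0 < c / 2 * (1 + |(i.1 : ℝ)| + |(i.2 : ℝ)|) := fun i => by positivity
  have hne : ∀ i : ℤ × ℤ, ∀ p ∈ Metric.ball ((ζ, τ) : ℂ × ℂ) (c / 2),
      p.1 - i.1 - i.2 * p.2 ≠ 0 := fun i p hp =>
    norm_pos_iff.mp ((hpos i).trans_le (hball i p hp))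
  have hmem : ((ζ, τ) : ℂ × ℂ) ∈ Metric.ball ((ζ, τ) : ℂ × ℂ) (c / 2) :=
    Metric.mem_ball_self (by positivity)
  have := hasFDerivAt_tsum_of_isPreconnected (𝕜 := ℂ)
    (f := fun (i : ℤ × ℤ) (p : ℂ × ℂ) => ((p.1 - i.1 - i.2 * p.2) ^ 3)⁻¹)
    (f' := fun i p => (-3 * ((p.1 - i.1 - i.2 * p.2) ^ 4)⁻¹) • A i)
    (u := fun i => 3 * (c / 2)⁻¹ ^ 4 * ((1 + |(i.1 : ℝ)| + |(i.2 : ℝ)|) ^ 3)⁻¹)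
    (s := Metric.ball ((ζ, τ) : ℂ × ℂ) (c / 2)) (x₀ := (ζ, τ)) (x := (ζ, τ))
    (summable_lattice_weight.mul_left _) Metric.isOpen_ball
    (convex_ball _ _).isPreconnected ?_ ?_ hmem ?_ hmem
  · exact this.differentiableAt
  · intro i p hp
    have h1 : HasFDerivAt (fun p : ℂ × ℂ => p.1 - i.1 - i.2 * p.2) (A i) p := by
      have := (A i).hasFDerivAt (x := p) |>.sub_const (i.1 : ℂ)
      refine this.congr_of_eventuallyEq (Eventually.of_forall fun q => ?_)
      simp [A]; ring
    have h2 : HasDerivAt (fun w : ℂ => (w ^ 3)⁻¹) (-3 * ((p.1 - i.1 - i.2 * p.2) ^ 4)⁻¹)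
        (p.1 - i.1 - i.2 * p.2) := by
      have h0 := hne i p hp
      have h3 := (hasDerivAt_id' (p.1 - i.1 - i.2 * p.2)).fun_pow 3
      refine (h3.fun_inv (pow_ne_zero 3 h0)).congr_deriv ?_
      field_simp
      norm_num
      ring
    exact HasDerivAt.comp_hasFDerivAt (h₂ := fun w : ℂ => (w ^ 3)⁻¹) p h2 h1
  · intro i p hp
    have h1 := hball i p hp
    have hw : 0 < 1 + |(i.1 : ℝ)| + |(i.2 : ℝ)| := by positivity
    rw [norm_smul, norm_mul, norm_neg, norm_inv, norm_pow]
    have h2 : ‖A i‖ ≤ 1 + |(i.1 : ℝ)| + |(i.2 : ℝ)| :=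
      (hA i).trans (by have := abs_nonneg (i.1 : ℝ); linarith)
    calc ‖(3 : ℂ)‖ * (‖p.1 - i.1 - i.2 * p.2‖ ^ 4)⁻¹ * ‖A i‖
        ≤ 3 * ((c / 2 * (1 + |(i.1 : ℝ)| + |(i.2 : ℝ)|)) ^ 4)⁻¹
          * (1 + |(i.1 : ℝ)| + |(i.2 : ℝ)|) := by
          have := hpos i
          gcongr
          simp
      _ = _ := by field_simp
  · refine Summable.of_norm_bounded (summable_lattice_weight.mul_left ((c / 2)⁻¹ ^ 3)) fun i => ?_
    have h1 := hball i _ hmem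
    have := hpos i
    rw [norm_inv, norm_pow]
    calc (‖ζ - i.1 - i.2 * τ‖ ^ 3)⁻¹ ≤ ((c / 2 * (1 + |(i.1 : ℝ)| + |(i.2 : ℝ)|)) ^ 3)⁻¹ := by
          gcongr
      _ = _ := by field_simp

/-- The homogeneity of `℘'` of degree `-3`, with the lattice normalized to `ℤ + ℤτ`. -/
theorem yCoord_eq_eisensteinCube (L : PeriodPair) (z : ℂ) :
    yCoord L z = -(L.ω₁⁻¹ ^ 3) * eisensteinCube (z / L.ω₁, L.ω₂ / L.ω₁) := by
  have h0 := L.ω₁_ne_zero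
  rw [yCoord, PeriodPair.derivWeierstrassP, eisensteinCube,
    ← L.latticeEquivProd.symm.toEquiv.tsum_eq, ← tsum_mul_left, neg_div, ← tsum_div_const,
    ← tsum_neg]
  refine tsum_congr fun i => ?_
  have e := L.latticeEquiv_symm_apply i
  have e2 : z / L.ω₁ - i.1 - i.2 * (L.ω₂ / L.ω₁) = (z - (i.1 * L.ω₁ + i.2 * L.ω₂)) * L.ω₁⁻¹ := by
    field_simp
    ring
  have e3 : ((L.latticeEquivProd.symm.toEquiv i : L.lattice) : ℂ) = i.1 * L.ω₁ + i.2 * L.ω₂ := e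
  rw [e3, e2, mul_pow, mul_inv, inv_pow, inv_inv]
  field_simp

/-! ### Affine coordinates in a chart -/

/-- The affine `x`-coordinate, with value `0` on the zero section. -/
def affX (P : LegendreScheme) : ℂ :=
  match P.point with
  | .zero => 0
  | .some x _ _ => x

/-- The affine `y`-coordinate, with value `0` on the zero section. -/
def affY (P : LegendreScheme) : ℂ :=
  match P.point with
  | .zero => 0
  | .some _ y _ => y

theorem affine_nonsingular {P : LegendreScheme} (hP : P.point ≠ 0) :
    (legendre P.base).toAffine.Nonsingular (affX P) (affY P) := by
  obtain ⟨t, h0, h1, pt⟩ := P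
  cases pt with
  | zero => exact absurd rfl hP
  | some x y h => exact h

theorem point_eq_some {P : LegendreScheme} (hP : P.point ≠ 0) :
    P.point = .some (affX P) (affY P) (affine_nonsingular hP) := by
  obtain ⟨t, h0, h1, pt⟩ := P
  cases pt with
  | zero => exact absurd rfl hP
  | some x y h => rfl

theorem affine_equation {P : LegendreScheme} (hP : P.point ≠ 0) :
    affY P ^ 2 = affX P * (affX P - 1) * (affX P - P.base) :=
  (legendre_equation_iff _ _ _).mp (affine_nonsingular hP).1

theorem isHomogeneousCoord_iff_of_ne_zero {P : LegendreScheme} (hP : P.point ≠ 0) (v : Fin 3 → ℂ) :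
    IsHomogeneousCoord v P.point ↔ v 2 ≠ 0 ∧ v 0 = affX P * v 2 ∧ v 1 = affY P * v 2 := by
  rw [point_eq_some hP]; rfl

theorem isHomogeneousCoord_iff_of_eq_zero {P : LegendreScheme} (hP : P.point = 0)
    (v : Fin 3 → ℂ) : IsHomogeneousCoord v P.point ↔ v 0 = 0 ∧ v 1 ≠ 0 ∧ v 2 = 0 := by
  rw [hP]; rfl

theorem IsHomogeneousCoord.ne_zero_iff {P : LegendreScheme} {v : Fin 3 → ℂ}
    (h : IsHomogeneousCoord v P.point) : v 2 ≠ 0 ↔ P.point ≠ 0 := by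
  constructor
  · intro h2 hP
    exact h2 ((isHomogeneousCoord_iff_of_eq_zero hP v).mp h).2.2
  · intro hP
    exact ((isHomogeneousCoord_iff_of_ne_zero hP v).mp h).1

namespace Chart

variable (c : Chart)

/-- The parameter of the fibre, as a function on the chart. -/
abbrev t (p : C2) : ℂ := (c.toFun p).base

theorem exists_ker_base (p : C2) : ∃ v : C2, v ≠ 0 ∧ fderiv ℂ c.t p v = 0 := by
  have : 1 ≤ Module.finrank ℂ (LinearMap.ker (fderiv ℂ c.t p).toLinearMap) := by
    have h1 := LinearMap.finrank_range_add_finrank_ker (fderiv ℂ c.t p).toLinearMap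
    have h2 : Module.finrank ℂ C2 = 2 := by simp
    have h3 : Module.finrank ℂ (LinearMap.range (fderiv ℂ c.t p).toLinearMap) ≤ 1 := by
      simpa using Submodule.finrank_le (LinearMap.range (fderiv ℂ c.t p).toLinearMap)
    omega
  have : Nontrivial (LinearMap.ker (fderiv ℂ c.t p).toLinearMap) :=
    Module.nontrivial_of_finrank_pos (R := ℂ) this
  obtain ⟨⟨v, hv⟩, hne⟩ := exists_ne (0 : LinearMap.ker (fderiv ℂ c.t p).toLinearMap)
  exact ⟨v, fun h => hne (Subtype.ext h), hv⟩

variable {c}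

theorem eventually_point_ne_zero {p : C2} (hp : p ∈ c.domain) (hP : (c.toFun p).point ≠ 0) :
    ∀ᶠ q in 𝓝 p, (c.toFun q).point ≠ 0 := by
  obtain ⟨F, hF, hFh, -⟩ := c.immersion p hp
  have h2 : F p 2 ≠ 0 := hFh.self_of_nhds.ne_zero_iff.mpr hP
  have hc : ContinuousAt (fun q => F q 2) p :=
    (continuous_apply 2).continuousAt.comp hF.continuousAt
  filter_upwards [hc.eventually_ne h2, hFh] with q hq hqh
  exact hqh.ne_zero_iff.mp hq

/-- Off the zero section the affine coordinates are holomorphic, and together with the parameter of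
the fibre they define an immersion. -/
theorem affine_coordinates {p : C2} (hp : p ∈ c.domain) (hP : (c.toFun p).point ≠ 0) :
    AnalyticAt ℂ (fun q => affX (c.toFun q)) p ∧ AnalyticAt ℂ (fun q => affY (c.toFun q)) p ∧
    ∀ v, fderiv ℂ c.t p v = 0 → fderiv ℂ (fun q => affX (c.toFun q)) p v = 0 →
      fderiv ℂ (fun q => affY (c.toFun q)) p v = 0 → v = 0 := by
  obtain ⟨F, hF, hFh, hinj⟩ := c.immersion p hp
  have hFi : ∀ i, AnalyticAt ℂ (fun q => F q i) p := fun i =>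
    (ContinuousLinearMap.proj (R := ℂ) (φ := fun _ : Fin 3 => ℂ) i).analyticAt _ |>.comp hF
  have h2 : F p 2 ≠ 0 := hFh.self_of_nhds.ne_zero_iff.mpr hP
  have hne := (hFi 2).continuousAt.eventually_ne h2
  have hx : (fun q => affX (c.toFun q)) =ᶠ[𝓝 p] fun q => F q 0 / F q 2 := by
    filter_upwards [hFh, hne] with q hq h
    have := (isHomogeneousCoord_iff_of_ne_zero (hq.ne_zero_iff.mp h) _).mp hq
    rw [this.2.1, mul_div_cancel_right₀ _ h]
  have hy : (fun q => affY (c.toFun q)) =ᶠ[𝓝 p] fun q => F q 1 / F q 2 := by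
    filter_upwards [hFh, hne] with q hq h
    have := (isHomogeneousCoord_iff_of_ne_zero (hq.ne_zero_iff.mp h) _).mp hq
    rw [this.2.2, mul_div_cancel_right₀ _ h]
  have hxa : AnalyticAt ℂ (fun q => affX (c.toFun q)) p := ((hFi 0).div (hFi 2) h2).congr hx.symm
  have hya : AnalyticAt ℂ (fun q => affY (c.toFun q)) p := ((hFi 1).div (hFi 2) h2).congr hy.symm
  refine ⟨hxa, hya, fun v hv hxv hyv => hinj v hv ⟨fderiv ℂ (fun q => F q 2) p v / F p 2, ?_⟩⟩
  have hcomp : ∀ i, fderiv ℂ F p v i = fderiv ℂ (fun q => F q i) p v := fun i => by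
    rw [fderiv_apply hF.differentiableAt]; rfl
  have e0 : (fun q => F q 0) =ᶠ[𝓝 p] fun q => affX (c.toFun q) * F q 2 := by
    filter_upwards [hx, hne] with q hq h
    rw [hq, div_mul_cancel₀ _ h]
  have e1 : (fun q => F q 1) =ᶠ[𝓝 p] fun q => affY (c.toFun q) * F q 2 := by
    filter_upwards [hy, hne] with q hq h
    rw [hq, div_mul_cancel₀ _ h]
  funext i
  fin_cases i
  · simp only [Fin.zero_eta, Pi.smul_apply, smul_eq_mul]
    rw [hcomp, e0.fderiv_eq, fderiv_fun_mul hxa.differentiableAt (hFi 2).differentiableAt,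
      show F p 0 = affX (c.toFun p) * F p 2 from e0.self_of_nhds]
    simp [hxv]
    field_simp
  · simp only [Fin.mk_one, Pi.smul_apply, smul_eq_mul]
    rw [hcomp, e1.fderiv_eq, fderiv_fun_mul hya.differentiableAt (hFi 2).differentiableAt,
      show F p 1 = affY (c.toFun p) * F p 2 from e1.self_of_nhds]
    simp [hyv]
    field_simp
  · simp only [Fin.reduceFinMk, Pi.smul_apply, smul_eq_mul]
    rw [hcomp]
    field_simp

theorem exists_point_ne_zero {U : Set C2} (hU : IsOpen U) (hne : U.Nonempty)
    (hUc : U ⊆ c.domain) : ∃ p ∈ U, (c.toFun p).point ≠ 0 := by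
  by_contra! hall
  obtain ⟨p, hp⟩ := hne
  obtain ⟨F, hF, hFh, hinj⟩ := c.immersion p (hUc hp)
  obtain ⟨v, hv0, hv⟩ := c.exists_ker_base p
  have hco : ∀ᶠ q in 𝓝 p, F q 0 = 0 ∧ F q 1 ≠ 0 ∧ F q 2 = 0 := by
    filter_upwards [hFh, hU.mem_nhds hp] with q hq hqU
    exact (isHomogeneousCoord_iff_of_eq_zero (hall q hqU) _).mp hq
  have hcomp : ∀ i, fderiv ℂ F p v i = fderiv ℂ (fun q => F q i) p v := fun i => by
    rw [fderiv_apply hF.differentiableAt]; rfl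
  have e0 : (fun q => F q 0) =ᶠ[𝓝 p] fun _ => 0 := hco.mono fun q h => h.1
  have e2 : (fun q => F q 2) =ᶠ[𝓝 p] fun _ => 0 := hco.mono fun q h => h.2.2
  have hp3 := hco.self_of_nhds
  refine hv0 (hinj v hv ⟨fderiv ℂ F p v 1 / F p 1, ?_⟩)
  funext i
  fin_cases i
  · simp only [Fin.zero_eta, Pi.smul_apply, smul_eq_mul]
    rw [hcomp, e0.fderiv_eq, hp3.1]
    simp
  · simp only [Fin.mk_one, Pi.smul_apply, smul_eq_mul]
    rw [div_mul_cancel₀ _ hp3.2.1]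
  · simp only [Fin.reduceFinMk, Pi.smul_apply, smul_eq_mul]
    rw [hcomp, e2.fderiv_eq, hp3.2.2]
    simp

/-- The polynomial `f'(x)` for `f = x (x - 1) (x - t)`. -/
def cubicDeriv (t x : ℂ) : ℂ := 3 * x ^ 2 - 2 * (1 + t) * x + t

theorem hasDerivAt_line {f : C2 → ℂ} {p : C2} (hf : AnalyticAt ℂ f p) (v : C2) :
    HasDerivAt (fun s : ℂ => f (p + s • v)) (fderiv ℂ f p v) 0 := by
  have h1 : HasFDerivAt f (fderiv ℂ f p) (p + (0 : ℂ) • v) := by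
    simpa using hf.differentiableAt.hasFDerivAt
  have h2 : HasDerivAt (fun s : ℂ => p + s • v) v 0 := by
    simpa using ((hasDerivAt_id (0 : ℂ)).smul_const v).const_add p
  exact h1.comp_hasDerivAt 0 h2

theorem eventually_line {P : C2 → Prop} {p : C2} (h : ∀ᶠ q in 𝓝 p, P q) (v : C2) :
    ∀ᶠ s : ℂ in 𝓝 0, P (p + s • v) := by
  have : ContinuousAt (fun s : ℂ => p + s • v) 0 := by fun_prop
  exact this.eventually (by simpa using h)

/-- In every open subset of the chart there is an affine point with `y ≠ 0` that is not a zero of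
`f'(x)`. Otherwise `y = 0` or `f'(x) = 0` on an open set. Differentiation along the fibre then gives
a singular point of the curve in the first case, and in the second one `f''(x) = 0` and a vanishing
differential of `x` along the fibre, against the immersion property of the chart. -/
theorem exists_generic_point {U : Set C2} (hU : IsOpen U) (hne : U.Nonempty)
    (hUc : U ⊆ c.domain) : ∃ p ∈ U, (c.toFun p).point ≠ 0 ∧ affY (c.toFun p) ≠ 0 ∧
      cubicDeriv (c.t p) (affX (c.toFun p)) ≠ 0 := by
  -- relations between the differentials of `t`, `x`, `y` along the fibre
  have hrel : ∀ q ∈ U, (c.toFun q).point ≠ 0 → ∀ v, fderiv ℂ c.t q v = 0 →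
      2 * affY (c.toFun q) * fderiv ℂ (fun q => affY (c.toFun q)) q v =
        cubicDeriv (c.t q) (affX (c.toFun q)) * fderiv ℂ (fun q => affX (c.toFun q)) q v := by
    intro q hq hqP v hv
    obtain ⟨hxa, hya, -⟩ := affine_coordinates (hUc hq) hqP
    have hx := hasDerivAt_line hxa v
    have hy := hasDerivAt_line hya v
    have ht := hasDerivAt_line (c.analyticAt_base q (hUc hq)) v
    rw [hv] at ht
    have h1 := hy.fun_pow 2
    have h2 := (hx.fun_mul (hx.sub_const 1)).fun_mul (hx.fun_sub ht)
    have h3 := h1.congr_of_eventuallyEq (f₁ := fun s : ℂ => affX (c.toFun (q + s • v)) *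
      (affX (c.toFun (q + s • v)) - 1) * (affX (c.toFun (q + s • v)) - c.t (q + s • v))) (by
        filter_upwards [eventually_line (eventually_point_ne_zero (hUc hq) hqP) v] with s hs
        exact (affine_equation hs).symm)
    have h4 := h3.unique h2
    simp only [zero_smul, add_zero] at h4
    rw [cubicDeriv]
    push_cast at h4
    linear_combination h4
  by_contra! hall
  obtain ⟨p₁, hp₁, hP₁⟩ := exists_point_ne_zero hU hne hUc
  by_cases hy0 : ∀ᶠ q in 𝓝 p₁, affY (c.toFun q) = 0
  · obtain ⟨hxa, hya, hinj⟩ := affine_coordinates (hUc hp₁) hP₁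
    obtain ⟨v, hv0, hv⟩ := c.exists_ker_base p₁
    have hyv : fderiv ℂ (fun q => affY (c.toFun q)) p₁ v = 0 := by
      rw [Filter.EventuallyEq.fderiv_eq (f := fun _ => (0 : ℂ)) hy0]; simp
    have hr := hrel p₁ hp₁ hP₁ v hv
    rw [hyv, mul_zero, eq_comm] at hr
    refine hv0 (hinj v hv ?_ hyv)
    refine (mul_eq_zero.mp hr).resolve_left fun h0 => ?_
    have he := affine_equation hP₁
    rw [hy0.self_of_nhds] at he
    -- a common zero of `f` and `f'` would be a singular point
    rw [cubicDeriv] at h0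
    have ht0 := (c.toFun p₁).base_ne_zero
    have ht1 := (c.toFun p₁).base_ne_one
    rcases mul_eq_zero.mp (he.symm.trans (by norm_num)) with h | h
    · rcases mul_eq_zero.mp h with h | h
      · rw [h] at h0; apply ht0; linear_combination h0
      · rw [sub_eq_zero.mp h] at h0; apply ht1; linear_combination -h0
    · rw [sub_eq_zero.mp h] at h0
      have : (c.toFun p₁).base * ((c.toFun p₁).base - 1) = 0 := by linear_combination h0
      exact mul_ne_zero ht0 (sub_ne_zero.mpr ht1) this
  · obtain ⟨p₂, hp₂, hp₂U, hP₂⟩ : ∃ q, affY (c.toFun q) ≠ 0 ∧ q ∈ U ∧ (c.toFun q).point ≠ 0 :=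
      ((not_eventually.mp hy0).and_eventually ((hU.eventually_mem hp₁).and
        (eventually_point_ne_zero (hUc hp₁) hP₁))).exists
    have hnear : ∀ᶠ q in 𝓝 p₂, affY (c.toFun q) ≠ 0 ∧ q ∈ U ∧ (c.toFun q).point ≠ 0 ∧
        cubicDeriv (c.t q) (affX (c.toFun q)) = 0 := by
      filter_upwards [(affine_coordinates (hUc hp₂U) hP₂).2.1.continuousAt.eventually_ne hp₂,
        hU.mem_nhds hp₂U, eventually_point_ne_zero (hUc hp₂U) hP₂] with q h1 h2 h3
      exact ⟨h1, h2, h3, hall q h2 h3 h1⟩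
    -- at such points the differential of `x` along the fibre cannot vanish
    have hkey : ∀ q, (∀ᶠ q' in 𝓝 q, affY (c.toFun q') ≠ 0 ∧ q' ∈ U ∧ (c.toFun q').point ≠ 0 ∧
        cubicDeriv (c.t q') (affX (c.toFun q')) = 0) → ∃ v, fderiv ℂ c.t q v = 0 ∧
        fderiv ℂ (fun q => affX (c.toFun q)) q v ≠ 0 := by
      intro q hq
      obtain ⟨h1, h2, h3, h4⟩ := hq.self_of_nhds
      obtain ⟨-, -, hinj⟩ := affine_coordinates (hUc h2) h3
      obtain ⟨v, hv0, hv⟩ := c.exists_ker_base q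
      refine ⟨v, hv, fun hxv => hv0 (hinj v hv hxv ?_)⟩
      have hr := hrel q h2 h3 v hv
      rw [hxv, mul_zero] at hr
      exact (mul_eq_zero.mp hr).resolve_left (mul_ne_zero two_ne_zero h1)
    -- the second derivative `f''(x) = 2 (3 x - (1 + t))` vanishes
    have hdouble : ∀ q, (∀ᶠ q' in 𝓝 q, affY (c.toFun q') ≠ 0 ∧ q' ∈ U ∧ (c.toFun q').point ≠ 0 ∧
        cubicDeriv (c.t q') (affX (c.toFun q')) = 0) →
        3 * affX (c.toFun q) - (1 + c.t q) = 0 := by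
      intro q hq
      obtain ⟨v, hv, hxv⟩ := hkey q hq
      obtain ⟨h1, h2, h3, h4⟩ := hq.self_of_nhds
      have hx := hasDerivAt_line (affine_coordinates (hUc h2) h3).1 v
      have ht := hasDerivAt_line (c.analyticAt_base q (hUc h2)) v
      rw [hv] at ht
      have h5 := (((hx.fun_pow 2).const_mul 3).fun_sub
        (((ht.const_add 1).const_mul 2).fun_mul hx)).fun_add ht
      have h6 := (hasDerivAt_const (0 : ℂ) (0 : ℂ)).congr_of_eventuallyEq
        (f₁ := fun s : ℂ => cubicDeriv (c.t (q + s • v)) (affX (c.toFun (q + s • v)))) (by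
          filter_upwards [eventually_line hq v] with s hs
          exact hs.2.2.2)
      have h7 := h5.unique h6
      simp only [zero_smul, add_zero] at h7
      push_cast at h7
      refine (mul_eq_zero.mp (?_ : (3 * affX (c.toFun q) - (1 + c.t q)) *
        fderiv ℂ (fun q => affX (c.toFun q)) q v = 0)).resolve_right hxv
      linear_combination h7 / 2
    obtain ⟨v, hv, hxv⟩ := hkey p₂ hnear
    refine hxv ?_
    have hx := hasDerivAt_line (affine_coordinates (hUc hp₂U) hP₂).1 v
    have ht := hasDerivAt_line (c.analyticAt_base p₂ (hUc hp₂U)) v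
    rw [hv] at ht
    have h5 := (hx.const_mul 3).fun_sub (ht.const_add 1)
    have h6 := (hasDerivAt_const (0 : ℂ) (0 : ℂ)).congr_of_eventuallyEq
      (f₁ := fun s : ℂ => 3 * affX (c.toFun (p₂ + s • v)) - (1 + c.t (p₂ + s • v))) (by
        filter_upwards [eventually_line hnear.eventually_nhds v] with s hs
        exact hdouble _ hs)
    have h7 := h5.unique h6
    linear_combination h7 / 3

end Chart

/-! ### Holomorphy of the abelian logarithm in a chart -/

section BettiBranch

variable {c : Chart} {D : Set ℂ} {L : ℂ → PeriodPair} {β₁ β₂ : C2 → ℝ}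

theorem IsPeriodFamily.isLegendrePeriods (hL : IsPeriodFamily D L) {t : ℂ} (ht : t ∈ D) :
    IsLegendrePeriods (L t) t where
  ne_zero h := hL.zero_notMem (h ▸ ht)
  ne_one h := hL.one_notMem (h ▸ ht)
  oriented := hL.oriented t ht
  g₂_eq := hL.g₂_eq t ht
  g₃_eq := hL.g₃_eq t ht

/-- The modulus `ω₂ / ω₁` of the fibre, as a function on the chart. -/
def Chart.tau (c : Chart) (L : ℂ → PeriodPair) (p : C2) : ℂ := (L (c.t p)).ω₂ / (L (c.t p)).ω₁

/-- The abelian logarithm divided by `ω₁`, as a function on the chart. -/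
def Chart.zeta (c : Chart) (L : ℂ → PeriodPair) (β₁ β₂ : C2 → ℝ) (p : C2) : ℂ :=
  β₁ p + β₂ p * c.tau L p

namespace IsBettiBranch

variable (hL : IsPeriodFamily D L) (hβ : IsBettiBranch c D L β₁ β₂)
include hβ

theorem analyticAt_comp_base {f : ℂ → ℂ} (hD : IsOpen D) (hf : DifferentiableOn ℂ f D) {p : C2}
    (hp : p ∈ c.domain) : AnalyticAt ℂ (fun q => f (c.t q)) p :=
  AnalyticAt.comp (g := f) (f := c.t) (hf.analyticAt (hD.mem_nhds (hβ.base_mem p hp)))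
    (c.analyticAt_base p hp)

include hL

theorem isLegendrePeriods {p : C2} (hp : p ∈ c.domain) :
    IsLegendrePeriods (L (c.t p)) (c.t p) :=
  hL.isLegendrePeriods (hβ.base_mem p hp)

theorem tau_im_pos {p : C2} (hp : p ∈ c.domain) : 0 < (c.tau L p).im :=
  (hβ.isLegendrePeriods hL hp).oriented

theorem analyticAt_omega {p : C2} (hp : p ∈ c.domain) :
    AnalyticAt ℂ (fun q => (L (c.t q)).ω₁) p :=
  hβ.analyticAt_comp_base hL.isOpen hL.holomorphic₁ hp

theorem analyticAt_tau {p : C2} (hp : p ∈ c.domain) : AnalyticAt ℂ (c.tau L) p :=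
  (hβ.analyticAt_comp_base hL.isOpen hL.holomorphic₂ hp).div (hβ.analyticAt_omega hL hp)
    (PeriodPair.ω₁_ne_zero _)

theorem contDiffOn_tau : ContDiffOn ℝ ∞ (c.tau L) c.domain := fun _ hp =>
  ((hβ.analyticAt_tau hL hp).restrictScalars (𝕜 := ℝ)).contDiffAt.contDiffWithinAt

theorem contDiffOn_zeta : ContDiffOn ℝ ∞ (c.zeta L β₁ β₂) c.domain :=
  (Complex.ofRealCLM.contDiff.comp_contDiffOn hβ.smooth₁).add
    ((Complex.ofRealCLM.contDiff.comp_contDiffOn hβ.smooth₂).mul (hβ.contDiffOn_tau hL))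

omit hL hβ in
theorem zeta_eq (p : C2) : (β₁ p * (L (c.t p)).ω₁ + β₂ p * (L (c.t p)).ω₂) / (L (c.t p)).ω₁ =
    c.zeta L β₁ β₂ p := by
  have := (L (c.t p)).ω₁_ne_zero
  rw [Chart.zeta, Chart.tau]
  field_simp

omit hL in
theorem isLog_of_point_ne_zero {p : C2} (hp : p ∈ c.domain) (hP : (c.toFun p).point ≠ 0) :
    β₁ p * (L (c.t p)).ω₁ + β₂ p * (L (c.t p)).ω₂ ∉ (L (c.t p)).lattice ∧
    affX (c.toFun p) = xCoord (L (c.t p)) (c.t p)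
      (β₁ p * (L (c.t p)).ω₁ + β₂ p * (L (c.t p)).ω₂) ∧
    affY (c.toFun p) = yCoord (L (c.t p)) (β₁ p * (L (c.t p)).ω₁ + β₂ p * (L (c.t p)).ω₂) := by
  have := hβ.isLog p hp
  rw [point_eq_some hP] at this
  exact this

omit hL in
theorem zeta_ne {p : C2} (hp : p ∈ c.domain) (hP : (c.toFun p).point ≠ 0) (m n : ℤ) :
    c.zeta L β₁ β₂ p ≠ m + n * c.tau L p := fun h =>
  (hβ.isLog_of_point_ne_zero hp hP).1 (mem_lattice_iff_div.mpr ⟨m, n, by rw [zeta_eq, h]; rfl⟩)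

omit hL in
theorem affY_eq {p : C2} (hp : p ∈ c.domain) (hP : (c.toFun p).point ≠ 0) :
    eisensteinCube (c.zeta L β₁ β₂ p, c.tau L p) =
      -((L (c.t p)).ω₁ ^ 3 * affY (c.toFun p)) := by
  have := (L (c.t p)).ω₁_ne_zero
  rw [(hβ.isLog_of_point_ne_zero hp hP).2.2, yCoord_eq_eisensteinCube, zeta_eq, Chart.tau]
  field_simp

theorem fderiv_tau_apply {p : C2} (hp : p ∈ c.domain) (v : C2) :
    fderiv ℝ (c.tau L) p v = fderiv ℂ (c.tau L) p v := by
  rw [(hβ.analyticAt_tau hL hp).differentiableAt.fderiv_restrictScalars ℝ]; rfl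

theorem differentiableAt_zeta_real {p : C2} (hp : p ∈ c.domain) :
    DifferentiableAt ℝ (c.zeta L β₁ β₂) p :=
  ((hβ.contDiffOn_zeta hL).contDiffAt (c.domain.isOpen.mem_nhds hp)).differentiableAt (by simp)

/-- At the points where `y` and `f'(x)` do not vanish, the abelian logarithm is an implicit
function of the holomorphic function `y`. -/
theorem fderiv_zeta_I_smul_of_generic {p : C2} (hp : p ∈ c.domain) (hP : (c.toFun p).point ≠ 0)
    (hy : affY (c.toFun p) ≠ 0) (hx : Chart.cubicDeriv (c.t p) (affX (c.toFun p)) ≠ 0) (v : C2) :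
    fderiv ℝ (c.zeta L β₁ β₂) p (Complex.I • v) =
      Complex.I * fderiv ℝ (c.zeta L β₁ β₂) p v := by
  have hh := hβ.isLegendrePeriods hL hp
  obtain ⟨hz, hX, hY⟩ := hβ.isLog_of_point_ne_zero hp hP
  have hE := differentiableAt_eisensteinCube (hβ.tau_im_pos hL hp) (hβ.zeta_ne hp hP)
  set Y' := fderiv ℂ eisensteinCube (c.zeta L β₁ β₂ p, c.tau L p) with hY'
  have hω := (L (c.t p)).ω₁_ne_zero
  have hne : Y' (1, 0) ≠ 0 := by
    set z := β₁ p * (L (c.t p)).ω₁ + β₂ p * (L (c.t p)).ω₂ with hzdef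
    have h2z : 2 * z ∉ (L (c.t p)).lattice := fun h2 =>
      hy (by rw [hY]; exact (hh.yCoord_eq_zero_iff hz).mpr h2)
    have h1 := hh.hasDerivAt_yCoord hz h2z
    have hE' : HasFDerivAt eisensteinCube Y' (z / (L (c.t p)).ω₁,
        (L (c.t p)).ω₂ / (L (c.t p)).ω₁) := by
      rw [hzdef, zeta_eq]; exact hE.hasFDerivAt
    have h2 : HasDerivAt (fun w => (w / (L (c.t p)).ω₁, (L (c.t p)).ω₂ / (L (c.t p)).ω₁))
        (1 / (L (c.t p)).ω₁, (0 : ℂ)) z :=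
      ((hasDerivAt_id z).div_const _).prodMk (hasDerivAt_const _ _)
    have h3 := (hE'.comp_hasDerivAt z h2).const_mul (-((L (c.t p)).ω₁⁻¹ ^ 3))
    have h4 : HasDerivAt (yCoord (L (c.t p))) _ z :=
      h3.congr_of_eventuallyEq (Eventually.of_forall fun w => yCoord_eq_eisensteinCube _ w)
    intro h0
    have h5 : Y' (1 / (L (c.t p)).ω₁, (0 : ℂ)) = 0 := by
      have : ((1 / (L (c.t p)).ω₁, (0 : ℂ)) : ℂ × ℂ) =
          (1 / (L (c.t p)).ω₁) • ((1 : ℂ), (0 : ℂ)) := by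
        simp
      rw [this, map_smul, h0, smul_zero]
    rw [h5, mul_zero] at h4
    apply hx
    rw [Chart.cubicDeriv, hX]
    exact h1.unique h4
  have hζ := (hβ.differentiableAt_zeta_real hL hp).hasFDerivAt
  have hτ := ((hβ.analyticAt_tau hL hp).differentiableAt.restrictScalars ℝ).hasFDerivAt
  have hG := (hE.hasFDerivAt.restrictScalars ℝ).comp p (hζ.prodMk hτ)
  have hR : DifferentiableAt ℂ (fun q => -((L (c.t q)).ω₁ ^ 3 * affY (c.toFun q))) p :=
    (((hβ.analyticAt_omega hL hp).differentiableAt.fun_pow 3).fun_mul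
      (Chart.affine_coordinates hp hP).2.1.differentiableAt).fun_neg
  have hG' := (hR.hasFDerivAt.restrictScalars ℝ).congr_of_eventuallyEq
    (f₁ := fun q => eisensteinCube (c.zeta L β₁ β₂ q, c.tau L q)) (by
      filter_upwards [c.domain.isOpen.mem_nhds hp, Chart.eventually_point_ne_zero hp hP]
        with q h1 h2
      exact hβ.affY_eq h1 h2)
  have heq := hG.unique hG'
  have e1 : ∀ w, Y' (fderiv ℝ (c.zeta L β₁ β₂) p w, fderiv ℝ (c.tau L) p w) =
      fderiv ℂ (fun q => -((L (c.t q)).ω₁ ^ 3 * affY (c.toFun q))) p w := fun w =>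
    DFunLike.congr_fun heq w
  have e2 := e1 (Complex.I • v)
  rw [(fderiv ℂ (fun q => -((L (c.t q)).ω₁ ^ 3 * affY (c.toFun q))) p).map_smul, ← e1 v,
    ← Y'.map_smul, hβ.fderiv_tau_apply hL hp, hβ.fderiv_tau_apply hL hp,
    (fderiv ℂ (c.tau L) p).map_smul, Prod.smul_mk] at e2
  rw [← sub_eq_zero, ← map_sub] at e2
  have e3 : (fderiv ℝ (c.zeta L β₁ β₂) p (Complex.I • v) -
      Complex.I * fderiv ℝ (c.zeta L β₁ β₂) p v) • Y' (1, 0) = 0 := by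
    rw [← Y'.map_smul]
    exact (congrArg Y' (by simp)).trans e2
  exact sub_eq_zero.mp ((smul_eq_zero.mp e3).resolve_right hne)

/-- The differential of the abelian logarithm is `ℂ`-linear: this holds on a dense set, hence
everywhere by smoothness of the Betti coordinates. -/
theorem fderiv_zeta_I_smul {p : C2} (hp : p ∈ c.domain) (v : C2) :
    fderiv ℝ (c.zeta L β₁ β₂) p (Complex.I • v) =
      Complex.I * fderiv ℝ (c.zeta L β₁ β₂) p v := by
  have hc : ContinuousOn (fderiv ℝ (c.zeta L β₁ β₂)) c.domain :=
    (hβ.contDiffOn_zeta hL).continuousOn_fderiv_of_isOpen c.domain.isOpen (by simp)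
  have hcont : ContinuousAt (fun q => fderiv ℝ (c.zeta L β₁ β₂) q (Complex.I • v) -
      Complex.I * fderiv ℝ (c.zeta L β₁ β₂) q v) p := by
    have := hc.continuousAt (c.domain.isOpen.mem_nhds hp)
    exact (this.clm_apply continuousAt_const).sub
      (continuousAt_const.mul (this.clm_apply continuousAt_const))
  by_contra hne
  have hev := (hcont.eventually_ne (sub_ne_zero.mpr hne)).and (c.domain.isOpen.eventually_mem hp)
  obtain ⟨U, hU, hUo, hpU⟩ := mem_nhds_iff.mp hev
  obtain ⟨q, hq, hqP, hqy, hqx⟩ := Chart.exists_generic_point hUo ⟨p, hpU⟩ fun r hr => (hU hr).2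
  exact (hU hq).1 (sub_eq_zero.mpr
    (hβ.fderiv_zeta_I_smul_of_generic hL (hU hq).2 hqP hqy hqx v))

theorem differentiableAt_zeta {p : C2} (hp : p ∈ c.domain) :
    DifferentiableAt ℂ (c.zeta L β₁ β₂) p := by
  refine (differentiableAt_iff_restrictScalars ℝ (hβ.differentiableAt_zeta_real hL hp)).mpr
    ⟨⟨⟨(fderiv ℝ (c.zeta L β₁ β₂) p).toAddMonoidHom, fun s v => ?_⟩,
      (fderiv ℝ (c.zeta L β₁ β₂) p).continuous⟩, rfl⟩
  have hs : s • v = s.re • v + s.im • (Complex.I • v) := by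
    ext i
    simp only [Pi.smul_apply, Pi.add_apply, smul_eq_mul, Complex.real_smul]
    nth_rewrite 1 [← Complex.re_add_im s]
    ring
  change fderiv ℝ (c.zeta L β₁ β₂) p (s • v) = s • fderiv ℝ (c.zeta L β₁ β₂) p v
  rw [hs, map_add, map_smul, map_smul, hβ.fderiv_zeta_I_smul hL hp, Complex.real_smul,
    Complex.real_smul, smul_eq_mul]
  nth_rewrite 3 [← Complex.re_add_im s]
  ring

end IsBettiBranch

end BettiBranch

/-! ### Pluriharmonic functions and the potential of `dβ₁ ∧ dβ₂` -/

/-- `f` is smooth and complex differentiable in a neighbourhood of `p`. -/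
def HoloAt (f : C2 → ℂ) (p : C2) : Prop :=
  ∀ᶠ q in 𝓝 p, ContDiffAt ℝ ∞ f q ∧ DifferentiableAt ℂ f q

theorem _root_.AnalyticAt.holoAt {f : C2 → ℂ} {p : C2} (hf : AnalyticAt ℂ f p) : HoloAt f p :=
  hf.eventually_analyticAt.mono fun _ hq =>
    ⟨(hq.restrictScalars (𝕜 := ℝ)).contDiffAt, hq.differentiableAt⟩

namespace HoloAt

variable {f g : C2 → ℂ} {p : C2}

theorem differentiableAt (hf : HoloAt f p) : DifferentiableAt ℂ f p := hf.self_of_nhds.2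

theorem contDiffAt (hf : HoloAt f p) : ContDiffAt ℝ ∞ f p := hf.self_of_nhds.1

theorem continuousAt (hf : HoloAt f p) : ContinuousAt f p := hf.differentiableAt.continuousAt

theorem mul (hf : HoloAt f p) (hg : HoloAt g p) : HoloAt (fun q => f q * g q) p := by
  filter_upwards [hf, hg] with q hf hg using ⟨hf.1.mul hg.1, hf.2.mul hg.2⟩

theorem comp_analyticAt {k : ℂ → ℂ} (hk : AnalyticAt ℂ k (f p)) (hf : HoloAt f p) :
    HoloAt (fun q => k (f q)) p := by
  filter_upwards [hf, hf.continuousAt.eventually hk.eventually_analyticAt] with q hf hk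
  exact ⟨(hk.restrictScalars (𝕜 := ℝ)).contDiffAt.comp q hf.1, hk.differentiableAt.comp q hf.2⟩

end HoloAt

/-- The real part of a holomorphic function is pluriharmonic: its `dᶜ` is closed, as it is the
differential of the imaginary part. -/
theorem ddcPair_comm_of_eq_re {u : C2 → ℝ} {g : C2 → ℂ} {p : C2} (hg : HoloAt g p)
    (hu : ∀ᶠ q in 𝓝 p, u q = (g q).re) (v w : C2) : ddcPair u p v w = ddcPair u p w v := by
  obtain ⟨V, hV, hVo, hpV⟩ := mem_nhds_iff.mp hg
  have hsm : ContDiffOn ℝ ∞ (fun q => (g q).im) V := fun q hq =>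
    (Complex.imCLM.contDiff.contDiffAt.comp q (hV hq).1).contDiffWithinAt
  have h1 : ∀ x : C2, (fun q => fderiv ℝ u q (-Complex.I • x)) =ᶠ[𝓝 p]
      fun q => fderiv ℝ (fun r => (g r).im) q x := by
    intro x
    filter_upwards [eventually_eventually_nhds.mpr hu, hVo.mem_nhds hpV] with q hq hqV
    have hr := (hV hqV).2.hasFDerivAt.restrictScalars ℝ
    have e1 : HasFDerivAt u _ q := (Complex.reCLM.hasFDerivAt.comp q hr).congr_of_eventuallyEq hq
    have e2 : HasFDerivAt (fun r => (g r).im) _ q := Complex.imCLM.hasFDerivAt.comp q hr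
    rw [e1.fderiv, e2.fderiv]
    simp
  rw [ddcPair, ddcPair, (h1 w).fderiv_eq, (h1 v).fderiv_eq]
  exact fderiv_fderiv_apply_comm hVo hsm hpV w v

theorem exists_log_norm_eq_re {f : C2 → ℂ} {p : C2} (hf : HoloAt f p) (h0 : f p ≠ 0) :
    ∃ g : C2 → ℂ, HoloAt g p ∧ ∀ᶠ q in 𝓝 p, Real.log ‖f q‖ = (g q).re := by
  refine ⟨fun q => Complex.log (f q / f p) + Real.log ‖f p‖,
    hf.comp_analyticAt (k := fun x => Complex.log (x / f p) + Real.log ‖f p‖) ?_, ?_⟩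
  · refine AnalyticAt.add (AnalyticAt.clog (analyticAt_id.div analyticAt_const h0) ?_)
      analyticAt_const
    rw [div_self h0]
    exact Complex.one_mem_slitPlane
  · filter_upwards [hf.continuousAt.eventually_ne h0] with q hq
    simp only [Complex.add_re, Complex.log_re, Complex.ofReal_re, norm_div]
    rw [Real.log_div (norm_ne_zero_iff.mpr hq) (norm_ne_zero_iff.mpr h0)]
    ring

theorem continuous_normalizedDdc {ψ : C2 → Alt 2} (hψ : ContDiff ℝ ∞ ψ) :
    Continuous (normalizedDdc ψ) := by
  rw [funext (normalizedDdc_eq hψ)]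
  have h : ∀ k l v w, Continuous fun p => ddcPair (coeff ψ k l) p v w := fun k l v w =>
    (contDiff_ddcPair (contDiff_apply_alt hψ _) v w).continuous
  fun_prop

theorem tsupport_normalizedDdc_subset {ψ : C2 → Alt 2} (hψ : ContDiff ℝ ∞ ψ) :
    tsupport (normalizedDdc ψ) ⊆ tsupport ψ :=
  closure_minimal (fun p hp => by
    by_contra h
    exact hp (normalizedDdc_eq_zero_of_notMem_tsupport hψ h)) (isClosed_tsupport ψ)

theorem hasCompactSupport_normalizedDdc {ψ : C2 → Alt 2} (hψ : ContDiff ℝ ∞ ψ)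
    (hc : HasCompactSupport ψ) : HasCompactSupport (normalizedDdc ψ) :=
  hc.mono' (subset_closure.trans (tsupport_normalizedDdc_subset hψ))

theorem integrable_mul_normalizedDdc {V : Set C2} (hV : IsOpen V) {u : C2 → ℝ}
    (hu : ContinuousOn u V) {ψ : C2 → Alt 2} (hψ : ContDiff ℝ ∞ ψ) (hc : HasCompactSupport ψ)
    (hs : tsupport ψ ⊆ V) : Integrable fun p => u p * normalizedDdc ψ p :=
  integrable_mul_of_tsupport_subset hV hu (continuous_normalizedDdc hψ)
    (hasCompactSupport_normalizedDdc hψ hc) ((tsupport_normalizedDdc_subset hψ).trans hs)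

/-- `u` is continuous on `V`, and `dd^c u = 0` on `V` in the sense of currents. -/
structure IsWeaklyPluriharmonicOn (u : C2 → ℝ) (V : Set C2) : Prop where
  continuousOn : ContinuousOn u V
  integral_eq_zero : ∀ ψ : C2 → Alt 2, ContDiff ℝ ∞ ψ → HasCompactSupport ψ → tsupport ψ ⊆ V →
    ∫ p, u p * normalizedDdc ψ p = 0

namespace IsWeaklyPluriharmonicOn

variable {u u' : C2 → ℝ} {V : Set C2}

theorem congr (h : IsWeaklyPluriharmonicOn u V) (he : ∀ p ∈ V, u' p = u p) :
    IsWeaklyPluriharmonicOn u' V where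
  continuousOn := h.continuousOn.congr he
  integral_eq_zero ψ hψ hc hs := by
    rw [← h.integral_eq_zero ψ hψ hc hs]
    refine integral_congr_ae (Eventually.of_forall fun p => ?_)
    by_cases hp : p ∈ V
    · simp only [he p hp]
    · simp only [normalizedDdc_eq_zero_of_notMem_tsupport hψ fun h => hp (hs h), mul_zero]

theorem const_mul (h : IsWeaklyPluriharmonicOn u V) (r : ℝ) :
    IsWeaklyPluriharmonicOn (fun p => r * u p) V where
  continuousOn := continuousOn_const.mul h.continuousOn
  integral_eq_zero ψ hψ hc hs := by
    simp only [mul_assoc]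
    rw [integral_const_mul, h.integral_eq_zero ψ hψ hc hs, mul_zero]

theorem add (hV : IsOpen V) (h : IsWeaklyPluriharmonicOn u V)
    (h' : IsWeaklyPluriharmonicOn u' V) : IsWeaklyPluriharmonicOn (fun p => u p + u' p) V where
  continuousOn := h.continuousOn.add h'.continuousOn
  integral_eq_zero ψ hψ hc hs := by
    simp only [add_mul]
    rw [integral_add (integrable_mul_normalizedDdc hV h.continuousOn hψ hc hs)
      (integrable_mul_normalizedDdc hV h'.continuousOn hψ hc hs), h.integral_eq_zero ψ hψ hc hs,
      h'.integral_eq_zero ψ hψ hc hs, add_zero]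

end IsWeaklyPluriharmonicOn

/-- `log |f|` is pluriharmonic where `f` is holomorphic without zeros. -/
theorem isWeaklyPluriharmonicOn_log_norm {V : Set C2} {f : C2 → ℂ} (hV : IsOpen V)
    (hf : ∀ p ∈ V, HoloAt f p) (h0 : ∀ p ∈ V, f p ≠ 0) :
    IsWeaklyPluriharmonicOn (fun p => Real.log ‖f p‖) V := by
  have hsm : ContDiffOn ℝ ∞ (fun p => Real.log ‖f p‖) V := fun p hp => by
    obtain ⟨g, hg, he⟩ := exists_log_norm_eq_re (hf p hp) (h0 p hp)
    exact ((Complex.reCLM.contDiff.contDiffAt.comp p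
      hg.contDiffAt).congr_of_eventuallyEq he).contDiffWithinAt
  refine ⟨hsm.continuousOn, fun ψ hψ hc hs => ?_⟩
  have := integral_mul_normalizedDdc_of_smooth hV hsm (η := 0) (fun p hp v w => by
    obtain ⟨g, hg, he⟩ := exists_log_norm_eq_re (hf p hp) (h0 p hp)
    rw [ddcPair_comm_of_eq_re hg he v w, sub_self]; simp) hψ hc hs (by simp)
  rw [setIntegral_mul_normalizedDdc hψ hs] at this
  simpa using this

section BettiBranch

variable {c : Chart} {D : Set ℂ} {L : ℂ → PeriodPair} {β₁ β₂ : C2 → ℝ}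

/-- The smooth potential `π β₂² Im τ` of `dβ₁ ∧ dβ₂`. It is the quadratic part of the Néron local
height. -/
def bettiPotential (c : Chart) (L : ℂ → PeriodPair) (β₂ : C2 → ℝ) (p : C2) : ℝ :=
  Real.pi * (β₂ p * β₂ p * (c.tau L p).im)

namespace IsBettiBranch

variable (hL : IsPeriodFamily D L) (hβ : IsBettiBranch c D L β₁ β₂)
include hL hβ

theorem contDiffOn_bettiPotential : ContDiffOn ℝ ∞ (bettiPotential c L β₂) c.domain :=
  contDiffOn_const.mul ((hβ.smooth₂.mul hβ.smooth₂).mul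
    (Complex.imCLM.contDiff.comp_contDiffOn (hβ.contDiffOn_tau hL)))

/-- The Cauchy-Riemann equations for `β₁ + β₂ τ` compute `dᶜ` of the potential. -/
theorem fderiv_bettiPotential {p : C2} (hp : p ∈ c.domain) (w : C2) :
    fderiv ℝ (bettiPotential c L β₂) p (-Complex.I • w) =
      -(2 * Real.pi) * (β₂ p * fderiv ℝ β₁ p w) -
        Real.pi * fderiv ℝ (fun q => β₂ q * β₂ q * (c.tau L q).re) p w := by
  have hn := c.domain.isOpen.mem_nhds hp
  have d1 := ((hβ.smooth₁.contDiffAt hn).differentiableAt (by simp)).hasFDerivAt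
  have d2 := ((hβ.smooth₂.contDiffAt hn).differentiableAt (by simp)).hasFDerivAt
  have dτ := ((hβ.contDiffOn_tau hL).contDiffAt hn).differentiableAt (by simp) |>.hasFDerivAt
  have c1 := Complex.ofRealCLM.hasFDerivAt.comp p d1
  have c2 := Complex.ofRealCLM.hasFDerivAt.comp p d2
  have dζ : HasFDerivAt (c.zeta L β₁ β₂) _ p := c1.fun_add (c2.fun_mul dτ)
  have dre := Complex.reCLM.hasFDerivAt.comp p dτ
  have dim := Complex.imCLM.hasFDerivAt.comp p dτ
  have dh : HasFDerivAt (bettiPotential c L β₂) _ p :=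
    ((d2.fun_mul d2).fun_mul dim).const_mul Real.pi
  have dr : HasFDerivAt (fun q => β₂ q * β₂ q * (c.tau L q).re) _ p := (d2.fun_mul d2).fun_mul dre
  have hI : ∀ x, fderiv ℝ (c.zeta L β₁ β₂) p (-Complex.I • x) =
      -Complex.I * fderiv ℝ (c.zeta L β₁ β₂) p x := fun x => by
    rw [neg_smul, map_neg, hβ.fderiv_zeta_I_smul hL hp, neg_mul]
  have hτI : fderiv ℝ (c.tau L) p (Complex.I • w) = Complex.I * fderiv ℝ (c.tau L) p w := by
    rw [hβ.fderiv_tau_apply hL hp, hβ.fderiv_tau_apply hL hp, map_smul, smul_eq_mul]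
  have key := hI w
  rw [dζ.fderiv] at key
  have key2 := congrArg Complex.im key
  rw [dh.fderiv, dr.fderiv]
  simp [hτI] at key2 ⊢
  linear_combination (2 * Real.pi * β₂ p) * key2

/-- `(1 / 2πi) dd^c (π β₂² Im τ) = dβ₁ ∧ dβ₂`. -/
theorem ddcPair_bettiPotential {p : C2} (hp : p ∈ c.domain) (v w : C2) :
    ddcPair (bettiPotential c L β₂) p v w - ddcPair (bettiPotential c L β₂) p w v =
      2 * Real.pi * wedgeD β₁ β₂ p ![v, w] := by
  have hn := c.domain.isOpen.mem_nhds hp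
  have hre : ContDiffOn ℝ ∞ (fun q => β₂ q * β₂ q * (c.tau L q).re) c.domain :=
    (hβ.smooth₂.mul hβ.smooth₂).mul (Complex.reCLM.contDiff.comp_contDiffOn (hβ.contDiffOn_tau hL))
  have key : ∀ v w, ddcPair (bettiPotential c L β₂) p v w =
      -(2 * Real.pi) * (β₂ p * fderiv ℝ (fun q => fderiv ℝ β₁ q w) p v +
        fderiv ℝ β₁ p w * fderiv ℝ β₂ p v) -
        Real.pi * fderiv ℝ (fun q => fderiv ℝ (fun q => β₂ q * β₂ q * (c.tau L q).re) q w) p v := by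
    intro v w
    have he : (fun q => fderiv ℝ (bettiPotential c L β₂) q (-Complex.I • w)) =ᶠ[𝓝 p] fun q =>
        -(2 * Real.pi) * (β₂ q * fderiv ℝ β₁ q w) -
          Real.pi * fderiv ℝ (fun q => β₂ q * β₂ q * (c.tau L q).re) q w := by
      filter_upwards [hn] with q hq using hβ.fderiv_bettiPotential hL hq w
    have d2 := ((hβ.smooth₂.contDiffAt hn).differentiableAt (by simp)).hasFDerivAt
    have d1 := (((contDiffOn_fderiv_apply_const c.domain.isOpen hβ.smooth₁ w).contDiffAt
      hn).differentiableAt (by simp)).hasFDerivAt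
    have d3 := (((contDiffOn_fderiv_apply_const c.domain.isOpen hre w).contDiffAt
      hn).differentiableAt (by simp)).hasFDerivAt
    have := ((d2.fun_mul d1).const_mul (-(2 * Real.pi))).fun_sub (d3.const_mul Real.pi)
    rw [ddcPair, he.fderiv_eq, this.fderiv]
    simp
    ring
  rw [key, key, wedgeD_apply,
    fderiv_fderiv_apply_comm c.domain.isOpen hβ.smooth₁ hp v w,
    fderiv_fderiv_apply_comm c.domain.isOpen hre hp v w]
  simp
  ring

end IsBettiBranch

end BettiBranch

/-! ### The Néron local height off the zero section -/

section Product

variable {a b : C2 → ℂ}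

theorem abs_log_norm_one_sub_le {z : ℂ} (hz : ‖z‖ ≤ 1 / 2) :
    |Real.log ‖1 - z‖| ≤ 3 / 2 * ‖z‖ := by
  have := Complex.norm_log_one_add_half_le_self (z := -z) (by rwa [norm_neg])
  rw [norm_neg, ← sub_eq_add_neg] at this
  rw [← Complex.log_re]
  exact (Complex.abs_re_le_norm _).trans this

theorem continuousOn_log_norm_factor {K : Set C2} (ha : ContinuousOn a K) (hb : ContinuousOn b K)
    (hne : ∀ n : ℕ, ∀ p ∈ K, a p ^ (n + 1) * b p ≠ 1) (n : ℕ) :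
    ContinuousOn (fun p => Real.log ‖1 - a p ^ (n + 1) * b p‖) K :=
  (continuousOn_const.sub ((ha.pow _).mul hb)).norm.log fun p hp =>
    norm_ne_zero_iff.mpr (sub_ne_zero.mpr (hne n p hp).symm)

/-- On a compact set the series `∑ log |1 - aⁿ⁺¹ b|` converges normally. -/
theorem exists_summable_bound_log_norm {K : Set C2} (hK : IsCompact K) (ha : ContinuousOn a K)
    (hb : ContinuousOn b K) (hlt : ∀ p ∈ K, ‖a p‖ < 1)
    (hne : ∀ n : ℕ, ∀ p ∈ K, a p ^ (n + 1) * b p ≠ 1) :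
    ∃ m : ℕ → ℝ, Summable m ∧ ∀ n, ∀ p ∈ K, ‖Real.log ‖1 - a p ^ (n + 1) * b p‖‖ ≤ m n := by
  rcases K.eq_empty_or_nonempty with rfl | hKne
  · exact ⟨0, summable_zero, by simp⟩
  obtain ⟨p₀, hp₀, hmax⟩ := hK.exists_isMaxOn hKne ha.norm
  obtain ⟨M, hM⟩ := hK.exists_bound_of_continuousOn hb
  set r := ‖a p₀‖ with hr
  have hr0 : 0 ≤ r := norm_nonneg _
  have hr1 : r < 1 := hlt p₀ hp₀
  have hbd : ∀ n : ℕ, ∀ p ∈ K, ‖a p ^ (n + 1) * b p‖ ≤ r ^ n * M := fun n p hp => by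
    rw [norm_mul, norm_pow]
    have h1 : ‖a p‖ ^ (n + 1) ≤ r ^ n := by
      rw [pow_succ]
      exact (mul_le_of_le_one_right (by positivity) (hlt p hp).le).trans
        (pow_le_pow_left₀ (norm_nonneg _) (hmax hp) n)
    exact mul_le_mul h1 (hM p hp) (norm_nonneg _) (by positivity)
  have hlim : Tendsto (fun n : ℕ => r ^ n * M) atTop (𝓝 0) := by
    simpa using (tendsto_pow_atTop_nhds_zero_of_lt_one hr0 hr1).mul_const M
  obtain ⟨N, hN⟩ := eventually_atTop.mp
    (hlim.eventually_le_const (show (0 : ℝ) < 1 / 2 by norm_num))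
  choose C hC using fun n =>
    hK.exists_bound_of_continuousOn (continuousOn_log_norm_factor ha hb hne n)
  refine ⟨fun n => if n < N then C n else 3 / 2 * (r ^ n * M), ?_, fun n p hp => ?_⟩
  · rw [← summable_nat_add_iff N]
    simpa using (((summable_nat_add_iff N).mpr
      (summable_geometric_of_lt_one hr0 hr1)).mul_right M).mul_left (3 / 2)
  · dsimp only
    split_ifs with h
    · exact hC n p hp
    · have h1 := hbd n p hp
      exact (abs_log_norm_one_sub_le (h1.trans (hN n (not_lt.mp h)))).trans (by gcongr)

/-- `log |∏ (1 - aⁿ⁺¹ b)|` is pluriharmonic for holomorphic `a` and `b`: the series of the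
logarithms of the factors is integrated termwise. -/
theorem isWeaklyPluriharmonicOn_log_norm_qProd {V : Set C2} (hV : IsOpen V)
    (ha : ∀ p ∈ V, HoloAt a p) (hb : ∀ p ∈ V, HoloAt b p) (hlt : ∀ p ∈ V, ‖a p‖ < 1)
    (hne : ∀ n : ℕ, ∀ p ∈ V, a p ^ (n + 1) * b p ≠ 1) :
    IsWeaklyPluriharmonicOn (fun p => Real.log ‖qProd (a p) (b p)‖) V := by
  have hac : ContinuousOn a V := fun p hp => (ha p hp).continuousAt.continuousWithinAt
  have hbc : ContinuousOn b V := fun p hp => (hb p hp).continuousAt.continuousWithinAt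
  have hterm : ∀ n : ℕ,
      IsWeaklyPluriharmonicOn (fun p => Real.log ‖1 - a p ^ (n + 1) * b p‖) V := fun n => by
    refine isWeaklyPluriharmonicOn_log_norm hV (fun p hp => ?_)
      (fun p hp => sub_ne_zero.mpr (hne n p hp).symm)
    have h1 : HoloAt (fun q => a q ^ (n + 1)) p :=
      (ha p hp).comp_analyticAt (k := fun x => x ^ (n + 1)) (by fun_prop)
    exact (h1.mul (hb p hp)).comp_analyticAt (k := fun x => 1 - x) (by fun_prop)
  have hsum : ∀ p ∈ V, Real.log ‖qProd (a p) (b p)‖ =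
      ∑' n : ℕ, Real.log ‖1 - a p ^ (n + 1) * b p‖ := fun p hp =>
    (log_norm_qProd (hlt p hp) fun n => hne n p hp).tsum_eq.symm
  refine IsWeaklyPluriharmonicOn.congr ⟨fun p hp => ?_, fun ψ hψ hc hs => ?_⟩ hsum
  · obtain ⟨K, hK, hKV, hKc⟩ := local_compact_nhds (hV.mem_nhds hp)
    obtain ⟨m, hm, hmb⟩ := exists_summable_bound_log_norm hKc (hac.mono hKV) (hbc.mono hKV)
      (fun q hq => hlt q (hKV hq)) (fun n q hq => hne n q (hKV hq))
    exact ((continuousOn_tsum (fun n => (hterm n).continuousOn.mono hKV) hm hmb).continuousAt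
      hK).continuousWithinAt
  · obtain ⟨m, hm, hmb⟩ := exists_summable_bound_log_norm hc (hac.mono hs) (hbc.mono hs)
      (fun q hq => hlt q (hs hq)) (fun n q hq => hne n q (hs hq))
    have hint : ∀ n : ℕ, Integrable fun p =>
        Real.log ‖1 - a p ^ (n + 1) * b p‖ * normalizedDdc ψ p := fun n =>
      integrable_mul_normalizedDdc hV (hterm n).continuousOn hψ hc hs
    have hφ : Integrable fun p => ‖normalizedDdc ψ p‖ :=
      ((continuous_normalizedDdc hψ).integrable_of_hasCompactSupport
        (hasCompactSupport_normalizedDdc hψ hc)).norm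
    have hle : ∀ n : ℕ, ∫ p, ‖Real.log ‖1 - a p ^ (n + 1) * b p‖ * normalizedDdc ψ p‖ ≤
        m n * ∫ p, ‖normalizedDdc ψ p‖ := fun n => by
      rw [← integral_const_mul]
      refine integral_mono (hint n).norm (hφ.const_mul _) fun p => ?_
      simp only [norm_mul]
      by_cases hp : p ∈ tsupport ψ
      · exact mul_le_mul_of_nonneg_right (hmb n p hp) (norm_nonneg _)
      · rw [normalizedDdc_eq_zero_of_notMem_tsupport hψ hp, norm_zero, mul_zero, mul_zero]
    have := hasSum_integral_of_summable_integral_norm hint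
      (Summable.of_nonneg_of_le (fun n => integral_nonneg fun p => norm_nonneg _) hle
        (hm.mul_right _))
    simp only [(hterm _).integral_eq_zero ψ hψ hc hs] at this
    simp only [← tsum_mul_right]
    exact this.unique hasSum_zero

end Product

section BettiBranch

variable {c : Chart} {D : Set ℂ} {L : ℂ → PeriodPair} {β₁ β₂ : C2 → ℝ}

/-- The complement of the zero section in the domain of the chart. -/
def Chart.affine (c : Chart) : Set C2 := {p | p ∈ c.domain ∧ (c.toFun p).point ≠ 0}

theorem Chart.isOpen_affine (c : Chart) : IsOpen c.affine :=
  isOpen_iff_mem_nhds.mpr fun _ hp => by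
    filter_upwards [c.domain.isOpen.mem_nhds hp.1, eventually_point_ne_zero hp.1 hp.2] with q h1 h2
      using ⟨h1, h2⟩

namespace IsBettiBranch

variable (hL : IsPeriodFamily D L) (hβ : IsBettiBranch c D L β₁ β₂)
include hL hβ

theorem holoAt_zeta {p : C2} (hp : p ∈ c.domain) : HoloAt (c.zeta L β₁ β₂) p := by
  filter_upwards [c.domain.isOpen.mem_nhds hp] with q hq
  exact ⟨(hβ.contDiffOn_zeta hL).contDiffAt (c.domain.isOpen.mem_nhds hq),
    hβ.differentiableAt_zeta hL hq⟩

theorem quadraticPart_eq {p : C2} (hp : p ∈ c.domain) :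
    quadraticPart (L (c.t p)) (β₁ p * (L (c.t p)).ω₁ + β₂ p * (L (c.t p)).ω₂) =
      bettiPotential c L β₂ p := by
  have h := (hβ.tau_im_pos hL hp).ne'
  rw [quadraticPart, zeta_eq, bettiPotential, Chart.zeta]
  change Real.pi * _ / (c.tau L p).im = _
  simp
  field_simp

theorem neronHeight_eq {p : C2} (hp : p ∈ c.affine) :
    neronHeight (c.toFun p) = neronFun (L (c.t p)) (c.t p)
      (β₁ p * (L (c.t p)).ω₁ + β₂ p * (L (c.t p)).ω₂) := by
  obtain ⟨hz, hX, hY⟩ := hβ.isLog_of_point_ne_zero hp.1 hp.2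
  rw [neronHeight, point_eq_some hp.2]
  exact (hβ.isLegendrePeriods hL hp.1).neronLocalHeight_some _ hz hX.symm hY.symm

/-- The nome `exp (2πiτ)` of the fibre. -/
def _root_.LegendreCurrent.Chart.nome (c : Chart) (L : ℂ → PeriodPair) (p : C2) : ℂ :=
  Complex.exp (2 * Real.pi * Complex.I * c.tau L p)

theorem neronHeight_sub_bettiPotential {p : C2} (hp : p ∈ c.affine) :
    neronHeight (c.toFun p) - bettiPotential c L β₂ p =
      -1 * Real.log ‖Complex.sin (Real.pi * c.zeta L β₁ β₂ p)‖ +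
      -1 * Real.log ‖qProd (c.nome L p)
        (Complex.exp (2 * Real.pi * Complex.I * c.zeta L β₁ β₂ p))‖ +
      -1 * Real.log ‖qProd (c.nome L p)
        (Complex.exp (-(2 * Real.pi * Complex.I * c.zeta L β₁ β₂ p)))‖ +
      2 * Real.log ‖qProd (c.nome L p) 1‖ +
      Real.log ‖Real.pi / (L (c.t p)).ω₁‖ +
      -1 / 12 * Real.log ‖16 * c.t p ^ 2 * (c.t p - 1) ^ 2‖ := by
  have hτ := hβ.tau_im_pos hL hp.1
  obtain ⟨h1, h2, h3⟩ := sigmaProd_factors_ne (hβ.zeta_ne hp.1 hp.2)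
  have hq := norm_nome_lt_one hτ
  rw [hβ.neronHeight_eq hL hp, neronFun, hβ.quadraticPart_eq hL hp.1, latticeSigma, zeta_eq,
    deriv_latticeSigma_zero, legendre_Δ]
  change bettiPotential c L β₂ p - Real.log ‖sigmaProd (c.tau L p) _‖ +
    Real.log ‖deriv (sigmaProd (c.tau L p)) 0 / _‖ - _ - _ = _
  have hω := (L (c.t p)).ω₁_ne_zero
  have hone := qProd_ne_zero hq (nome_pow_ne_one hτ)
  rw [deriv_sigmaProd_zero hτ, sigmaProd, norm_mul, norm_mul,
    Real.log_mul (norm_ne_zero_iff.mpr h1) (mul_ne_zero (norm_ne_zero_iff.mpr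
      (qProd_ne_zero hq h2)) (norm_ne_zero_iff.mpr (qProd_ne_zero hq h3))),
    Real.log_mul (norm_ne_zero_iff.mpr (qProd_ne_zero hq h2)) (norm_ne_zero_iff.mpr
      (qProd_ne_zero hq h3)), mul_div_right_comm, norm_mul, norm_pow,
    Real.log_mul (norm_ne_zero_iff.mpr (div_ne_zero (by simp [Real.pi_ne_zero]) hω))
      (pow_ne_zero _ (norm_ne_zero_iff.mpr hone)), Real.log_pow]
  simp only [Chart.nome]
  push_cast
  ring

/-- Off the zero section, the Néron local height and the smooth potential of `dβ₁ ∧ dβ₂` differ by a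
pluriharmonic function. -/
theorem isWeaklyPluriharmonicOn_neronHeight_sub :
    IsWeaklyPluriharmonicOn (fun p => neronHeight (c.toFun p) - bettiPotential c L β₂ p)
      c.affine := by
  have hV := c.isOpen_affine
  have hζ : ∀ p ∈ c.affine, HoloAt (c.zeta L β₁ β₂) p := fun p hp => hβ.holoAt_zeta hL hp.1
  have hq : ∀ p ∈ c.affine, HoloAt (c.nome L) p := fun p hp =>
    (hβ.analyticAt_tau hL hp.1).holoAt.comp_analyticAt
      (k := fun x => Complex.exp (2 * Real.pi * Complex.I * x)) (by fun_prop)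
  have hlt : ∀ p ∈ c.affine, ‖c.nome L p‖ < 1 := fun p hp =>
    norm_nome_lt_one (hβ.tau_im_pos hL hp.1)
  have hne : ∀ p ∈ c.affine, _ := fun p hp =>
    sigmaProd_factors_ne (hβ.zeta_ne hp.1 hp.2)
  refine IsWeaklyPluriharmonicOn.congr ?_ fun p hp => hβ.neronHeight_sub_bettiPotential hL hp
  refine ((((((isWeaklyPluriharmonicOn_log_norm hV (fun p hp => ?_)
    fun p hp => (hne p hp).1).const_mul (-1)).add hV
    ((isWeaklyPluriharmonicOn_log_norm_qProd hV hq (fun p hp => ?_) hlt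
      fun n p hp => (hne p hp).2.1 n).const_mul (-1))).add hV
    ((isWeaklyPluriharmonicOn_log_norm_qProd hV hq (fun p hp => ?_) hlt
      fun n p hp => (hne p hp).2.2 n).const_mul (-1))).add hV
    ((isWeaklyPluriharmonicOn_log_norm_qProd hV hq (fun p hp => analyticAt_const.holoAt) hlt
      fun n p hp => nome_pow_ne_one (hβ.tau_im_pos hL hp.1) n).const_mul 2)).add hV
    (isWeaklyPluriharmonicOn_log_norm hV (fun p hp => ?_) fun p hp => ?_)).add hV
    ((isWeaklyPluriharmonicOn_log_norm hV (fun p hp => ?_) fun p hp => ?_).const_mul (-1 / 12))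
  · exact (hζ p hp).comp_analyticAt (k := fun x => Complex.sin (Real.pi * x)) (by fun_prop)
  · exact (hζ p hp).comp_analyticAt (k := fun x => Complex.exp (2 * Real.pi * Complex.I * x))
      (by fun_prop)
  · exact (hζ p hp).comp_analyticAt (k := fun x => Complex.exp (-(2 * Real.pi * Complex.I * x)))
      (by fun_prop)
  · exact (analyticAt_const.div (hβ.analyticAt_omega hL hp.1) (PeriodPair.ω₁_ne_zero _)).holoAt
  · exact div_ne_zero (by simp [Real.pi_ne_zero]) (PeriodPair.ω₁_ne_zero _)
  · exact (c.analyticAt_base p hp.1).holoAt.comp_analyticAt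
      (k := fun x => 16 * x ^ 2 * (x - 1) ^ 2) (by fun_prop)
  · have h0 := (c.toFun p).base_ne_zero
    have h1 := sub_ne_zero.mpr (c.toFun p).base_ne_one
    exact mul_ne_zero (mul_ne_zero (by norm_num) (pow_ne_zero _ h0)) (pow_ne_zero _ h1)

end IsBettiBranch

end BettiBranch

/-! ### Removal of a smooth hypersurface -/

/-- The `r`-neighbourhood `|s| < r` of a smooth hypersurface `s = 0` has volume `O(r²)`: in a
coordinate direction transversal to the hypersurface the slices have diameter `O(r)`. -/
theorem exists_volume_sublevel_le {s : C2 → ℂ} {p : C2} (hs : AnalyticAt ℂ s p)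
    (hd : fderiv ℂ s p ≠ 0) : ∃ W : Set C2, IsOpen W ∧ p ∈ W ∧ ∃ C : ℝ, 0 ≤ C ∧ ∀ r > 0,
      volume {q | q ∈ W ∧ ‖s q‖ < r} ≤ ENNReal.ofReal (C * r ^ 2) := by
  obtain ⟨i, hi⟩ : ∃ i, fderiv ℂ s p (Pi.single i 1) ≠ 0 := by
    by_contra! h
    refine hd (ContinuousLinearMap.ext fun v => ?_)
    have hv : v = v 0 • Pi.single 0 (1 : ℂ) + v 1 • Pi.single 1 (1 : ℂ) := by
      funext j; fin_cases j <;> simp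
    rw [hv, map_add, map_smul, map_smul, h, h]
    simp
  set c := ‖fderiv ℂ s p (Pi.single i 1)‖ with hc
  have hc0 : 0 < c := norm_pos_iff.mpr hi
  obtain ⟨W₁, hW₁, happ⟩ := hs.hasStrictFDerivAt.approximates_deriv_on_nhds
    (c := (c / 2).toNNReal) (Or.inr (Real.toNNReal_pos.mpr (half_pos hc0)))
  obtain ⟨ρ, hρ, hball⟩ := Metric.mem_nhds_iff.mp
    (inter_mem hW₁ (hs.eventually_analyticAt))
  set W := Metric.ball p ρ
  have hcont : ContinuousOn s W := fun q hq =>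
    (hball hq).2.continuousAt.continuousWithinAt
  have hinj : ∀ (y : Fin 1 → ℂ) (z z' : ℂ), i.insertNth z y ∈ W → i.insertNth z' y ∈ W →
      c / 2 * ‖z - z'‖ ≤ ‖s (i.insertNth z y) - s (i.insertNth z' y)‖ := by
    intro y z z' h h'
    have h1 := happ _ (hball h).1 _ (hball h').1
    have e : (i.insertNth z y : C2) - i.insertNth z' y = (z - z') • Pi.single i (1 : ℂ) := by
      rw [Fin.insertNth_sub_same, ← Pi.single_smul]; simp
    rw [e, map_smul, norm_smul, Pi.norm_single, norm_one, mul_one] at h1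
    have h2 : ‖(z - z') • fderiv ℂ s p (Pi.single i 1)‖ = ‖z - z'‖ * c := norm_smul _ _
    have h3 := norm_sub_norm_le ((z - z') • fderiv ℂ s p (Pi.single i 1))
      (s (i.insertNth z y) - s (i.insertNth z' y))
    rw [Real.coe_toNNReal _ (half_pos hc0).le] at h1
    rw [norm_sub_rev] at h1
    linarith
  refine ⟨W, Metric.isOpen_ball, Metric.mem_ball_self hρ,
    Real.pi * (4 / c) ^ 2 * (volume (Metric.closedBall (fun j => p (i.succAbove j)) ρ)).toReal,
    by positivity, fun r hr => ?_⟩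
  set A : Set C2 := {q | q ∈ W ∧ ‖s q‖ < r} with hA
  have hAo : IsOpen A := by
    have := hcont.isOpen_inter_preimage Metric.isOpen_ball (Metric.isOpen_ball (x := 0) (ε := r))
    convert this using 1
    ext q
    simp [hA]
  have hmp := (volume_preserving_piFinSuccAbove (fun _ : Fin 2 => ℂ) i).symm
  rw [← hmp.measure_preimage_equiv, Measure.volume_eq_prod,
    Measure.prod_apply_symm ((MeasurableEquiv.measurable _) hAo.measurableSet)]
  set Y := Metric.closedBall (fun j => p (i.succAbove j)) ρ
  have hsec : ∀ y : Fin 1 → ℂ, volume ((fun z : ℂ => (z, y)) ⁻¹'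
      ((MeasurableEquiv.piFinSuccAbove (fun _ : Fin 2 => ℂ) i).symm ⁻¹' A)) ≤
        Y.indicator (fun _ => ENNReal.ofReal (Real.pi * (4 / c) ^ 2 * r ^ 2)) y := by
    intro y
    rcases Set.eq_empty_or_nonempty ((fun z : ℂ => (z, y)) ⁻¹'
      ((MeasurableEquiv.piFinSuccAbove (fun _ : Fin 2 => ℂ) i).symm ⁻¹' A)) with h | ⟨z₀, hz₀⟩
    · rw [h, measure_empty]; exact zero_le
    have hz₀' : i.insertNth z₀ y ∈ A := hz₀
    have hy : y ∈ Y := by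
      rw [Metric.mem_closedBall, dist_pi_le_iff hρ.le]
      intro j
      have := dist_le_pi_dist (i.insertNth z₀ y : C2) p (i.succAbove j)
      rw [Fin.insertNth_apply_succAbove] at this
      exact this.trans (Metric.mem_ball.mp hz₀'.1).le
    rw [Set.indicator_of_mem hy]
    have hsub : ((fun z : ℂ => (z, y)) ⁻¹'
      ((MeasurableEquiv.piFinSuccAbove (fun _ : Fin 2 => ℂ) i).symm ⁻¹' A)) ⊆
        Metric.closedBall z₀ (4 * r / c) := by
      intro z hz
      have hz' : i.insertNth z y ∈ A := hz
      have h1 := hinj y z z₀ hz'.1 hz₀'.1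
      have h2 := (norm_sub_le (s (i.insertNth z y)) (s (i.insertNth z₀ y)))
      have h3 := hz'.2
      have h4 := hz₀'.2
      rw [Metric.mem_closedBall, dist_eq_norm, le_div_iff₀ hc0]
      linarith
    refine (measure_mono hsub).trans ?_
    rw [Complex.volume_closedBall, ← ENNReal.ofReal_pow (by positivity)]
    rw [show (NNReal.pi : ENNReal) = ENNReal.ofReal Real.pi from by
      rw [← NNReal.coe_real_pi, ENNReal.ofReal_coe_nnreal],
      ← ENNReal.ofReal_mul (by positivity)]
    refine ENNReal.ofReal_le_ofReal (le_of_eq ?_)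
    ring
  refine (lintegral_mono hsec).trans ?_
  rw [lintegral_indicator Metric.isClosed_closedBall.measurableSet, setLIntegral_const]
  refine (mul_le_mul' le_rfl (ENNReal.ofReal_toReal (measure_closedBall_lt_top (μ := volume)
      (x := fun j => p (i.succAbove j)) (r := ρ)).ne).ge).trans ?_
  rw [← ENNReal.ofReal_mul (by positivity)]
  refine ENNReal.ofReal_le_ofReal (le_of_eq ?_)
  ring

/-- Smooth functions that go from `0` to `1` on `[-2N, -N]`, with derivatives of order `k` bounded
by a multiple of `N⁻ᵏ`. -/
theorem exists_transition : ∃ B : ℝ, 0 ≤ B ∧ ∀ N : ℕ, 0 < N → ∃ Φ : ℝ → ℝ, ContDiff ℝ ∞ Φ ∧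
    (∀ y, 0 ≤ Φ y ∧ Φ y ≤ 1) ∧ (∀ y ≤ -2 * (N : ℝ), Φ y = 0) ∧ (∀ y ≥ -(N : ℝ), Φ y = 1) ∧
    (∀ y, |deriv Φ y| ≤ B / N) ∧ (∀ y, |deriv (deriv Φ) y| ≤ B / N ^ 2) ∧
    (∀ y, y < -2 * (N : ℝ) ∨ -(N : ℝ) < y → deriv Φ y = 0 ∧ deriv (deriv Φ) y = 0) := by
  have hsm : ContDiff ℝ ∞ Real.smoothTransition := Real.smoothTransition.contDiff
  have hbd : ∀ f : ℝ → ℝ, Continuous f → (∀ x < 0, f x = 0) → (∀ x > 1, f x = 0) →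
      ∃ B : ℝ, ∀ x, |f x| ≤ B := by
    intro f hf h0 h1
    obtain ⟨B, hB⟩ := (isCompact_Icc (a := (0 : ℝ)) (b := 1)).exists_bound_of_continuousOn
      hf.continuousOn
    refine ⟨B, fun x => ?_⟩
    by_cases hx : x ∈ Set.Icc (0 : ℝ) 1
    · exact hB x hx
    · have hB0 : 0 ≤ B := (norm_nonneg _).trans (hB 0 (by simp))
      have : f x = 0 := by
        rw [Set.mem_Icc, not_and_or, not_le, not_le] at hx
        exact hx.elim (h0 x) (h1 x)
      rwa [this, abs_zero]
  have hl : ∀ x < (0 : ℝ), Real.smoothTransition =ᶠ[𝓝 x] fun _ => 0 := fun x hx => by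
    filter_upwards [Iio_mem_nhds hx] with y hy using Real.smoothTransition.zero_of_nonpos hy.le
  have hr : ∀ x > (1 : ℝ), Real.smoothTransition =ᶠ[𝓝 x] fun _ => 1 := fun x hx => by
    filter_upwards [Ioi_mem_nhds hx] with y hy using Real.smoothTransition.one_of_one_le hy.le
  have hd1 : ContDiff ℝ ∞ (deriv Real.smoothTransition) := (contDiff_infty_iff_deriv.mp hsm).2
  have hd2 : ContDiff ℝ ∞ (deriv (deriv Real.smoothTransition)) :=
    (contDiff_infty_iff_deriv.mp hd1).2
  obtain ⟨B₁, hB₁⟩ := hbd _ hd1.continuous (fun x hx => by simp [(hl x hx).deriv_eq])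
    (fun x hx => by simp [(hr x hx).deriv_eq])
  obtain ⟨B₂, hB₂⟩ := hbd _ hd2.continuous (fun x hx => by simp [(hl x hx).deriv.deriv_eq])
    (fun x hx => by simp [(hr x hx).deriv.deriv_eq])
  refine ⟨max B₁ B₂, (abs_nonneg _).trans ((hB₁ 0).trans (le_max_left _ _)), fun N hN => ?_⟩
  have hN' : (0 : ℝ) < N := by exact_mod_cast hN
  have hin : ∀ y : ℝ, HasDerivAt (fun y : ℝ => y / N + 2) (1 / N) y := fun y =>
    ((hasDerivAt_id y).div_const _).add_const 2
  have e1 : deriv (fun y : ℝ => Real.smoothTransition (y / N + 2)) =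
      fun y => deriv Real.smoothTransition (y / N + 2) * (1 / N) := funext fun y =>
    ((hsm.differentiable (by simp) _).hasDerivAt.comp y (hin y)).deriv
  have e2 : deriv (fun y => deriv Real.smoothTransition (y / N + 2) * (1 / N)) =
      fun y => deriv (deriv Real.smoothTransition) (y / N + 2) * (1 / N) * (1 / N) :=
    funext fun y => (((hd1.differentiable (by simp) _).hasDerivAt.comp y (hin y)).mul_const _).deriv
  refine ⟨fun y => Real.smoothTransition (y / N + 2), hsm.comp (by fun_prop),
    fun y => ⟨Real.smoothTransition.nonneg _, Real.smoothTransition.le_one _⟩, fun y hy => ?_,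
    fun y hy => ?_, fun y => ?_, fun y => ?_, fun y hy => ?_⟩
  · refine Real.smoothTransition.zero_of_nonpos ?_
    have : y / N ≤ -2 := by rwa [div_le_iff₀ hN']
    linarith
  · refine Real.smoothTransition.one_of_one_le ?_
    have : -1 ≤ y / N := by rw [le_div_iff₀ hN']; linarith
    linarith
  · rw [e1, abs_mul, abs_of_pos (by positivity : (0 : ℝ) < 1 / N), mul_one_div]
    exact div_le_div_of_nonneg_right ((hB₁ _).trans (le_max_left _ _)) hN'.le
  · rw [e1, e2, abs_mul, abs_mul, abs_of_pos (by positivity : (0 : ℝ) < 1 / N), mul_one_div,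
      mul_one_div, div_div, ← sq]
    exact div_le_div_of_nonneg_right ((hB₂ _).trans (le_max_right _ _)) (by positivity)
  · have h2 : deriv Real.smoothTransition (y / N + 2) = 0 ∧
        deriv (deriv Real.smoothTransition) (y / N + 2) = 0 := by
      rcases hy with hy | hy
      · have h : y / N + 2 < 0 := by
          have : y / N < -2 := by rwa [div_lt_iff₀ hN']
          linarith
        simp [(hl _ h).deriv_eq, (hl _ h).deriv.deriv_eq]
      · have h : 1 < y / N + 2 := by
          have : -1 < y / N := by rw [lt_div_iff₀ hN']; linarith
          linarith
        simp [(hr _ h).deriv_eq, (hr _ h).deriv.deriv_eq]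
    rw [e1, e2]
    simp [h2]

section

variable {V : Set C2} {f a g : C2 → ℝ} {p : C2}

theorem ddcPair_mul (hV : IsOpen V) (hf : ContDiffOn ℝ ∞ f V) (ha : ContDiffOn ℝ ∞ a V)
    (hp : p ∈ V) (v w : C2) : ddcPair (fun q => f q * a q) p v w =
      f p * ddcPair a p v w + fderiv ℝ f p v * fderiv ℝ a p (-Complex.I • w) +
      (a p * ddcPair f p v w + fderiv ℝ a p v * fderiv ℝ f p (-Complex.I • w)) := by
  have hd : ∀ {k : C2 → ℝ}, ContDiffOn ℝ ∞ k V → ∀ q ∈ V, HasFDerivAt k (fderiv ℝ k q) q :=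
    fun hk q hq => ((hk.contDiffAt (hV.mem_nhds hq)).differentiableAt (by simp)).hasFDerivAt
  have he : (fun q => fderiv ℝ (fun q => f q * a q) q (-Complex.I • w)) =ᶠ[𝓝 p] fun q =>
      f q * fderiv ℝ a q (-Complex.I • w) + a q * fderiv ℝ f q (-Complex.I • w) := by
    filter_upwards [hV.mem_nhds hp] with q hq
    rw [((hd hf q hq).fun_mul (hd ha q hq)).fderiv]
    simp
  rw [ddcPair, he.fderiv_eq, (((hd hf p hp).fun_mul
    (hd (contDiffOn_fderiv_apply_const hV ha (-Complex.I • w)) p hp)).fun_add ((hd ha p hp).fun_mul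
    (hd (contDiffOn_fderiv_apply_const hV hf (-Complex.I • w)) p hp))).fderiv]
  simp only [ddcPair, add_apply, smul_apply, smul_eq_mul]
  ring

theorem fderiv_comp_real {Φ : ℝ → ℝ} (hΦ : ContDiff ℝ ∞ Φ) (hg : ContDiffAt ℝ ∞ g p) (v : C2) :
    fderiv ℝ (fun q => Φ (g q)) p v = deriv Φ (g p) * fderiv ℝ g p v := by
  have h := (hΦ.differentiable (by simp) (g p)).hasDerivAt.comp_hasFDerivAt p
    (hg.differentiableAt (by simp)).hasFDerivAt
  have e : fderiv ℝ (fun q => Φ (g q)) p = deriv Φ (g p) • fderiv ℝ g p := h.fderiv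
  rw [e]
  simp

theorem ddcPair_comp_real (hV : IsOpen V) {Φ : ℝ → ℝ} (hΦ : ContDiff ℝ ∞ Φ)
    (hg : ContDiffOn ℝ ∞ g V) (hp : p ∈ V) (v w : C2) : ddcPair (fun q => Φ (g q)) p v w =
      deriv Φ (g p) * ddcPair g p v w +
        deriv (deriv Φ) (g p) * (fderiv ℝ g p v * fderiv ℝ g p (-Complex.I • w)) := by
  have hgp : ∀ q ∈ V, ContDiffAt ℝ ∞ g q := fun q hq => hg.contDiffAt (hV.mem_nhds hq)
  have hΦ' : ContDiff ℝ ∞ (deriv Φ) := (contDiff_infty_iff_deriv.mp hΦ).2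
  have he : (fun q => fderiv ℝ (fun q => Φ (g q)) q (-Complex.I • w)) =ᶠ[𝓝 p] fun q =>
      deriv Φ (g q) * fderiv ℝ g q (-Complex.I • w) := by
    filter_upwards [hV.mem_nhds hp] with q hq using fderiv_comp_real hΦ (hgp q hq) _
  have h1 : DifferentiableAt ℝ (fun q => deriv Φ (g q)) p :=
    (hΦ'.contDiffAt.comp p (hgp p hp)).differentiableAt (by simp)
  have h2 : DifferentiableAt ℝ (fun q => fderiv ℝ g q (-Complex.I • w)) p :=
    ((contDiffOn_fderiv_apply_const hV hg _).contDiffAt (hV.mem_nhds hp)).differentiableAt (by simp)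
  rw [ddcPair, he.fderiv_eq, (h1.hasFDerivAt.fun_mul h2.hasFDerivAt).fderiv]
  simp only [add_apply, smul_apply, smul_eq_mul]
  rw [fderiv_comp_real hΦ' (hgp p hp), ddcPair]
  ring

end

theorem norm_frame (i : Fin 4) : ‖frame i‖ = 1 := by
  fin_cases i <;> simp [frame, Pi.norm_single]

theorem norm_neg_I_smul (v : C2) : ‖-Complex.I • v‖ = ‖v‖ := by simp [norm_smul]

theorem abs_fderiv_le {f : C2 → ℝ} {p v : C2} {d : ℝ} (hd : ‖fderiv ℝ f p‖ ≤ d) (hv : ‖v‖ = 1) :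
    |fderiv ℝ f p v| ≤ d :=
  ((fderiv ℝ f p).le_opNorm v).trans (by rwa [hv, mul_one])

/-- The commutator of `ddᶜ` with multiplication by `χ`, for one component of the form. -/
theorem abs_ddcPair_mul_sub_le {V : Set C2} (hV : IsOpen V) {χ a : C2 → ℝ}
    (hχ : ContDiffOn ℝ ∞ χ V) (ha : ContDiffOn ℝ ∞ a V) {p : C2} (hp : p ∈ V) {v w : C2}
    (hv : ‖v‖ = 1) (hw : ‖w‖ = 1) {d e M : ℝ} (hM : |a p| ≤ M) (hM' : ‖fderiv ℝ a p‖ ≤ M)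
    (hd : ‖fderiv ℝ χ p‖ ≤ d) (he : |ddcPair χ p v w - ddcPair χ p w v| ≤ e) :
    |(ddcPair (fun q => χ q * a q) p v w - ddcPair (fun q => χ q * a q) p w v) -
      χ p * (ddcPair a p v w - ddcPair a p w v)| ≤ 4 * (d * M) + M * e := by
  have hv' : ‖-Complex.I • v‖ = 1 := by rw [norm_neg_I_smul, hv]
  have hw' : ‖-Complex.I • w‖ = 1 := by rw [norm_neg_I_smul, hw]
  have hM0 : 0 ≤ M := (abs_nonneg _).trans hM
  have hprod : ∀ x y : C2, ‖x‖ = 1 → ‖y‖ = 1 → |fderiv ℝ χ p x * fderiv ℝ a p y| ≤ d * M :=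
    fun x y hx hy => by
      rw [abs_mul]
      exact mul_le_mul (abs_fderiv_le hd hx) (abs_fderiv_le hM' hy) (abs_nonneg _)
        ((norm_nonneg _).trans hd)
  have h1 := abs_le.mp (hprod _ _ hv hw')
  have h2 := abs_le.mp (hprod _ _ hw' hv)
  have h3 := abs_le.mp (hprod _ _ hw hv')
  have h4 := abs_le.mp (hprod _ _ hv' hw)
  have h5 : |a p * (ddcPair χ p v w - ddcPair χ p w v)| ≤ M * e := by
    rw [abs_mul]
    exact mul_le_mul hM he (abs_nonneg _) hM0
  have h5 := abs_le.mp h5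
  rw [ddcPair_mul hV hχ ha hp, ddcPair_mul hV hχ ha hp, abs_le]
  constructor <;> linarith

/-- The commutator of `(1 / 2πi) dd^c` with multiplication by `χ` involves only first derivatives of
`χ` and the antisymmetrized second derivatives, which are small for a cut-off in a pluriharmonic
function. -/
theorem abs_normalizedDdc_smul_sub_le {V : Set C2} (hV : IsOpen V) {χ : C2 → ℝ} {ψ : C2 → Alt 2}
    (hχ : ContDiffOn ℝ ∞ χ V) (hψ : ContDiff ℝ ∞ ψ) (hχψ : ContDiff ℝ ∞ fun q => χ q • ψ q)
    {p : C2} (hp : p ∈ V) {d e M : ℝ} (hM : ∀ k l, |coeff ψ k l p| ≤ M)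
    (hM' : ∀ k l, ‖fderiv ℝ (coeff ψ k l) p‖ ≤ M) (hd : ‖fderiv ℝ χ p‖ ≤ d)
    (he : ∀ v w : C2, ‖v‖ = 1 → ‖w‖ = 1 → |ddcPair χ p v w - ddcPair χ p w v| ≤ e) :
    |normalizedDdc (fun q => χ q • ψ q) p - χ p * normalizedDdc ψ p| ≤
      6 * (4 * (d * M) + M * e) := by
  have key : ∀ k l i j : Fin 4, _ := fun k l i j => abs_le.mp (abs_ddcPair_mul_sub_le hV hχ
    (contDiff_apply_alt hψ ![frame k, frame l]).contDiffOn hp (norm_frame i) (norm_frame j)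
    (hM k l) (hM' k l) hd (he _ _ (norm_frame i) (norm_frame j)))
  have hco : ∀ k l, coeff (fun q => χ q • ψ q) k l = fun q => χ q * coeff ψ k l q := fun k l => rfl
  rw [normalizedDdc_eq hχψ, normalizedDdc_eq hψ]
  simp only [hco]
  have k1 := key 0 1 2 3
  have k2 := key 0 2 1 3
  have k3 := key 0 3 1 2
  have k4 := key 1 2 0 3
  have k5 := key 1 3 0 2
  have k6 := key 2 3 0 1
  have hpi : 1 / (2 * Real.pi) ≤ 1 := by
    rw [div_le_one (by positivity)]
    linarith [Real.pi_gt_three]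
  rw [mul_left_comm, ← mul_sub, abs_mul, abs_of_pos (by positivity : 0 < 1 / (2 * Real.pi))]
  refine (mul_le_of_le_one_left (abs_nonneg _) hpi).trans ?_
  rw [abs_le]
  constructor <;> linarith

/-- The differential of `log |s|` is `O(1 / |s|)`. -/
theorem norm_fderiv_log_norm_le {s : C2 → ℂ} {p : C2} (hs : DifferentiableAt ℂ s p)
    (h0 : s p ≠ 0) : ‖fderiv ℝ (fun q => Real.log ‖s q‖) p‖ ≤ ‖fderiv ℂ s p‖ / ‖s p‖ := by
  have h1 : HasFDerivAt (fun q => Complex.log (s q * (s p)⁻¹)) _ p :=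
    ((hs.hasFDerivAt.mul_const (s p)⁻¹).clog (by
      rw [mul_inv_cancel₀ h0]; exact Complex.one_mem_slitPlane)).restrictScalars ℝ
  have h2 := ((Complex.reCLM.hasFDerivAt.comp p h1).add_const
    (Real.log ‖s p‖)).congr_of_eventuallyEq (f₁ := fun q => Real.log ‖s q‖) (by
      filter_upwards [hs.continuousAt.eventually_ne h0] with q hq
      simp only [Function.comp, Complex.reCLM_apply, Complex.log_re, ← div_eq_mul_inv, norm_div]
      rw [Real.log_div (norm_ne_zero_iff.mpr hq) (norm_ne_zero_iff.mpr h0)]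
      ring)
  rw [h2.fderiv]
  refine ContinuousLinearMap.opNorm_le_bound _ (by positivity) fun v => ?_
  refine (Complex.abs_re_le_norm _).trans ?_
  have := (fderiv ℂ s p).le_opNorm v
  simp only [mul_inv_cancel₀ h0]
  simp
  rw [← div_eq_inv_mul, div_mul_eq_mul_div]
  gcongr

/-- If `e^{-2N} ≤ ℓ ≤ e^{-N}`, then one of the terms bounds `ℓ⁻²`: the one with
`e^{-(N+k+1)} < ℓ ≤ e^{-(N+k)}`. -/
theorem inv_sq_le_dyadic_sum {ℓ : ℝ} (hℓ : 0 < ℓ) {N : ℕ} (h1 : -2 * (N : ℝ) ≤ Real.log ℓ)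
    (h2 : Real.log ℓ ≤ -(N : ℝ)) (b : ℕ → ℝ) (hb0 : ∀ j, 0 ≤ b j)
    (hb1 : ∀ j : ℕ, ℓ < 2 * Real.exp (-j) → b j = 1) :
    (ℓ ^ 2)⁻¹ ≤ ∑ k ∈ Finset.range (N + 1), Real.exp (2 * ((N + k : ℕ) + 1)) * b (N + k) := by
  have hN : (N : ℝ) ≤ -Real.log ℓ := by linarith
  have hn0 : 0 ≤ -Real.log ℓ := (Nat.cast_nonneg N).trans hN
  set j := ⌊-Real.log ℓ⌋₊ with hj
  have hj1 : (j : ℝ) ≤ -Real.log ℓ := Nat.floor_le hn0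
  have hj2 : -Real.log ℓ < j + 1 := Nat.lt_floor_add_one _
  have hNj : N ≤ j := Nat.le_floor hN
  have hj3 : j < 2 * N + 1 := by
    have : (j : ℝ) < 2 * N + 1 := by linarith
    exact_mod_cast this
  have hbj : b j = 1 := by
    refine hb1 j ?_
    have h3 : ℓ ≤ Real.exp (-j) := by
      rw [← Real.log_le_iff_le_exp hℓ]; linarith
    have := Real.exp_pos (-(j : ℝ))
    linarith
  have hle : (ℓ ^ 2)⁻¹ ≤ Real.exp (2 * ((j : ℝ) + 1)) := by
    rw [← Real.exp_log (inv_pos.mpr (pow_pos hℓ 2)), Real.exp_le_exp, Real.log_inv, Real.log_pow]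
    push_cast
    linarith
  have hmem : j - N ∈ Finset.range (N + 1) := by rw [Finset.mem_range]; omega
  have hs := Finset.single_le_sum
    (f := fun k => Real.exp (2 * ((N + k : ℕ) + 1)) * b (N + k))
    (fun k _ => mul_nonneg (Real.exp_pos _).le (hb0 _)) hmem
  simp only [Nat.add_sub_cancel' hNj, hbj, mul_one] at hs
  exact hle.trans hs

section

variable {V : Set C2} {s : C2 → ℂ} {C : ℝ}

/-- The volume bound for `|s| < r`, in the form of a bound for an integral. -/
theorem integral_indicator_sublevel_le (hV : IsOpen V) (hs : ContinuousOn s V) (hC : 0 ≤ C)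
    (hvol : ∀ r > 0, volume {q | q ∈ V ∧ ‖s q‖ < r} ≤ ENNReal.ofReal (C * r ^ 2)) {r : ℝ}
    (hr : 0 < r) : Integrable ({q | q ∈ V ∧ ‖s q‖ < r}.indicator (fun _ => (1 : ℝ))) ∧
      ∫ q, {q | q ∈ V ∧ ‖s q‖ < r}.indicator (fun _ => (1 : ℝ)) q ≤ C * r ^ 2 := by
  have hm : MeasurableSet {q | q ∈ V ∧ ‖s q‖ < r} := by
    have := hs.isOpen_inter_preimage hV (Metric.isOpen_ball (x := 0) (ε := r))
    refine IsOpen.measurableSet ?_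
    convert this using 1
    ext q
    simp
  refine ⟨(integrable_indicator_iff hm).mpr (integrableOn_const
    ((hvol r hr).trans_lt ENNReal.ofReal_lt_top).ne), ?_⟩
  rw [integral_indicator hm, setIntegral_const, smul_eq_mul, mul_one]
  exact ENNReal.toReal_le_of_le_ofReal (by positivity) (hvol r hr)

/-- The cut-off function `Φ (log |s|)`, with value `0` on the hypersurface `s = 0`. There `Real.log`
has the value `0`, which would give `Φ 0`. -/
def cutoff (Φ : ℝ → ℝ) (s : C2 → ℂ) (p : C2) : ℝ :=
  open Classical in if s p = 0 then 0 else Φ (Real.log ‖s p‖)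

theorem cutoff_of_ne {Φ : ℝ → ℝ} {p : C2} (h : s p ≠ 0) :
    cutoff Φ s p = Φ (Real.log ‖s p‖) := if_neg h

theorem cutoff_eventuallyEq_zero {Φ : ℝ → ℝ} {b : ℝ} (hΦ : ∀ y ≤ b, Φ y = 0) {p : C2}
    (hs : ContinuousAt s p) (h : s p = 0) : cutoff Φ s =ᶠ[𝓝 p] fun _ => 0 := by
  have hlt : ∀ᶠ q in 𝓝 p, ‖s q‖ < Real.exp b :=
    hs.norm.eventually_lt_const (by simpa [h] using Real.exp_pos b)
  filter_upwards [hlt] with q hq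
  by_cases h0 : s q = 0
  · exact if_pos h0
  · rw [cutoff_of_ne h0]
    exact hΦ _ ((Real.log_le_iff_le_exp (norm_pos_iff.mpr h0)).mpr hq.le)

theorem contDiffOn_log_norm (hs : ∀ p ∈ V, HoloAt s p) :
    ContDiffOn ℝ ∞ (fun p => Real.log ‖s p‖) (V ∩ {p | s p ≠ 0}) := fun p hp => by
  obtain ⟨g, hg, he⟩ := exists_log_norm_eq_re (hs p hp.1) hp.2
  exact ((Complex.reCLM.contDiff.contDiffAt.comp p
    hg.contDiffAt).congr_of_eventuallyEq he).contDiffWithinAt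

theorem isOpen_inter_ne (hV : IsOpen V) (hs : ContinuousOn s V) :
    IsOpen (V ∩ {p | s p ≠ 0}) := hs.isOpen_inter_preimage hV isOpen_ne

theorem contDiffOn_cutoff {Φ : ℝ → ℝ} (hsm : ContDiff ℝ ∞ Φ) (hs : ∀ p ∈ V, HoloAt s p) :
    ContDiffOn ℝ ∞ (cutoff Φ s) (V ∩ {p | s p ≠ 0}) :=
  (hsm.comp_contDiffOn (contDiffOn_log_norm hs)).congr fun _ hp => cutoff_of_ne hp.2

theorem contDiff_cutoff_smul {Φ : ℝ → ℝ} (hsm : ContDiff ℝ ∞ Φ) {b : ℝ} (hΦ : ∀ y ≤ b, Φ y = 0)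
    (hV : IsOpen V) (hs : ∀ p ∈ V, HoloAt s p) {ψ : C2 → Alt 2} (hψ : ContDiff ℝ ∞ ψ)
    (hsupp : tsupport ψ ⊆ V) : ContDiff ℝ ∞ (fun p => cutoff Φ s p • ψ p) := by
  rw [contDiff_iff_contDiffAt]
  intro p
  by_cases hp : p ∈ tsupport ψ
  · have hpV := hsupp hp
    by_cases h0 : s p = 0
    · refine (contDiffAt_const (c := (0 : Alt 2))).congr_of_eventuallyEq ?_
      filter_upwards [cutoff_eventuallyEq_zero hΦ (hs p hpV).continuousAt h0] with q hq
      rw [hq, zero_smul]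
    · have ho := isOpen_inter_ne hV fun p hp => (hs p hp).continuousAt.continuousWithinAt
      exact ((contDiffOn_cutoff hsm hs).contDiffAt (ho.mem_nhds ⟨hpV, h0⟩)).smul hψ.contDiffAt
  · refine (contDiffAt_const (c := (0 : Alt 2))).congr_of_eventuallyEq ?_
    filter_upwards [notMem_tsupport_iff_eventuallyEq.mp hp] with q hq
    rw [hq, Pi.zero_apply, smul_zero]

theorem tsupport_cutoff_smul_subset {Φ : ℝ → ℝ} {b : ℝ} (hΦ : ∀ y ≤ b, Φ y = 0)
    (hs : ∀ p ∈ V, HoloAt s p) {ψ : C2 → Alt 2} (hsupp : tsupport ψ ⊆ V) :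
    tsupport (fun p => cutoff Φ s p • ψ p) ⊆ V ∩ {p | s p ≠ 0} := by
  intro p hp
  have hpψ : p ∈ tsupport ψ := tsupport_smul_subset_right (cutoff Φ s) ψ hp
  refine ⟨hsupp hpψ, fun h0 => ?_⟩
  refine notMem_tsupport_iff_eventuallyEq.mpr ?_ hp
  filter_upwards [cutoff_eventuallyEq_zero hΦ (hs p (hsupp hpψ)).continuousAt h0] with q hq
  rw [hq, zero_smul]
  rfl

/-- The differential and `ddᶜ` of a cut-off function of `log |s|`. As `log |s|` is pluriharmonic,
the second derivative of `Φ` only meets the square of the first derivative of `log |s|`. -/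
theorem cutoff_derivative_bounds {Φ : ℝ → ℝ} (hsm : ContDiff ℝ ∞ Φ) (hV : IsOpen V)
    (hs : ∀ p ∈ V, HoloAt s p) {p : C2} (hp : p ∈ V) (h0 : s p ≠ 0) {m d₁ d₂ : ℝ}
    (hm : ‖fderiv ℂ s p‖ ≤ m) (hd₁ : |deriv Φ (Real.log ‖s p‖)| ≤ d₁)
    (hd₂ : |deriv (deriv Φ) (Real.log ‖s p‖)| ≤ d₂) :
    ‖fderiv ℝ (cutoff Φ s) p‖ ≤ d₁ * (m / ‖s p‖) ∧
    ∀ v w : C2, ‖v‖ = 1 → ‖w‖ = 1 → |ddcPair (cutoff Φ s) p v w - ddcPair (cutoff Φ s) p w v| ≤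
      d₂ * (2 * (m / ‖s p‖) ^ 2) := by
  have ho := isOpen_inter_ne hV fun p hp => (hs p hp).continuousAt.continuousWithinAt
  have hmem : p ∈ V ∩ {p | s p ≠ 0} := ⟨hp, h0⟩
  have hg := contDiffOn_log_norm hs
  set g : C2 → ℝ := fun p => Real.log ‖s p‖ with hgdef
  have heq : ∀ q ∈ V ∩ {p | s p ≠ 0}, cutoff Φ s =ᶠ[𝓝 q] fun q => Φ (g q) := fun q hq => by
    filter_upwards [ho.mem_nhds hq] with r hr using cutoff_of_ne hr.2
  have hgn : ‖fderiv ℝ g p‖ ≤ m / ‖s p‖ :=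
    (norm_fderiv_log_norm_le (hs p hp).differentiableAt h0).trans
      (div_le_div_of_nonneg_right hm (norm_nonneg _))
  have hk0 : 0 ≤ m / ‖s p‖ := (norm_nonneg _).trans hgn
  constructor
  · refine ContinuousLinearMap.opNorm_le_bound _ (mul_nonneg ((abs_nonneg _).trans hd₁) hk0)
      fun v => ?_
    rw [(heq p hmem).fderiv_eq, fderiv_comp_real hsm (hg.contDiffAt (ho.mem_nhds hmem)),
      norm_mul, mul_assoc]
    exact mul_le_mul hd₁ (((fderiv ℝ g p).le_opNorm v).trans (by gcongr)) (norm_nonneg _)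
      ((abs_nonneg _).trans hd₁)
  · intro v w hv hw
    have hdd : ∀ v w, ddcPair (cutoff Φ s) p v w = ddcPair (fun q => Φ (g q)) p v w := fun v w => by
      have : (fun q => fderiv ℝ (cutoff Φ s) q (-Complex.I • w)) =ᶠ[𝓝 p]
          fun q => fderiv ℝ (fun q => Φ (g q)) q (-Complex.I • w) := by
        filter_upwards [ho.mem_nhds hmem] with q hq
        rw [(heq q hq).fderiv_eq]
      rw [ddcPair, this.fderiv_eq, ddcPair]
    obtain ⟨k, hk, hke⟩ := exists_log_norm_eq_re (hs p hp) h0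
    have hcomm := ddcPair_comm_of_eq_re hk hke v w
    rw [hdd, hdd, ddcPair_comp_real ho hsm hg hmem, ddcPair_comp_real ho hsm hg hmem, hcomm]
    have hp2 : ∀ x y : C2, ‖x‖ = 1 → ‖y‖ = 1 →
        |fderiv ℝ g p x * fderiv ℝ g p y| ≤ (m / ‖s p‖) ^ 2 := fun x y hx hy => by
      rw [abs_mul, sq]
      exact mul_le_mul (abs_fderiv_le hgn hx) (abs_fderiv_le hgn hy) (abs_nonneg _) hk0
    have hv' : ‖-Complex.I • v‖ = 1 := by rw [norm_neg_I_smul, hv]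
    have hw' : ‖-Complex.I • w‖ = 1 := by rw [norm_neg_I_smul, hw]
    rw [add_sub_add_left_eq_sub, ← mul_sub, abs_mul]
    refine mul_le_mul hd₂ ?_ (abs_nonneg _) ((abs_nonneg _).trans hd₂)
    refine (abs_sub _ _).trans ?_
    linarith [hp2 _ _ hv hw', hp2 _ _ hw hv']

end

section

variable {V : Set C2} {s : C2 → ℂ}

/-- The indicator function of the tube `|s| < 2 e^{-j}`. -/
def tube (V : Set C2) (s : C2 → ℂ) (j : ℕ) : C2 → ℝ :=
  {q | q ∈ V ∧ ‖s q‖ < 2 * Real.exp (-j)}.indicator fun _ => 1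

theorem tube_nonneg (j : ℕ) (p : C2) : 0 ≤ tube V s j p :=
  Set.indicator_nonneg (fun _ _ => zero_le_one) p

theorem tube_eq_one {j : ℕ} {p : C2} (hp : p ∈ V) (h : ‖s p‖ < 2 * Real.exp (-j)) :
    tube V s j p = 1 :=
  Set.indicator_of_mem (show p ∈ {q | q ∈ V ∧ ‖s q‖ < 2 * Real.exp (-j)} from ⟨hp, h⟩) _

/-- Logarithmic cut-off: a test form `ψ` is modified near the hypersurface `s = 0` to a test form
whose support does not meet it. The error in `dd^c ψ` is a multiple of `N⁻² |s|⁻²` on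
`e^{-2N} ≤ |s| ≤ e^{-N}`, up to a bounded term on the tube `|s| < 2 e^{-N}`; the factor `|s|⁻²` is
replaced by a dyadic sum over tubes. -/
theorem exists_cutoff_form (hV : IsOpen V) (hs : ∀ p ∈ V, AnalyticAt ℂ s p) {ψ : C2 → Alt 2}
    (hψ : ContDiff ℝ ∞ ψ) (hc : HasCompactSupport ψ) (hsupp : tsupport ψ ⊆ V) :
    ∃ Q R : ℝ, 0 ≤ Q ∧ 0 ≤ R ∧ ∀ N : ℕ, 0 < N → ∃ ψ' : C2 → Alt 2, ContDiff ℝ ∞ ψ' ∧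
      tsupport ψ' ⊆ tsupport ψ ∧ tsupport ψ' ⊆ V ∩ {p | s p ≠ 0} ∧
      ∀ p, |normalizedDdc ψ p - normalizedDdc ψ' p| ≤ Q * tube V s N p + R / N ^ 2 *
        ∑ k ∈ Finset.range (N + 1), Real.exp (2 * ((N + k : ℕ) + 1)) * tube V s (N + k) p := by
  have hh : ∀ p ∈ V, HoloAt s p := fun p hp => (hs p hp).holoAt
  obtain ⟨B, hB0, hB⟩ := exists_transition
  obtain ⟨Q, hQ⟩ := (continuous_normalizedDdc hψ).bounded_above_of_compact_support
    (hasCompactSupport_normalizedDdc hψ hc)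
  obtain ⟨m, hm⟩ := hc.isCompact.exists_bound_of_continuousOn
    (f := fderiv ℂ s) fun p hp => (hs p (hsupp hp)).fderiv.continuousAt.continuousWithinAt
  have hcc : ∀ k l, HasCompactSupport (coeff ψ k l) := fun k l =>
    hc.mono' (subset_closure.trans (tsupport_coeff_subset ψ k l))
  choose M₁ hM₁ using fun i : Fin 4 × Fin 4 =>
    (contDiff_apply_alt hψ ![frame i.1, frame i.2]).continuous.bounded_above_of_compact_support
      (hcc i.1 i.2)
  choose M₂ hM₂ using fun i : Fin 4 × Fin 4 =>
    ((contDiff_apply_alt hψ ![frame i.1, frame i.2]).continuous_fderiv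
      (by simp)).bounded_above_of_compact_support ((hcc i.1 i.2).fderiv ℝ)
  obtain ⟨M₃, hM₃⟩ := Finite.exists_le M₁
  obtain ⟨M₄, hM₄⟩ := Finite.exists_le M₂
  set M := max M₃ M₄ with hM
  have hMa : ∀ p k l, |coeff ψ k l p| ≤ M := fun p k l =>
    (hM₁ (k, l) p).trans ((hM₃ _).trans (le_max_left _ _))
  have hMb : ∀ p k l, ‖fderiv ℝ (coeff ψ k l) p‖ ≤ M := fun p k l =>
    (hM₂ (k, l) p).trans ((hM₄ _).trans (le_max_right _ _))
  have hM0 : 0 ≤ M := (abs_nonneg _).trans (hMa 0 0 0)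
  have hQ0 : 0 ≤ Q := (norm_nonneg _).trans (hQ 0)
  have hm0 : 0 ≤ |m| := abs_nonneg m
  refine ⟨Q, 6 * (4 * (B * |m| * M) + M * (B * (2 * |m| ^ 2))), hQ0, by positivity,
    fun N hN => ?_⟩
  have hN' : (0 : ℝ) < N := by exact_mod_cast hN
  obtain ⟨Φ, hΦs, hΦ01, hΦ0, hΦ1, hΦd, hΦdd, hΦout⟩ := hB N hN
  have hsm := contDiff_cutoff_smul hΦs hΦ0 hV hh hψ hsupp
  have hsub := tsupport_cutoff_smul_subset hΦ0 hh hsupp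
  have hsubψ : tsupport (fun p => cutoff Φ s p • ψ p) ⊆ tsupport ψ :=
    tsupport_smul_subset_right (cutoff Φ s) ψ
  refine ⟨_, hsm, hsubψ, hsub, fun p => ?_⟩
  have hS0 : 0 ≤ ∑ k ∈ Finset.range (N + 1),
      Real.exp (2 * ((N + k : ℕ) + 1)) * tube V s (N + k) p :=
    Finset.sum_nonneg fun k _ => mul_nonneg (Real.exp_pos _).le (tube_nonneg _ _)
  set S := ∑ k ∈ Finset.range (N + 1), Real.exp (2 * ((N + k : ℕ) + 1)) * tube V s (N + k) p
  set R := 6 * (4 * (B * |m| * M) + M * (B * (2 * |m| ^ 2))) with hR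
  have hRS : 0 ≤ R / N ^ 2 * S := mul_nonneg (by positivity) hS0
  have hQt : 0 ≤ Q * tube V s N p := mul_nonneg hQ0 (tube_nonneg _ _)
  by_cases hpK : p ∈ tsupport ψ
  swap
  · rw [normalizedDdc_eq_zero_of_notMem_tsupport hψ hpK,
      normalizedDdc_eq_zero_of_notMem_tsupport hsm fun h => hpK (hsubψ h), sub_zero, abs_zero]
    exact add_nonneg hQt hRS
  have hpV := hsupp hpK
  by_cases h0 : s p = 0
  · rw [normalizedDdc_eq_zero_of_notMem_tsupport hsm fun h => (hsub h).2 h0, sub_zero,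
      tube_eq_one hpV (by rw [h0, norm_zero]; positivity), mul_one]
    exact (hQ p).trans (le_add_of_nonneg_right hRS)
  have hℓ : 0 < ‖s p‖ := norm_pos_iff.mpr h0
  have hmp : ‖fderiv ℂ s p‖ ≤ |m| := (hm p hpK).trans (le_abs_self m)
  have hmain : ∀ d₁ d₂ : ℝ, |deriv Φ (Real.log ‖s p‖)| ≤ d₁ →
      |deriv (deriv Φ) (Real.log ‖s p‖)| ≤ d₂ →
      |normalizedDdc (fun q => cutoff Φ s q • ψ q) p - cutoff Φ s p * normalizedDdc ψ p| ≤
      6 * (4 * (d₁ * (|m| / ‖s p‖) * M) + M * (d₂ * (2 * (|m| / ‖s p‖) ^ 2))) := by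
    intro d₁ d₂ h1 h2
    obtain ⟨hd, he⟩ := cutoff_derivative_bounds hΦs hV hh hpV h0 hmp h1 h2
    exact abs_normalizedDdc_smul_sub_le
      (isOpen_inter_ne hV fun p hp => (hs p hp).continuousAt.continuousWithinAt)
      (contDiffOn_cutoff hΦs hh) hψ hsm ⟨hpV, h0⟩ (hMa p) (hMb p) hd he
  rw [cutoff_of_ne h0] at hmain
  -- the tube contains all points where the cut-off function is not `1`
  have htube : Real.log ‖s p‖ ≤ -N → tube V s N p = 1 := fun h => by
    refine tube_eq_one hpV ?_
    have h1 : ‖s p‖ ≤ Real.exp (-N) := (Real.log_le_iff_le_exp hℓ).mp h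
    have := Real.exp_pos (-(N : ℝ))
    linarith
  have hχ := hΦ01 (Real.log ‖s p‖)
  have hbd : |(1 - Φ (Real.log ‖s p‖)) * normalizedDdc ψ p| ≤ Q := by
    rw [abs_mul, abs_of_nonneg (by linarith [hχ.2])]
    calc _ ≤ 1 * Q := mul_le_mul (by linarith [hχ.1]) (hQ p) (abs_nonneg _) zero_le_one
      _ = Q := one_mul Q
  have htri : |normalizedDdc ψ p - normalizedDdc (fun q => cutoff Φ s q • ψ q) p| ≤
      |(1 - Φ (Real.log ‖s p‖)) * normalizedDdc ψ p| +
      |normalizedDdc (fun q => cutoff Φ s q • ψ q) p -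
        Φ (Real.log ‖s p‖) * normalizedDdc ψ p| := by
    refine le_trans (le_of_eq ?_) (abs_sub _ _)
    congr 1
    ring
  refine htri.trans ?_
  by_cases hout : Real.log ‖s p‖ < -2 * (N : ℝ) ∨ -(N : ℝ) < Real.log ‖s p‖
  · obtain ⟨e1, e2⟩ := hΦout _ hout
    have h1 := hmain 0 0 (by rw [e1, abs_zero]) (by rw [e2, abs_zero])
    simp only [zero_mul, mul_zero, add_zero] at h1
    rcases hout with h | h
    · rw [htube (by linarith), mul_one]
      linarith
    · rw [hΦ1 _ h.le] at h1 ⊢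
      rw [sub_self, zero_mul, abs_zero]
      linarith
  · push Not at hout
    have h1 := hmain _ _ (hΦd _) (hΦdd _)
    -- it makes the terms with one derivative of the cut-off as small as those with two
    have hNℓ : N * ‖s p‖ ≤ 1 := by
      have h2 : ‖s p‖ ≤ Real.exp (-N) := (Real.log_le_iff_le_exp hℓ).mp hout.2
      have h3 : (N : ℝ) ≤ Real.exp N := by linarith [Real.add_one_le_exp (N : ℝ)]
      calc N * ‖s p‖ ≤ Real.exp N * Real.exp (-N) := by gcongr
        _ = 1 := by rw [← Real.exp_add, add_neg_cancel, Real.exp_zero]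
    have hx : (N * ‖s p‖)⁻¹ ≤ ((N : ℝ) ^ 2)⁻¹ * (‖s p‖ ^ 2)⁻¹ := by
      have hx1 : 1 ≤ (N * ‖s p‖)⁻¹ := (one_le_inv₀ (by positivity)).mpr hNℓ
      calc (N * ‖s p‖)⁻¹ ≤ (N * ‖s p‖)⁻¹ * (N * ‖s p‖)⁻¹ :=
            le_mul_of_one_le_left (by positivity) hx1
        _ = _ := by rw [mul_inv]; ring
    have hS := inv_sq_le_dyadic_sum hℓ hout.1 hout.2 (fun j => tube V s j p)
      (fun j => tube_nonneg j p) (fun j hj => tube_eq_one hpV hj)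
    have h2 : 6 * (4 * (B / N * (|m| / ‖s p‖) * M) + M * (B / N ^ 2 * (2 * (|m| / ‖s p‖) ^ 2))) ≤
        R / N ^ 2 * S := by
      calc _ = 6 * (4 * (B * |m| * M) * (N * ‖s p‖)⁻¹ +
            M * (B * (2 * |m| ^ 2)) * (((N : ℝ) ^ 2)⁻¹ * (‖s p‖ ^ 2)⁻¹)) := by
            field_simp
        _ ≤ 6 * (4 * (B * |m| * M) * (((N : ℝ) ^ 2)⁻¹ * (‖s p‖ ^ 2)⁻¹) +
            M * (B * (2 * |m| ^ 2)) * (((N : ℝ) ^ 2)⁻¹ * (‖s p‖ ^ 2)⁻¹)) := by gcongr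
        _ = R / N ^ 2 * (‖s p‖ ^ 2)⁻¹ := by rw [hR]; field_simp
        _ ≤ R / N ^ 2 * S := by gcongr
    rw [htube hout.2, mul_one]
    linarith

/-- A continuous function that is pluriharmonic off a smooth hypersurface is pluriharmonic: the
logarithmic cut-off makes no contribution in the limit, because the hypersurface has real
codimension two. With tubes of volume `O(e^{-2j})` each of the `N + 1` terms of the dyadic sum
contributes `O(1)`, so that the error is `O(1 / N)`. -/
theorem IsWeaklyPluriharmonicOn.of_inter_ne (hV : IsOpen V) {u : C2 → ℝ} (hu : ContinuousOn u V)
    (hs : ∀ p ∈ V, AnalyticAt ℂ s p) {C : ℝ} (hC : 0 ≤ C)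
    (hvol : ∀ r > 0, volume {q | q ∈ V ∧ ‖s q‖ < r} ≤ ENNReal.ofReal (C * r ^ 2))
    (h : IsWeaklyPluriharmonicOn u (V ∩ {p | s p ≠ 0})) : IsWeaklyPluriharmonicOn u V := by
  refine ⟨hu, fun ψ hψ hc hsupp => ?_⟩
  have hsc : ContinuousOn s V := fun p hp => (hs p hp).continuousAt.continuousWithinAt
  obtain ⟨Q, R, hQ, hR, hcut⟩ := exists_cutoff_form hV hs hψ hc hsupp
  obtain ⟨U, hU⟩ := hc.isCompact.exists_bound_of_continuousOn (hu.mono hsupp)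
  have htube : ∀ j : ℕ, Integrable (tube V s j) ∧
      ∫ p, tube V s j p ≤ C * (2 * Real.exp (-j)) ^ 2 := fun j =>
    integral_indicator_sublevel_le hV hsc hC hvol (by positivity)
  set Z := |U| * (4 * Q * C + R * (8 * C * Real.exp 2)) with hZ
  have key : ∀ N : ℕ, 0 < N → |∫ p, u p * normalizedDdc ψ p| ≤ Z / N := by
    intro N hN
    have hN1 : (1 : ℝ) ≤ N := by exact_mod_cast hN
    obtain ⟨ψ', hψ', hsub, hsub', hle⟩ := hcut N hN
    have hc' : HasCompactSupport ψ' := hc.mono' (subset_closure.trans hsub)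
    have e : ∫ p, u p * normalizedDdc ψ p =
        ∫ p, (u p * normalizedDdc ψ p - u p * normalizedDdc ψ' p) := by
      rw [integral_sub (integrable_mul_normalizedDdc hV hu hψ hc hsupp)
        (integrable_mul_normalizedDdc hV hu hψ' hc' (hsub.trans hsupp)),
        h.integral_eq_zero ψ' hψ' hc' hsub', sub_zero]
    set G : C2 → ℝ := fun p => Q * tube V s N p + R / N ^ 2 *
        ∑ k ∈ Finset.range (N + 1), Real.exp (2 * ((N + k : ℕ) + 1)) * tube V s (N + k) p with hG
    have hi1 : Integrable fun p => Q * tube V s N p := (htube N).1.const_mul Q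
    have hi2 : Integrable fun p => R / N ^ 2 *
        ∑ k ∈ Finset.range (N + 1), Real.exp (2 * ((N + k : ℕ) + 1)) * tube V s (N + k) p :=
      (integrable_finsetSum _ fun k _ => (htube (N + k)).1.const_mul _).const_mul _
    have hGi : Integrable G := hi1.add hi2
    have hexp : Real.exp (-N) ≤ 1 / N := by
      rw [Real.exp_neg, ← one_div]
      exact one_div_le_one_div_of_le (by positivity) (by linarith [Real.add_one_le_exp (N : ℝ)])
    have hGint : ∫ p, G p ≤ (4 * Q * C + R * (8 * C * Real.exp 2)) / N := by
      rw [hG, integral_add hi1 hi2, integral_const_mul, integral_const_mul,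
        integral_finsetSum _ fun k _ => (htube (N + k)).1.const_mul _]
      simp only [integral_const_mul]
      have hb1 : Q * ∫ p, tube V s N p ≤ 4 * Q * C / N := by
        have h2 : (2 * Real.exp (-(N : ℝ))) ^ 2 ≤ 4 / N := by
          have h3 : Real.exp (-(N : ℝ)) ≤ 1 := Real.exp_le_one_iff.mpr (by linarith)
          calc (2 * Real.exp (-(N : ℝ))) ^ 2 = 4 * (Real.exp (-N) * Real.exp (-N)) := by ring
            _ ≤ 4 * (1 * (1 / N)) := by gcongr
            _ = 4 / N := by ring
        calc Q * ∫ p, tube V s N p ≤ Q * (C * (4 / N)) :=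
              mul_le_mul_of_nonneg_left ((htube N).2.trans (by gcongr)) hQ
          _ = 4 * Q * C / N := by ring
      have hb2 : ∀ k ∈ Finset.range (N + 1),
          Real.exp (2 * ((N + k : ℕ) + 1)) * ∫ p, tube V s (N + k) p ≤ 4 * C * Real.exp 2 := by
        intro k _
        calc _ ≤ Real.exp (2 * ((N + k : ℕ) + 1)) * (C * (2 * Real.exp (-(N + k : ℕ))) ^ 2) :=
              mul_le_mul_of_nonneg_left (htube (N + k)).2 (Real.exp_pos _).le
          _ = 4 * C * (Real.exp (2 * ((N + k : ℕ) + 1)) *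
              (Real.exp (-(N + k : ℕ)) * Real.exp (-(N + k : ℕ)))) := by ring
          _ = 4 * C * Real.exp 2 := by
              rw [← Real.exp_add, ← Real.exp_add]
              congr 2
              ring
      have hb3 := Finset.sum_le_card_nsmul _ _ _ hb2
      rw [Finset.card_range, nsmul_eq_mul] at hb3
      have hb4 : R / N ^ 2 * ((N + 1 : ℕ) * (4 * C * Real.exp 2)) ≤
          R * (8 * C * Real.exp 2) / N := by
        have : ((N + 1 : ℕ) : ℝ) ≤ 2 * N := by push_cast; linarith
        calc _ ≤ R / N ^ 2 * (2 * N * (4 * C * Real.exp 2)) := by gcongr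
          _ = R * (8 * C * Real.exp 2) / N := by field_simp; ring
      calc _ ≤ 4 * Q * C / N + R / N ^ 2 * ((N + 1 : ℕ) * (4 * C * Real.exp 2)) := by gcongr
        _ ≤ 4 * Q * C / N + R * (8 * C * Real.exp 2) / N := by gcongr
        _ = _ := by ring
    rw [e, ← Real.norm_eq_abs]
    refine (norm_integral_le_of_norm_le (hGi.const_mul |U|)
      (Eventually.of_forall fun p => ?_)).trans ?_
    · rw [← mul_sub, norm_mul]
      by_cases hp : p ∈ tsupport ψ
      · exact mul_le_mul ((hU p hp).trans (le_abs_self U)) (hle p) (norm_nonneg _) (abs_nonneg _)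
      · rw [normalizedDdc_eq_zero_of_notMem_tsupport hψ hp,
          normalizedDdc_eq_zero_of_notMem_tsupport hψ' fun h => hp (hsub h), sub_zero, norm_zero,
          mul_zero]
        exact mul_nonneg (abs_nonneg _) ((abs_nonneg _).trans (hle p))
    · rw [integral_const_mul, hZ, mul_div_assoc]
      exact mul_le_mul_of_nonneg_left hGint (abs_nonneg _)
  have hlim : Tendsto (fun N : ℕ => Z / N) atTop (𝓝 0) := tendsto_const_div_atTop_nhds_zero_nat Z
  have := ge_of_tendsto hlim ((eventually_gt_atTop 0).mono fun N hN => key N hN)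
  exact abs_nonpos_iff.mp this

end

/-! ### The zero section in a chart -/

/-- Near a point of the zero section, the zero section is the smooth hypersurface `X / Y = 0`. In
the affine chart `Y = 1` of the projective plane the curve is `w = s (s - w) (s - t w)`, so
`w = Z / Y` vanishes to third order along `s = X / Y`, and `s` is a coordinate transversal to the
zero section. -/
theorem Chart.exists_zeroSection_equation {c : Chart} {p : C2} (hp : p ∈ c.domain)
    (hP : (c.toFun p).point = 0) : ∃ s : C2 → ℂ, AnalyticAt ℂ s p ∧ fderiv ℂ s p ≠ 0 ∧
      ∀ᶠ q in 𝓝 p, (c.toFun q).point = 0 ↔ s q = 0 := by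
  obtain ⟨F, hF, hFh, hinj⟩ := c.immersion p hp
  have hFi : ∀ i, AnalyticAt ℂ (fun q => F q i) p := fun i =>
    (ContinuousLinearMap.proj (R := ℂ) (φ := fun _ : Fin 3 => ℂ) i).analyticAt _ |>.comp hF
  obtain ⟨hp0, hp1, hp2⟩ := (isHomogeneousCoord_iff_of_eq_zero hP _).mp hFh.self_of_nhds
  have hne := (hFi 1).continuousAt.eventually_ne hp1
  set s : C2 → ℂ := fun q => F q 0 / F q 1 with hs
  set w : C2 → ℂ := fun q => F q 2 / F q 1 with hw
  have hsa : AnalyticAt ℂ s p := (hFi 0).div (hFi 1) hp1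
  have hwa : AnalyticAt ℂ w p := (hFi 2).div (hFi 1) hp1
  have hs0 : s p = 0 := by simp [hs, hp0]
  have hw0 : w p = 0 := by simp [hw, hp2]
  -- the equation of the curve in the affine chart `Y = 1`
  have heq : w =ᶠ[𝓝 p] fun q => s q * ((s q - w q) * (s q - c.t q * w q)) := by
    filter_upwards [hFh, hne] with q hq h1
    by_cases hQ : (c.toFun q).point = 0
    · obtain ⟨h0, -, h2⟩ := (isHomogeneousCoord_iff_of_eq_zero hQ _).mp hq
      simp [hs, hw, h0, h2]
    · obtain ⟨h2, h0, h1'⟩ := (isHomogeneousCoord_iff_of_ne_zero hQ _).mp hq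
      have he := affine_equation hQ
      have hy : affY (c.toFun q) ≠ 0 := fun h => h1 (by rw [h1', h, zero_mul])
      simp only [hs, hw, h0, h1']
      field_simp
      linear_combination he
  refine ⟨s, hsa, fun hds => ?_, ?_⟩
  · obtain ⟨v, hv0, hv⟩ := c.exists_ker_base p
    refine hv0 (hinj v hv ⟨fderiv ℂ (fun q => F q 1) p v / F p 1, ?_⟩)
    have hdsv : fderiv ℂ s p v = 0 := by rw [hds]; rfl
    have hdw : fderiv ℂ w p v = 0 := by
      have hwd := hwa.differentiableAt
      have htd := (c.analyticAt_base p hp).differentiableAt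
      have hsd := hsa.differentiableAt
      rw [heq.fderiv_eq, fderiv_fun_mul hsd
        ((hsd.fun_sub hwd).fun_mul (hsd.fun_sub (htd.fun_mul hwd)))]
      simp [hdsv, hs0, hw0]
    have hcomp : ∀ i, fderiv ℂ F p v i = fderiv ℂ (fun q => F q i) p v := fun i => by
      rw [fderiv_apply hF.differentiableAt]; rfl
    have e0 : (fun q => F q 0) =ᶠ[𝓝 p] fun q => s q * F q 1 := by
      filter_upwards [hne] with q h
      rw [hs, div_mul_cancel₀ _ h]
    have e2 : (fun q => F q 2) =ᶠ[𝓝 p] fun q => w q * F q 1 := by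
      filter_upwards [hne] with q h
      rw [hw, div_mul_cancel₀ _ h]
    funext i
    fin_cases i
    · simp only [Fin.zero_eta, Pi.smul_apply, smul_eq_mul]
      rw [hcomp, e0.fderiv_eq, fderiv_fun_mul hsa.differentiableAt (hFi 1).differentiableAt, hp0]
      simp [hdsv, hs0]
    · simp only [Fin.mk_one, Pi.smul_apply, smul_eq_mul]
      rw [hcomp, div_mul_cancel₀ _ hp1]
    · simp only [Fin.reduceFinMk, Pi.smul_apply, smul_eq_mul]
      rw [hcomp, e2.fderiv_eq, fderiv_fun_mul hwa.differentiableAt (hFi 1).differentiableAt, hp2]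
      simp [hdw, hw0]
  · filter_upwards [hFh, hne] with q hq h1
    refine ⟨fun hQ => ?_, fun h => ?_⟩
    · simp [hs, ((isHomogeneousCoord_iff_of_eq_zero hQ _).mp hq).1]
    · by_contra hQ
      obtain ⟨h2, h0, h1'⟩ := (isHomogeneousCoord_iff_of_ne_zero hQ _).mp hq
      have hx : affX (c.toFun q) = 0 := by
        have := (div_eq_zero_iff.mp h).resolve_right h1
        rw [h0] at this
        exact (mul_eq_zero.mp this).resolve_right h2
      have he := affine_equation hQ
      rw [hx, zero_mul, zero_mul] at he
      exact h1 (by rw [h1', pow_eq_zero_iff two_ne_zero |>.mp he, zero_mul])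

/-! ### Localization of currents -/

/-- The product of a test form with a smooth function. -/
def smulTestForm {Ω : Opens C2} (f : C2 → ℝ) (hf : ContDiff ℝ ∞ f) (ψ : 𝓓(Ω, Alt 2)) :
    𝓓(Ω, Alt 2) where
  toFun p := f p • ψ p
  contDiff' := ContDiff.smul (n := ∞) hf ψ.contDiff
  hasCompactSupport' :=
    ψ.hasCompactSupport.mono' (subset_closure.trans (tsupport_smul_subset_right f ψ))
  tsupport_subset' := (tsupport_smul_subset_right f ψ).trans ψ.tsupport_subset

/-- A current that vanishes locally vanishes. -/
theorem current_eq_zero_of_local {Ω : Opens C2} (S : Current Ω)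
    (h : ∀ p ∈ Ω, ∃ W : Set C2, IsOpen W ∧ p ∈ W ∧ ∀ ψ : 𝓓(Ω, Alt 2), tsupport ψ ⊆ W → S ψ = 0) :
    S = 0 := by
  ext ψ
  choose! W hWo hpW hW using h
  obtain ⟨f, hf⟩ := SmoothPartitionOfUnity.exists_isSubordinate (modelWithCornersSelf ℝ C2)
    (isClosed_tsupport ψ) (fun p : Ω => W p) (fun p => hWo p p.2) fun p hp =>
      Set.mem_iUnion.mpr ⟨⟨p, ψ.tsupport_subset hp⟩, hpW p (ψ.tsupport_subset hp)⟩
  have hsm : ∀ i, ContDiff ℝ ∞ (f i) := fun i => (f i).contMDiff.contDiff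
  have hfin := f.locallyFinite.finite_nonempty_inter_compact ψ.hasCompactSupport
  have hψ : ψ = ∑ i ∈ hfin.toFinset, smulTestForm (f i) (hsm i) ψ := by
    ext1 p
    have hev : (∑ i ∈ hfin.toFinset, smulTestForm (f i) (hsm i) ψ) p =
        ∑ i ∈ hfin.toFinset, f i p • ψ p := by
      simp [smulTestForm]
    rw [hev, ← Finset.sum_smul]
    by_cases hp : p ∈ tsupport ψ
    · rw [f.sum_finsupport' p hp, one_smul]
      intro i hi
      rw [hfin.mem_toFinset]
      exact ⟨p, f.mem_finsupport p |>.mp hi, hp⟩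
    · rw [image_eq_zero_of_notMem_tsupport hp, smul_zero]
  rw [hψ, map_sum]
  simp only [zero_apply]
  exact Finset.sum_eq_zero fun i _ => hW i i.2 _
    ((tsupport_smul_subset_left (f i) ψ).trans (hf i))

/-! ### The current of `dβ₁ ∧ dβ₂` -/

theorem continuousOn_wedgeD {V : Set C2} (hV : IsOpen V) {f g : C2 → ℝ} (hf : ContDiffOn ℝ ∞ f V)
    (hg : ContDiffOn ℝ ∞ g V) : ContinuousOn (wedgeD f g) V := by
  have hf' : ContinuousOn (fderiv ℝ f) V := hf.continuousOn_fderiv_of_isOpen hV (by simp)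
  have hg' : ContinuousOn (fderiv ℝ g) V := hg.continuousOn_fderiv_of_isOpen hV (by simp)
  let P : ContinuousMultilinearMap ℝ (fun _ : Fin 2 => C2 →L[ℝ] ℝ)
      (ContinuousMultilinearMap ℝ (fun _ : Fin 2 => C2) ℝ) :=
    (ContinuousLinearMap.apply ℝ _ (ContinuousMultilinearMap.mkPiAlgebra ℝ (Fin 2) ℝ)
      ).compContinuousMultilinearMap
      (ContinuousMultilinearMap.compContinuousLinearMapContinuousMultilinear ℝ
        (fun _ : Fin 2 => C2) (fun _ => ℝ) ℝ)
  have hpair : ∀ {a b : C2 → C2 →L[ℝ] ℝ}, ContinuousOn a V → ContinuousOn b V →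
      ContinuousOn (fun p => P ![a p, b p]) V := fun ha hb =>
    P.cont.comp_continuousOn (continuousOn_pi.mpr fun i => by fin_cases i <;> assumption)
  rw [ContinuousAlternatingMap.isEmbedding_toContinuousMultilinearMap.isInducing.continuousOn_iff]
  refine ((hpair hf' hg').sub (hpair hg' hf')).congr fun p _ => ?_
  ext v
  have h1 : (wedgeD f g p).toContinuousMultilinearMap v = wedgeD f g p v := rfl
  simp only [Function.comp, h1, wedgeD_apply]
  simp [P, Fin.prod_univ_two]
  ring

theorem integrable_wedge {V : Set C2} (hV : IsOpen V) {η : C2 → Alt 2} (hη : ContinuousOn η V)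
    {ψ : C2 → Alt 2} (hψ : Continuous ψ) (hc : HasCompactSupport ψ) (hs : tsupport ψ ⊆ V) :
    Integrable fun p => wedge (ψ p) (η p) := by
  have hsub : tsupport (fun p => wedge (ψ p) (η p)) ⊆ tsupport ψ := by
    refine closure_mono fun p hp h0 => hp ?_
    simp only [h0, map_zero, zero_apply]
  have hcont : Continuous fun p => wedge (ψ p) (η p) := by
    refine continuous_of_tsupport fun p hp => ?_
    have hpV := hs (hsub hp)
    exact (wedge.continuous.continuousAt.comp hψ.continuousAt).clm_apply
      (hη.continuousAt (hV.mem_nhds hpV))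
  exact hcont.integrable_of_hasCompactSupport (hc.mono' (subset_closure.trans hsub))

/-- For a continuous function the local integrability in `HasPotentialOn` is automatic, and the
integral over `V` is the one over the whole space. -/
theorem hasPotentialOn_iff {Ω : Opens C2} {T : Current Ω} {V : Set C2} (hV : IsOpen V)
    {u : C2 → ℝ} (hu : ContinuousOn u V) : HasPotentialOn T V u ↔
      ∀ ψ : 𝓓(Ω, Alt 2), tsupport ψ ⊆ V → T ψ = ∫ p, u p * normalizedDdc ψ p := by
  have : ∀ ψ : 𝓓(Ω, Alt 2), tsupport ψ ⊆ V →
      ∫ p in V, u p * normalizedDdc ψ p = ∫ p, u p * normalizedDdc ψ p := fun ψ hs =>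
    setIntegral_mul_normalizedDdc ψ.contDiff hs u
  constructor
  · intro h ψ hs
    rw [h.2 ψ hs, this ψ hs]
  · intro h
    exact ⟨hu.locallyIntegrableOn hV.measurableSet, fun ψ hs => by rw [h ψ hs, this ψ hs]⟩

section BettiBranch

variable {c : Chart} {D : Set ℂ} {L : ℂ → PeriodPair} {β₁ β₂ : C2 → ℝ}

namespace IsBettiBranch

variable (hL : IsPeriodFamily D L) (hβ : IsBettiBranch c D L β₁ β₂)
include hL hβ

/-- The current of `dβ₁ ∧ dβ₂` has the potential `π β₂² Im τ`. -/
theorem formCurrent_apply (ψ : 𝓓(c.domain, Alt 2)) :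
    formCurrent c.domain (wedgeD β₁ β₂) ψ = ∫ p, bettiPotential c L β₂ p * normalizedDdc ψ p := by
  have hη := continuousOn_wedgeD c.domain.isOpen hβ.smooth₁ hβ.smooth₂
  rw [formCurrent, TestFunction.integralAgainstBilinCLM_eq_integral
    (hη.locallyIntegrableOn c.domain.isOpen.measurableSet),
    ← setIntegral_mul_normalizedDdc ψ.contDiff ψ.tsupport_subset]
  exact (integral_mul_normalizedDdc_of_smooth c.domain.isOpen (hβ.contDiffOn_bettiPotential hL)
    (fun p hp v w => hβ.ddcPair_bettiPotential hL hp v w) ψ.contDiff ψ.hasCompactSupport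
    ψ.tsupport_subset (integrable_wedge c.domain.isOpen hη ψ.continuous ψ.hasCompactSupport
      ψ.tsupport_subset)).symm

theorem continuousOn_bettiPotential : ContinuousOn (bettiPotential c L β₂) c.domain :=
  (hβ.contDiffOn_bettiPotential hL).continuousOn

theorem continuousOn_neronHeight : ContinuousOn (fun p => neronHeight (c.toFun p)) c.affine :=
  (((hβ.isWeaklyPluriharmonicOn_neronHeight_sub hL).continuousOn.add
    ((hβ.continuousOn_bettiPotential hL).mono fun _ hp => hp.1))).congr fun p _ =>
      (sub_add_cancel (neronHeight (c.toFun p)) (bettiPotential c L β₂ p)).symm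

/-- Off the zero section, the potentials `H_N` and `π β₂² Im τ` define the same current. -/
theorem integral_neronHeight_mul {ψ : C2 → Alt 2} (hψ : ContDiff ℝ ∞ ψ) (hc : HasCompactSupport ψ)
    (hs : tsupport ψ ⊆ c.affine) : ∫ p, neronHeight (c.toFun p) * normalizedDdc ψ p =
      ∫ p, bettiPotential c L β₂ p * normalizedDdc ψ p := by
  have h := (hβ.isWeaklyPluriharmonicOn_neronHeight_sub hL).integral_eq_zero ψ hψ hc hs
  simp only [sub_mul] at h
  rwa [integral_sub (integrable_mul_normalizedDdc c.isOpen_affine (hβ.continuousOn_neronHeight hL)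
    hψ hc hs) (integrable_mul_normalizedDdc c.domain.isOpen (hβ.continuousOn_bettiPotential hL)
    hψ hc (hs.trans fun _ hp => hp.1)), sub_eq_zero] at h

theorem isDeMarcoMavraki_formCurrent :
    IsDeMarcoMavraki c (formCurrent c.domain (wedgeD β₁ β₂)) := by
  refine ⟨fun p hp => ⟨c.domain, c.domain.isOpen, hp, subset_rfl, bettiPotential c L β₂,
    hβ.continuousOn_bettiPotential hL, (hasPotentialOn_iff c.domain.isOpen
      (hβ.continuousOn_bettiPotential hL)).mpr fun ψ _ => hβ.formCurrent_apply hL ψ⟩,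
    (hasPotentialOn_iff c.isOpen_affine (hβ.continuousOn_neronHeight hL)).mpr fun ψ hs => ?_⟩
  rw [hβ.formCurrent_apply hL, hβ.integral_neronHeight_mul hL ψ.contDiff ψ.hasCompactSupport hs]

/-- The difference between a continuous potential and `π β₂² Im τ` is pluriharmonic, also across
the zero section. -/
theorem exists_isWeaklyPluriharmonicOn_sub {T : Current c.domain} (hT : IsDeMarcoMavraki c T)
    {V : Set C2} (hV : IsOpen V) (hVc : V ⊆ c.domain) {g : C2 → ℝ} (hg : ContinuousOn g V)
    (hpot : HasPotentialOn T V g) {p : C2} (hp : p ∈ V) : ∃ W, IsOpen W ∧ p ∈ W ∧ W ⊆ V ∧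
      IsWeaklyPluriharmonicOn (fun q => g q - bettiPotential c L β₂ q) W := by
  have hh := hβ.continuousOn_bettiPotential hL
  have hoff : ∀ W ⊆ V ∩ c.affine,
      IsWeaklyPluriharmonicOn (fun q => g q - bettiPotential c L β₂ q) W := by
    refine fun W hW => ⟨(hg.mono fun q hq => (hW hq).1).sub (hh.mono fun q hq => (hW hq).2.1),
      fun ψ hψ hc hs => ?_⟩
    have hsV : tsupport ψ ⊆ V := fun q hq => (hW (hs hq)).1
    have hsA : tsupport ψ ⊆ c.affine := fun q hq => (hW (hs hq)).2
    let ψ' : 𝓓(c.domain, Alt 2) := ⟨ψ, hψ, hc, hsV.trans hVc⟩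
    have h1 := (hasPotentialOn_iff hV hg).mp hpot ψ' hsV
    have h2 := (hasPotentialOn_iff c.isOpen_affine (hβ.continuousOn_neronHeight hL)).mp hT.2 ψ' hsA
    have h3 := hβ.integral_neronHeight_mul hL hψ hc hsA
    simp only [sub_mul]
    rw [integral_sub (integrable_mul_normalizedDdc hV hg hψ hc hsV)
      (integrable_mul_normalizedDdc c.domain.isOpen hh hψ hc (hsV.trans hVc)), ← h3, sub_eq_zero]
    exact h1.symm.trans h2
  by_cases hP : (c.toFun p).point = 0
  · obtain ⟨s, hs, hds, hiff⟩ := Chart.exists_zeroSection_equation (hVc hp) hP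
    obtain ⟨W₀, hW₀, hpW₀, C, hC, hvol⟩ := exists_volume_sublevel_le hs hds
    obtain ⟨W, hW, hWo, hpW⟩ := mem_nhds_iff.mp (inter_mem (inter_mem (hW₀.mem_nhds hpW₀)
      (hV.mem_nhds hp)) (hs.eventually_analyticAt.and hiff))
    refine ⟨W, hWo, hpW, fun q hq => (hW hq).1.2, ?_⟩
    refine IsWeaklyPluriharmonicOn.of_inter_ne hWo ((hg.mono fun q hq => (hW hq).1.2).sub
      (hh.mono fun q hq => hVc (hW hq).1.2)) (fun q hq => (hW hq).2.1) hC (fun r hr =>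
        (measure_mono (fun q (hq : q ∈ W ∧ ‖s q‖ < r) => (⟨(hW hq.1).1.1, hq.2⟩ :
          q ∈ W₀ ∧ ‖s q‖ < r))).trans (hvol r hr)) (hoff _ ?_)
    exact fun q hq => ⟨(hW hq.1).1.2, hVc (hW hq.1).1.2, fun h0 => hq.2 ((hW hq.1).2.2.mp h0)⟩
  · exact ⟨V ∩ c.affine, hV.inter c.isOpen_affine, ⟨hp, hVc hp, hP⟩, Set.inter_subset_left,
      hoff _ subset_rfl⟩

theorem eq_formCurrent {T : Current c.domain} (hT : IsDeMarcoMavraki c T) :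
    T = formCurrent c.domain (wedgeD β₁ β₂) := by
  rw [← sub_eq_zero]
  refine current_eq_zero_of_local _ fun p hp => ?_
  obtain ⟨V, hV, hpV, hVc, g, hg, hpot⟩ := hT.1 p hp
  obtain ⟨W, hW, hpW, hWV, hu⟩ :=
    hβ.exists_isWeaklyPluriharmonicOn_sub hL hT hV hVc hg hpot hpV
  refine ⟨W, hW, hpW, fun ψ hs => ?_⟩
  have h1 := (hasPotentialOn_iff hV hg).mp hpot ψ (hs.trans hWV)
  have h2 := hu.integral_eq_zero ψ ψ.contDiff ψ.hasCompactSupport hs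
  simp only [sub_mul] at h2
  rw [integral_sub (integrable_mul_normalizedDdc hV hg ψ.contDiff ψ.hasCompactSupport
    (hs.trans hWV)) (integrable_mul_normalizedDdc c.domain.isOpen
      (hβ.continuousOn_bettiPotential hL) ψ.contDiff ψ.hasCompactSupport ψ.tsupport_subset)] at h2
  rw [sub_apply, h1, hβ.formCurrent_apply hL, h2]

end IsBettiBranch

end BettiBranch

end LegendreCurrent

end

theorem mainTheorem8 (c : LegendreCurrent.Chart) (D : Set ℂ) (L : ℂ → PeriodPair)
    (hL : LegendreCurrent.IsPeriodFamily D L) (β₁ β₂ : LegendreCurrent.C2 → ℝ)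
    (hβ : LegendreCurrent.IsBettiBranch c D L β₁ β₂)
    (T : LegendreCurrent.Current c.domain) :
    LegendreCurrent.IsDeMarcoMavraki c T ↔
      T = LegendreCurrent.formCurrent c.domain (LegendreCurrent.wedgeD β₁ β₂) := by
  constructor
  · exact hβ.eq_formCurrent hL
  · rintro rfl
    exact hβ.isDeMarcoMavraki_formCurrent hL
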